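/- For an oriented knot $K$ in $S^3$ let $c(K)$ be its crossing number, let $V_K(t)$ be its Jones polynomial, and let $$v_3(K)=-\frac{1}{144}V_K'''(1)-\frac{1}{48}V_K''(1)$$ (so that $4v_3$ is the primitive finite type invariant of degree $3$; the normalization is such that $4v_3=1$ for the trefoil with positive crossings). Then for every knot $K$ $$-\frac{1}{24}\bigl(c(K)^3-c(K)\bigr)\le 4v_3(K)\le \frac{1}{24}\bigl(c(K)^3-c(K)\bigr).$$ This bound, conjectured by Willerton, is optimal: for every odd integer $p$ the $(2,p)$-torus knot $T_{2,p}$ (the closure of the $2$-braid $\sigma_1^p$, all of whose crossings have the sign of $p$) satisfies $$4v_3(T_{2,p})=\operatorname{sgn}(p)\,\frac{c(T_{2,p})^3-c(T_{2,p})}{24},$$ where $c(T_{2,p})=|p|$ if $|p|\neq 1$ (and $T_{2,\pm1}$ is the unknot, with $c=0$). -/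

import Mathlib

/-!
# Knots through diagrams, the Jones polynomial, and the degree three invariant

An oriented knot diagram on the sphere is determined, up to orientation preserving homeomorphism of
the sphere, by its signed Gauss code: travel once along the knot from a base point and write, at
every passage through a crossing, the name of the crossing, whether we pass over or under, and the
sign of the crossing.  The signed Gauss codes that come from diagrams are those whose associated
closed oriented surface is a sphere.  An oriented knot type is a class of diagrams modulo the
Reidemeister moves.
-/

namespace KnotTheory

/-- One passage of a knot diagram through a crossing: the name of the crossing, whether this is the
passage over (`true`) or under (`false`), and the sign of the crossing. -/
@[ext]
structure Letter where
  label : ℕ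
  isOver : Bool
  sign : ℤˣ

/-- The other passage through the same crossing. -/
def Letter.flip (x : Letter) : Letter := ⟨x.label, !x.isOver, x.sign⟩

/-- Rename the crossing. -/
def Letter.relabel (f : ℕ → ℕ) (x : Letter) : Letter := ⟨f x.label, x.isOver, x.sign⟩

/-- A signed Gauss code: every crossing is passed exactly twice, once over and once under, and the
two passages record the same sign. -/
structure IsGaussCode (w : List Letter) : Prop where
  nodup : w.Nodup
  flip_mem : ∀ x ∈ w, x.flip ∈ w
  sign_eq : ∀ x ∈ w, ∀ y ∈ w, x.label = y.label → x.sign = y.sign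

/-- The crossings of a Gauss code. -/
def crossings (w : List Letter) : Finset ℕ := (w.map Letter.label).toFinset

/-- The writhe: the sum of the signs of the crossings, each counted at its overpass. -/
def writhe (w : List Letter) : ℤ :=
  ((w.filter fun x => x.isOver).map fun x => (x.sign : ℤ)).sum

/-! ### The edges of a diagram

Cut the knot at the base point.  The code `w` of length `m` cuts the knot into `m + 1` arcs, indexed
by `Fin (m + 1)`; the passage `i : Fin m` comes in along the arc `i.castSucc` and goes out along the
arc `i.succ`.  The first and the last arc are joined at the base point.  -/

/-- Adjacency of the sides of arcs along the boundary of the faces of the diagram; `(a, true)` is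
the left side of the arc `a` and `(a, false)` its right side.  At a crossing with passages `i`, `j`
such that the pair (direction of `i`, direction of `j`) is positively oriented (`i` is the overpass
at a positive crossing, and the underpass at a negative crossing), the four corners join the
left of outgoing `i` to the right of outgoing `j`, the left of incoming `i` to the left of
outgoing `j`, the right of incoming `i` to the left of incoming `j`, and the right of outgoing `i`
to the right of incoming `j`. -/
inductive FaceRel (w : List Letter) :
    Fin (w.length + 1) × Bool → Fin (w.length + 1) × Bool → Prop
  | base (s : Bool) : FaceRel w (0, s) (Fin.last _, s)
  | out_out (i j : Fin w.length) (hij : w.get j = (w.get i).flip)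
      (hi : (w.get i).isOver = true ↔ (w.get i).sign = 1) :
      FaceRel w (i.succ, true) (j.succ, false)
  | in_out (i j : Fin w.length) (hij : w.get j = (w.get i).flip)
      (hi : (w.get i).isOver = true ↔ (w.get i).sign = 1) :
      FaceRel w (i.castSucc, true) (j.succ, true)
  | in_in (i j : Fin w.length) (hij : w.get j = (w.get i).flip)
      (hi : (w.get i).isOver = true ↔ (w.get i).sign = 1) :
      FaceRel w (i.castSucc, false) (j.castSucc, true)
  | out_in (i j : Fin w.length) (hij : w.get j = (w.get i).flip)
      (hi : (w.get i).isOver = true ↔ (w.get i).sign = 1) :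
      FaceRel w (i.succ, false) (j.castSucc, false)

/-- The number of faces of the closed surface that carries the diagram, that is, the number of
boundary circles of the ribbon neighbourhood of the underlying 4-valent graph. -/
noncomputable def numFaces (w : List Letter) : ℕ := Nat.card (Quot (FaceRel w))

/-- The carrying surface, which is connected, is a sphere.  With `n` crossings there are `n`
vertices and `2 n` edges, so Euler's formula `n - 2 n + F = 2` reads `F = n + 2` (this also holds
for the circle without crossings, which bounds two faces). -/
def IsPlanar (w : List Letter) : Prop := numFaces w = (crossings w).card + 2

/-- An oriented knot diagram (on the sphere, with a base point), as a signed Gauss code. -/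
structure Diagram where
  code : List Letter
  isGaussCode : IsGaussCode code
  isPlanar : IsPlanar code

/-- The number of crossings of a diagram. -/
def Diagram.numCrossings (D : Diagram) : ℕ := (crossings D.code).card

/-! ### Reidemeister moves and knots -/

/-- The two passages `x`, `y` in this order if `e = 1` and in the opposite order if `e = -1`. -/
def strand (e : ℤˣ) (x y : Letter) : List Letter := if e = 1 then [x, y] else [y, x]

/-- Elementary moves on signed Gauss codes. Between codes of diagrams on the sphere these are the
change of base point, the renaming of crossings, and the three Reidemeister moves, with all choices
of orientation.

In the third move, the top strand crosses over the middle strand at `a` and over the bottom strand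
at `b`, and the middle strand crosses over the bottom strand at `c`; `εa`, `εb`, `εc` are the signs
of these crossings, and `t`, `m`, `u` say in which order the top, middle and bottom strand run
through their two crossings.  The equations `t m εa = t u εb = m u εc` say that the three segments
bound a triangular face: the three products are the orientation of the triangle `a b c` as computed
at its three corners.  The move pushes one strand across the opposite crossing, which reverses the
order on each strand.  The three strands occur along the knot in one of two cyclic orders. -/
inductive Move : List Letter → List Letter → Prop
  | rotate (A B : List Letter) : Move (A ++ B) (B ++ A)
  | relabel (f : Equiv.Perm ℕ) (A : List Letter) : Move A (A.map (Letter.relabel f))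
  | r1 (A B : List Letter) (x : Letter) : Move (A ++ B) (A ++ [x, x.flip] ++ B)
  | r2_parallel (A B C : List Letter) (x y : Letter)
      (hover : x.isOver = y.isOver) (hsign : y.sign = -x.sign) :
      Move (A ++ B ++ C) (A ++ [x, y] ++ B ++ [x.flip, y.flip] ++ C)
  | r2_antiparallel (A B C : List Letter) (x y : Letter)
      (hover : x.isOver = y.isOver) (hsign : y.sign = -x.sign) :
      Move (A ++ B ++ C) (A ++ [x, y] ++ B ++ [y.flip, x.flip] ++ C)
  | r3 (A B C D : List Letter) (a b c : ℕ) (εa εb εc t m u : ℤˣ)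
      (hab : t * m * εa = t * u * εb) (hbc : t * u * εb = m * u * εc) :
      Move
        (A ++ strand t ⟨a, true, εa⟩ ⟨b, true, εb⟩ ++ B ++
          strand m ⟨a, false, εa⟩ ⟨c, true, εc⟩ ++ C ++
          strand u ⟨b, false, εb⟩ ⟨c, false, εc⟩ ++ D)
        (A ++ strand (-t) ⟨a, true, εa⟩ ⟨b, true, εb⟩ ++ B ++
          strand (-m) ⟨a, false, εa⟩ ⟨c, true, εc⟩ ++ C ++
          strand (-u) ⟨b, false, εb⟩ ⟨c, false, εc⟩ ++ D)
  | r3' (A B C D : List Letter) (a b c : ℕ) (εa εb εc t m u : ℤˣ)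
      (hab : t * m * εa = t * u * εb) (hbc : t * u * εb = m * u * εc) :
      Move
        (A ++ strand t ⟨a, true, εa⟩ ⟨b, true, εb⟩ ++ B ++
          strand u ⟨b, false, εb⟩ ⟨c, false, εc⟩ ++ C ++
          strand m ⟨a, false, εa⟩ ⟨c, true, εc⟩ ++ D)
        (A ++ strand (-t) ⟨a, true, εa⟩ ⟨b, true, εb⟩ ++ B ++
          strand (-u) ⟨b, false, εb⟩ ⟨c, false, εc⟩ ++ C ++
          strand (-m) ⟨a, false, εa⟩ ⟨c, true, εc⟩ ++ D)

/-- Two diagrams are equivalent if they are joined by a finite sequence of moves and inverse moves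
through diagrams on the sphere. -/
def diagramSetoid : Setoid Diagram :=
  Relation.EqvGen.setoid fun D D' => Move D.code D'.code

/-- An (oriented, classical) knot type. -/
def Knot : Type := Quotient diagramSetoid

/-- The knot type represented by a diagram. -/
def Diagram.toKnot (D : Diagram) : Knot := Quotient.mk diagramSetoid D

/-- The crossing number `c(K)`: the least number of crossings of a diagram of `K`. -/
noncomputable def Knot.crossingNumber (K : Knot) : ℕ :=
  sInf {n | ∃ D : Diagram, D.toKnot = K ∧ D.numCrossings = n}

/-! ### The Jones polynomial -/

/-- Adjacency of arcs along the circles of the Kauffman state in which the crossings in `S` get the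
`A`-smoothing and the other ones the `B`-smoothing.  At a positive crossing the `A`-smoothing is the
one that respects the orientation (it joins incoming arcs to outgoing ones), at a negative crossing
it is the `B`-smoothing. -/
inductive StateRel (w : List Letter) (S : Finset ℕ) :
    Fin (w.length + 1) → Fin (w.length + 1) → Prop
  | base : StateRel w S 0 (Fin.last _)
  | oriented (i j : Fin w.length) (hij : w.get j = (w.get i).flip)
      (hi : (w.get i).label ∈ S ↔ (w.get i).sign = 1) :
      StateRel w S i.castSucc j.succ
  | in_in (i j : Fin w.length) (hij : w.get j = (w.get i).flip)
      (hi : ¬ ((w.get i).label ∈ S ↔ (w.get i).sign = 1)) :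
      StateRel w S i.castSucc j.castSucc
  | out_out (i j : Fin w.length) (hij : w.get j = (w.get i).flip)
      (hi : ¬ ((w.get i).label ∈ S ↔ (w.get i).sign = 1)) :
      StateRel w S i.succ j.succ

/-- The number of circles of a Kauffman state. -/
noncomputable def numCircles (w : List Letter) (S : Finset ℕ) : ℕ := Nat.card (Quot (StateRel w S))

/-- The Kauffman bracket at `A`, normalized to be `1` on the circle without crossings: the sum over
all states of `A ^ (a - b) * (-A ^ 2 - A ^ (-2)) ^ (circles - 1)`, where `a` and `b` are the numbers
of `A`- and `B`-smoothings. -/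
noncomputable def kauffmanBracket (w : List Letter) (A : ℝ) : ℝ :=
  ∑ S ∈ (crossings w).powerset,
    A ^ ((S.card : ℤ) - ((crossings w \ S).card : ℤ)) *
      (-A ^ 2 - A ^ (-2 : ℤ)) ^ (numCircles w S - 1)

/-- The Jones polynomial `V(t)`, as a function of `t > 0`: the normalized bracket
`(-A ^ 3) ^ (-writhe) * ⟨D⟩` at `A = t ^ (-1/4)`. -/
noncomputable def Diagram.jones (D : Diagram) (t : ℝ) : ℝ :=
  (-(t ^ (-(1 / 4) : ℝ)) ^ 3) ^ (-writhe D.code) * kauffmanBracket D.code (t ^ (-(1 / 4) : ℝ))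

/-- The degree three finite type invariant `v₃ = - V'''(1) / 144 - V''(1) / 48`. -/
noncomputable def Diagram.v3 (D : Diagram) : ℝ :=
  -(1 / 144) * iteratedDeriv 3 D.jones 1 - (1 / 48) * iteratedDeriv 2 D.jones 1

/-! ### The `(2,p)`-torus knots -/

/-- The Gauss code of the closure of the 2-braid `σ₁ ^ p`, for `p` odd, that is, of the standard
diagram of the `(2,p)`-torus knot: with `n = |p|`, the knot runs twice through the crossings
`0, …, n - 1`, alternately over and under, and all crossings have the sign of `p`. -/
def torusCode (p : ℤ) : List Letter :=
  (List.range (2 * p.natAbs)).map fun k =>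
    ⟨k % p.natAbs, k % 2 == 0, if 0 < p then 1 else -1⟩

end KnotTheory

/-! The proof rewrites 4v₃ as a weighted count of triples of crossings and bounds that count one
triple at a time.

Make the crossings of a diagram the vertices of a directed graph: two crossings are joined when they
interlace in the Gauss code, and the over/under data orient the edge. The result is a skew matrix T
with entries -1, 0, 1 (`overInterlacement`). Let s be the signs of the crossings.
`Diagram.v3_eq_codeWeight` says that 48·4v₃ is the sum over ordered triples of s i * s j * s k times
a weight, which is 8 on a cyclic triangle, 2 on an induced directed path and 0 otherwise. So 4v₃
counts cyclic triangles, plus a quarter of the induced directed paths, all with signs.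

For σ = ±1, σ times the weight is at most 2 + 2σ(ab + bc + ca) (`mul_weight_le`). On the sphere the
sums ∑ s j * T i j over a row vanish (`Diagram.sum_row`), because the two loops at a crossing have
intersection number zero. Hence the products ab, bc, ca sum to nothing. The n triples i = j = k have
weight 0, which lowers the constant part from 2n³ to 2(n³ - n). If all pairs interlace and all signs
agree, every triple is an equality: T is then a regular tournament, with the largest possible number
of cyclic triangles. The torus diagrams are of this kind. The triple sum is invariant under the
moves (`Move.codeWeight_eq`), so the bound may be read off a minimal diagram.

To get the triple formula, write the number of circles of a Kauffman state as one plus the nullity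
k, over the field with two elements, of the interlacement matrix with 1 added on the diagonal at the
crossings smoothed against the orientation (`IsGaussCode.numCircles_eq`). Near t = 1 the Jones
polynomial is then a sum of terms t^(-Y/4) (t^(1/2) + t^(-1/2))^k, with Y a signed sum of centred
spins, and v₃ is the average of Y³ + 12kY - 16Y for the weights (-1)^n (-2)^k, whose total mass is 1
(`v3_eq_mean`, `mean_one`). Schur complements give the moments of the spins explicitly. The average
of kY reduces to the change of the mean nullity `kappa` when one crossing is smoothed against the
orientation.

Topology enters in that change. For a curve on the sphere `kappa` equals the length plus six times
`Phi`, a sum over interlaced pairs of crossings (`kappa_eq_Phi`), because both sides obey the same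
recursion under smoothings. Planarity is used through one statement: every system of edge weights
satisfying Kirchhoff's law comes from a colouring of the faces (`IsGaussCode.isColourable`). This
property survives smoothings and forces the required intersection numbers to vanish. -/

namespace KnotTheory

open Finset Module

/-! ### Nullities of symmetric matrices over the field with two elements -/

/-- The kernel of the matrix `M`, restricted to the rows and columns in `V`. -/
def solSpace (V : Finset ℕ) (M : ℕ → ℕ → ZMod 2) : Submodule (ZMod 2) (ℕ → ZMod 2) where
  carrier := {x | (∀ v, v ∉ V → x v = 0) ∧ ∀ v ∈ V, ∑ u ∈ V, M v u * x u = 0}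
  add_mem' := by
    rintro x y ⟨hx, hx'⟩ ⟨hy, hy'⟩
    refine ⟨fun v hv => by simp [hx v hv, hy v hv], fun v hv => ?_⟩
    simp [mul_add, sum_add_distrib, hx' v hv, hy' v hv]
  zero_mem' := by simp
  smul_mem' := by
    rintro c x ⟨hx, hx'⟩
    refine ⟨fun v hv => by simp [hx v hv], fun v hv => ?_⟩
    have : ∑ u ∈ V, M v u * (c • x) u = c * ∑ u ∈ V, M v u * x u := by
      rw [mul_sum]
      exact sum_congr rfl fun u _ => by simp only [Pi.smul_apply, smul_eq_mul]; ring
    rw [this, hx' v hv, mul_zero]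

lemma mem_solSpace {V : Finset ℕ} {M : ℕ → ℕ → ZMod 2} {x : ℕ → ZMod 2} :
    x ∈ solSpace V M ↔ (∀ v, v ∉ V → x v = 0) ∧ ∀ v ∈ V, ∑ u ∈ V, M v u * x u = 0 := Iff.rfl

instance (V : Finset ℕ) (M : ℕ → ℕ → ZMod 2) : Module.Finite (ZMod 2) (solSpace V M) := by
  let f : solSpace V M →ₗ[ZMod 2] (V → ZMod 2) :=
    { toFun := fun x v => x.1 v
      map_add' := fun _ _ => rfl
      map_smul' := fun _ _ => rfl }
  refine Module.Finite.of_injective f fun x y h => Subtype.ext (funext fun v => ?_)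
  by_cases hv : v ∈ V
  · exact congrFun h ⟨v, hv⟩
  · rw [x.2.1 v hv, y.2.1 v hv]

/-- The nullity of the matrix `M`, restricted to the rows and columns in `V`. -/
noncomputable def nullity (V : Finset ℕ) (M : ℕ → ℕ → ZMod 2) : ℕ := finrank (ZMod 2) (solSpace V M)

lemma nullity_congr {V : Finset ℕ} {M M' : ℕ → ℕ → ZMod 2}
    (h : ∀ u ∈ V, ∀ v ∈ V, M u v = M' u v) : nullity V M = nullity V M' := by
  have : solSpace V M = solSpace V M' := by
    ext x
    simp only [mem_solSpace]
    refine and_congr_right fun _ => forall₂_congr fun v hv => ?_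
    rw [sum_congr rfl fun u hu => by rw [h v hv u hu]]
  rw [nullity, nullity, this]

lemma finrank_eq_of_maps (S T : Submodule (ZMod 2) (ℕ → ZMod 2))
    (f g : (ℕ → ZMod 2) →ₗ[ZMod 2] (ℕ → ZMod 2))
    (hf : ∀ x ∈ S, f x ∈ T) (hg : ∀ x ∈ T, g x ∈ S) (hgf : ∀ x ∈ S, g (f x) = x)
    (hfg : ∀ x ∈ T, f (g x) = x) : finrank (ZMod 2) S = finrank (ZMod 2) T :=
  LinearEquiv.finrank_eq
    (LinearEquiv.ofLinearMap (f.restrict hf) (g.restrict hg)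
      (LinearMap.ext fun x => Subtype.ext (hfg x.1 x.2))
      (LinearMap.ext fun x => Subtype.ext (hgf x.1 x.2)))

lemma finrank_inf_ker (S : Submodule (ZMod 2) (ℕ → ZMod 2)) [Module.Finite (ZMod 2) S]
    (φ : (ℕ → ZMod 2) →ₗ[ZMod 2] ZMod 2) {x : ℕ → ZMod 2} (hx : x ∈ S) (h : φ x ≠ 0) :
    finrank (ZMod 2) S = finrank (ZMod 2) (S ⊓ LinearMap.ker φ : Submodule _ _) + 1 := by
  have hne : φ.domRestrict S ≠ 0 := fun h0 => h (LinearMap.congr_fun h0 ⟨x, hx⟩)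
  rw [← Module.Dual.finrank_ker_add_one_of_ne_zero hne]
  congr 1
  refine LinearEquiv.finrank_eq (LinearEquiv.ofBijective
    (({ toFun := fun y => ⟨y.1.1, y.1.2, y.2⟩, map_add' := fun _ _ => rfl,
        map_smul' := fun _ _ => rfl } :
      LinearMap.ker (φ.domRestrict S) →ₗ[ZMod 2] (S ⊓ LinearMap.ker φ : Submodule _ _))) ⟨?_, ?_⟩)
  · intro y z hyz
    exact Subtype.ext (Subtype.ext (congrArg (fun t => t.1) hyz))
  · intro y
    exact ⟨⟨⟨y.1, y.2.1⟩, y.2.2⟩, rfl⟩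

/-- Overwrite the coordinate `i` by the value of a linear functional. -/
def overwrite (i : ℕ) (φ : (ℕ → ZMod 2) →ₗ[ZMod 2] ZMod 2) :
    (ℕ → ZMod 2) →ₗ[ZMod 2] (ℕ → ZMod 2) where
  toFun x u := if u = i then φ x else x u
  map_add' x y := by ext u; by_cases h : u = i <;> simp [h]
  map_smul' c x := by ext u; by_cases h : u = i <;> simp [h]

lemma overwrite_apply (i : ℕ) (φ : (ℕ → ZMod 2) →ₗ[ZMod 2] ZMod 2) (x : ℕ → ZMod 2) (u : ℕ) :
    overwrite i φ x u = if u = i then φ x else x u := rfl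

/-- The linear functional with the given coefficients on `V`. -/
def rowForm (V : Finset ℕ) (r : ℕ → ZMod 2) : (ℕ → ZMod 2) →ₗ[ZMod 2] ZMod 2 where
  toFun x := ∑ u ∈ V, r u * x u
  map_add' x y := by simp [mul_add, sum_add_distrib]
  map_smul' c x := by
    simp only [Pi.smul_apply, smul_eq_mul, RingHom.id_apply, mul_sum]
    exact sum_congr rfl fun u _ => by ring

lemma rowForm_apply (V : Finset ℕ) (r x : ℕ → ZMod 2) : rowForm V r x = ∑ u ∈ V, r u * x u := rfl

/-- The Schur complement of a diagonal entry `1`. -/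
def schur (M : ℕ → ℕ → ZMod 2) (i : ℕ) : ℕ → ℕ → ZMod 2 := fun u v => M u v + M u i * M i v

/-- The Schur complement of an off-diagonal pair of entries `1`. -/
def schurPair (M : ℕ → ℕ → ZMod 2) (i j : ℕ) : ℕ → ℕ → ZMod 2 := fun u v =>
  M u v + M u i * M j v + M u j * M i v + M j j * (M u i * M i v)

lemma two_self (a : ZMod 2) : a + a = 0 := CharTwo.add_self_eq_zero a

lemma eq_of_add_zero {a b : ZMod 2} (h : a + b = 0) : a = b := CharTwo.add_eq_zero.mp h

lemma sum_overwrite {V : Finset ℕ} {i : ℕ} (hi : i ∉ V) (r : ℕ → ZMod 2) (c : ZMod 2)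
    (x : ℕ → ZMod 2) : ∑ u ∈ V, r u * (if u = i then c else x u) = ∑ u ∈ V, r u * x u :=
  sum_congr rfl fun u hu => by rw [if_neg (ne_of_mem_of_not_mem hu hi)]

/-- Gaussian elimination with the pivot at (i, i): row i expresses x i through the other
coordinates, and substitution into the other rows produces the Schur complement. In characteristic
two there are no signs. -/
lemma nullity_schur {V : Finset ℕ} {M : ℕ → ℕ → ZMod 2} {i : ℕ} (hi : i ∉ V) (h : M i i = 1) :
    nullity (insert i V) M = nullity V (schur M i) := by
  refine finrank_eq_of_maps _ _ (overwrite i 0) (overwrite i (rowForm V (M i))) ?_ ?_ ?_ ?_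
  · rintro x ⟨hx, hx'⟩
    have hxi := hx' i (mem_insert_self _ _)
    rw [sum_insert hi, h, one_mul] at hxi
    refine ⟨fun v hv => ?_, fun v hv => ?_⟩
    · by_cases hvi : v = i
      · simp [overwrite_apply, hvi]
      · simp [overwrite_apply, hvi, hx v (by simp [hv, hvi])]
    · have hv' := hx' v (mem_insert_of_mem hv)
      rw [sum_insert hi, eq_of_add_zero hxi] at hv'
      simp only [overwrite_apply, sum_overwrite hi, schur, add_mul, sum_add_distrib, mul_assoc,
        ← mul_sum]
      rw [add_comm]; exact hv'
  · rintro x ⟨hx, hx'⟩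
    refine ⟨fun v hv => ?_, fun v hv => ?_⟩
    · simp only [mem_insert, not_or] at hv
      simp [overwrite_apply, hv.1, hx v hv.2]
    · rw [sum_insert hi]
      simp only [overwrite_apply, sum_overwrite hi, if_true, rowForm_apply]
      rcases mem_insert.mp hv with rfl | hv
      · rw [h, one_mul, two_self]
      · have hv' := hx' v hv
        simp only [schur, add_mul, sum_add_distrib, mul_assoc, ← mul_sum] at hv'
        rw [add_comm]; exact hv'
  · rintro x ⟨hx, hx'⟩
    have hxi := hx' i (mem_insert_self _ _)
    rw [sum_insert hi, h, one_mul] at hxi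
    ext u
    by_cases hu : u = i
    · simp only [overwrite_apply, hu, if_true, rowForm_apply, sum_overwrite hi]
      exact (eq_of_add_zero hxi).symm
    · simp [overwrite_apply, hu]
  · rintro x ⟨hx, hx'⟩
    ext u
    by_cases hu : u = i
    · simp [overwrite_apply, hu, hx i hi]
    · simp [overwrite_apply, hu]

/-- The pivot is the block on {i, j}. It is invertible whatever M j j is, and its inverse has
diagonal entries M j j, 0 and off-diagonal entries 1. Row i solves for x j, and then row j for x i.
-/
lemma nullity_schurPair {V : Finset ℕ} {M : ℕ → ℕ → ZMod 2} {i j : ℕ} (hij : i ≠ j) (hi : i ∉ V)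
    (hj : j ∉ V) (hii : M i i = 0) (hMij : M i j = 1) (hMji : M j i = 1) :
    nullity (insert i (insert j V)) M = nullity V (schurPair M i j) := by
  have hi' : i ∉ insert j V := by simp [hij, hi]
  have key : ∀ x ∈ solSpace (insert i (insert j V)) M,
      x j = ∑ u ∈ V, M i u * x u ∧ x i = ∑ u ∈ V, M j u * x u + M j j * ∑ u ∈ V, M i u * x u := by
    rintro x ⟨hx, hx'⟩
    have h1 := hx' i (by simp)
    have h2 := hx' j (by simp)
    rw [sum_insert hi', sum_insert hj] at h1 h2
    rw [hii, hMij, zero_mul, zero_add, one_mul] at h1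
    have h3 := eq_of_add_zero h1
    rw [hMji, one_mul] at h2
    refine ⟨h3, ?_⟩
    rw [eq_of_add_zero h2, h3, add_comm]
  let φi : (ℕ → ZMod 2) →ₗ[ZMod 2] ZMod 2 := rowForm V (M j) + M j j • rowForm V (M i)
  refine finrank_eq_of_maps _ _ (overwrite i 0 ∘ₗ overwrite j 0)
    (overwrite i φi ∘ₗ overwrite j (rowForm V (M i))) ?_ ?_ ?_ ?_
  · rintro x hx0
    obtain ⟨hxj, hxi⟩ := key x hx0
    obtain ⟨hx, hx'⟩ := hx0
    refine ⟨fun v hv => ?_, fun v hv => ?_⟩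
    · by_cases hvi : v = i
      · simp [overwrite_apply, hvi]
      by_cases hvj : v = j
      · simp [overwrite_apply, hvj]
      · simp [overwrite_apply, hvi, hvj, hx v (by simp [hv, hvi, hvj])]
    · have hv' := hx' v (by simp [hv])
      rw [sum_insert hi', sum_insert hj, hxi, hxj] at hv'
      simp only [LinearMap.comp_apply, overwrite_apply, sum_overwrite hi, sum_overwrite hj,
        schurPair, add_mul, sum_add_distrib, mul_assoc, ← mul_sum]
      rw [← hv']; ring
  · rintro x ⟨hx, hx'⟩
    refine ⟨fun v hv => ?_, fun v hv => ?_⟩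
    · simp only [mem_insert, not_or] at hv
      simp [overwrite_apply, hv.1, hv.2.1, hx v hv.2.2]
    · rw [sum_insert hi', sum_insert hj]
      simp only [LinearMap.comp_apply, overwrite_apply, sum_overwrite hi, sum_overwrite hj, if_true,
        rowForm_apply, φi, LinearMap.add_apply, LinearMap.smul_apply, smul_eq_mul, hij.symm,
        if_false]
      rcases mem_insert.mp hv with rfl | hv
      · rw [hii, hMij, zero_mul, zero_add, one_mul, two_self]
      rcases mem_insert.mp hv with rfl | hv
      · rw [hMji, one_mul]
        linear_combination two_self (∑ u ∈ V, M v u * x u) +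
          two_self (M v v * ∑ u ∈ V, M i u * x u)
      · have hv' := hx' v hv
        simp only [schurPair, add_mul, sum_add_distrib, mul_assoc, ← mul_sum] at hv'
        rw [← hv']; ring
  · rintro x hx0
    obtain ⟨hxj, hxi⟩ := key x hx0
    ext u
    by_cases hu : u = i
    · simp only [LinearMap.comp_apply, overwrite_apply, hu, if_true, rowForm_apply,
        sum_overwrite hi, sum_overwrite hj, φi, LinearMap.add_apply, LinearMap.smul_apply,
        smul_eq_mul]
      exact hxi.symm
    by_cases hu' : u = j
    · simp only [LinearMap.comp_apply, overwrite_apply, hu', hij.symm, if_true, if_false,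
        rowForm_apply, sum_overwrite hi, sum_overwrite hj]
      exact hxj.symm
    · simp [overwrite_apply, hu, hu']
  · rintro x ⟨hx, hx'⟩
    ext u
    by_cases hu : u = i
    · simp [overwrite_apply, hu, hx i hi]
    by_cases hu' : u = j
    · simp [overwrite_apply, hu', hij.symm, hx j hj]
    · simp [overwrite_apply, hu, hu']

lemma nullity_isolated {V : Finset ℕ} {M : ℕ → ℕ → ZMod 2} {i : ℕ} (hi : i ∉ V) (h : M i i = 0)
    (hr : ∀ u ∈ V, M i u = 0) (hc : ∀ u ∈ V, M u i = 0) :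
    nullity (insert i V) M = nullity V M + 1 := by
  have hmem : (Pi.single i 1 : ℕ → ZMod 2) ∈ solSpace (insert i V) M := by
    refine ⟨fun v hv => ?_, fun v hv => ?_⟩
    · rw [Pi.single_eq_of_ne]; rintro rfl; simp at hv
    · rw [sum_insert hi, Pi.single_eq_same, sum_eq_zero, mul_one, add_zero]
      · rcases mem_insert.mp hv with rfl | hv
        exacts [h, hc v hv]
      · intro u hu
        rw [Pi.single_eq_of_ne (ne_of_mem_of_not_mem hu hi), mul_zero]
  rw [nullity, finrank_inf_ker _ (LinearMap.proj i) hmem (by simp), nullity]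
  suffices solSpace (insert i V) M ⊓ LinearMap.ker (LinearMap.proj i) = solSpace V M by rw [this]
  ext x
  simp only [Submodule.mem_inf, LinearMap.mem_ker, LinearMap.proj_apply, mem_solSpace]
  constructor
  · rintro ⟨⟨hx, hx'⟩, hxi⟩
    refine ⟨fun v hv => ?_, fun v hv => ?_⟩
    · by_cases hvi : v = i
      · rw [hvi, hxi]
      · exact hx v (by simp [hv, hvi])
    · have := hx' v (mem_insert_of_mem hv)
      rwa [sum_insert hi, hxi, mul_zero, zero_add] at this
  · rintro ⟨hx, hx'⟩
    refine ⟨⟨fun v hv => hx v fun h => hv (mem_insert_of_mem h), fun v hv => ?_⟩, hx i hi⟩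
    rw [sum_insert hi, hx i hi, mul_zero, zero_add]
    rcases mem_insert.mp hv with rfl | hv
    · exact sum_eq_zero fun u hu => by rw [hr u hu, zero_mul]
    · exact hx' v hv

/-- Add `1` to the diagonal entries in `D`. -/
def addDiag (M : ℕ → ℕ → ZMod 2) (D : Finset ℕ) : ℕ → ℕ → ZMod 2 := fun u v =>
  M u v + if u = v ∧ u ∈ D then 1 else 0

/-- Among the nullities of a symmetric matrix, of the matrix with one diagonal entry changed, and of
the matrix with the row and column of this entry deleted, two are equal and the third one is
larger by one. -/
lemma nullity_three_terms {V : Finset ℕ} {M : ℕ → ℕ → ZMod 2} {i : ℕ} (hi : i ∉ V)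
    (hM : ∀ u v, M u v = M v u) :
    (-2 : ℤ) ^ nullity (insert i V) M + (-2 : ℤ) ^ nullity (insert i V) (addDiag M {i}) =
      -(-2 : ℤ) ^ nullity V M := by
  have hsum : ∀ (N : ℕ → ℕ → ZMod 2), (∀ u v, (u, v) ≠ (i, i) → N u v = M u v) →
      ∀ x : ℕ → ZMod 2, x ∈ solSpace (insert i V) N ↔ (∀ v, v ∉ insert i V → x v = 0) ∧
        (N i i * x i + ∑ u ∈ V, M i u * x u = 0) ∧
        ∀ v ∈ V, M v i * x i + ∑ u ∈ V, M v u * x u = 0 := by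
    intro N hN x
    rw [mem_solSpace, forall_mem_insert, sum_insert hi]
    refine and_congr_right fun _ => and_congr ?_ (forall₂_congr fun v hv => ?_)
    · rw [sum_congr rfl fun u hu => by
        rw [hN i u (fun h => ne_of_mem_of_not_mem hu hi (Prod.ext_iff.mp h).2)]]
    · have hvi : v ≠ i := fun h => hi (h ▸ hv)
      rw [sum_insert hi, hN v i (by simp [hvi]), sum_congr rfl fun u hu => by
        rw [hN v u (by simp [hvi])]]
  have hadd : ∀ u v, (u, v) ≠ (i, i) → addDiag M {i} u v = M u v := by
    intro u v huv
    simp only [addDiag, mem_singleton]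
    rw [if_neg, add_zero]
    rintro ⟨rfl, rfl⟩; exact huv rfl
  -- The dichotomy is whether column i, restricted to V, lies in the column space of the block on V.
  -- If it does, the scalar `d` below is the only diagonal entry for which the enlarged matrix gains
  -- a kernel vector.
  by_cases hy : ∃ y : ℕ → ZMod 2, (∀ v, v ∉ V → y v = 0) ∧ ∀ v ∈ V, ∑ u ∈ V, M v u * y u = M v i
  · obtain ⟨y, hy0, hy⟩ := hy
    set d : ZMod 2 := ∑ u ∈ V, M i u * y u with hd
    -- By symmetry row i is then a combination of the rows of the block, so it kills the kernel of
    -- the block.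
    have hperp : ∀ x : ℕ → ZMod 2, (∀ v ∈ V, ∑ u ∈ V, M v u * x u = 0) →
        ∑ u ∈ V, M i u * x u = 0 := by
      intro x hx
      have h1 : ∑ u ∈ V, M i u * x u = ∑ u ∈ V, ∑ v ∈ V, M u v * y v * x u := by
        refine sum_congr rfl fun u hu => ?_
        rw [hM i u, ← hy u hu, sum_mul]
      rw [h1, sum_comm]
      refine sum_eq_zero fun v hv => ?_
      have h2 : ∑ u ∈ V, M u v * y v * x u = y v * ∑ u ∈ V, M v u * x u := by
        rw [mul_sum]
        exact sum_congr rfl fun u _ => by rw [hM u v]; ring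
      rw [h2, hx v hv, mul_zero]
    have heq : ∀ N : ℕ → ℕ → ZMod 2, (∀ u v, (u, v) ≠ (i, i) → N u v = M u v) →
        solSpace (insert i V) N ⊓ LinearMap.ker (LinearMap.proj i) = solSpace V M := by
      intro N hN
      ext x
      rw [Submodule.mem_inf, hsum N hN, LinearMap.mem_ker, LinearMap.proj_apply, mem_solSpace]
      constructor
      · rintro ⟨⟨hx, -, hx'⟩, hxi⟩
        refine ⟨fun v hv => ?_, fun v hv => by simpa [hxi] using hx' v hv⟩
        by_cases hvi : v = i
        · rw [hvi, hxi]
        · exact hx v (by simp [hv, hvi])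
      · rintro ⟨hx, hx'⟩
        refine ⟨⟨fun v hv => hx v fun h => hv (mem_insert_of_mem h), ?_, fun v hv => ?_⟩, hx i hi⟩
        · rw [hx i hi, hperp x hx']; simp
        · rw [hx i hi, hx' v hv]; simp
    have hbig : ∀ N : ℕ → ℕ → ZMod 2, (∀ u v, (u, v) ≠ (i, i) → N u v = M u v) → N i i = d →
        nullity (insert i V) N = nullity V M + 1 := by
      intro N hN hNd
      have hmem : overwrite i (LinearMap.proj i) y + Pi.single i 1 ∈ solSpace (insert i V) N := by
        rw [hsum N hN]
        have hval : ∀ u ∈ V, (overwrite i (LinearMap.proj i) y + Pi.single i 1 : ℕ → ZMod 2) u =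
            y u := by
          intro u hu
          have : u ≠ i := fun h => hi (h ▸ hu)
          simp [overwrite_apply, this]
        have hvali : (overwrite i (LinearMap.proj i) y + Pi.single i 1 : ℕ → ZMod 2) i = 1 := by
          simp [overwrite_apply, hy0 i hi]
        refine ⟨fun v hv => ?_, ?_, fun v hv => ?_⟩
        · simp only [mem_insert, not_or] at hv
          simp [overwrite_apply, hv.1, hy0 v hv.2]
        · rw [hvali, sum_congr rfl fun u hu => by rw [hval u hu], hNd, mul_one, ← hd, two_self]
        · rw [hvali, sum_congr rfl fun u hu => by rw [hval u hu], hy v hv, mul_one, two_self]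
      rw [nullity, finrank_inf_ker _ (LinearMap.proj i) hmem, heq N hN, nullity]
      simp [overwrite_apply, hy0 i hi]
    have hsmall : ∀ N : ℕ → ℕ → ZMod 2, (∀ u v, (u, v) ≠ (i, i) → N u v = M u v) → N i i ≠ d →
        nullity (insert i V) N = nullity V M := by
      intro N hN hNd
      rw [nullity, nullity, ← heq N hN]
      suffices solSpace (insert i V) N ≤ LinearMap.ker (LinearMap.proj i) by
        rw [inf_eq_left.mpr this]
      intro x hx
      rw [hsum N hN] at hx
      obtain ⟨-, hx1, hx2⟩ := hx
      rw [LinearMap.mem_ker, LinearMap.proj_apply]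
      have h1 : ∑ u ∈ V, M i u * x u = d * x i := by
        have h3 : ∑ u ∈ V, M i u * x u = ∑ u ∈ V, ∑ v ∈ V, M u v * y v * x u := by
          refine sum_congr rfl fun u hu => ?_
          rw [hM i u, ← hy u hu, sum_mul]
        rw [h3, sum_comm, hd, sum_mul]
        refine sum_congr rfl fun v hv => ?_
        have h2 : ∑ u ∈ V, M u v * y v * x u = y v * ∑ u ∈ V, M v u * x u := by
          rw [mul_sum]
          exact sum_congr rfl fun u _ => by rw [hM u v]; ring
        rw [h2, ← eq_of_add_zero (hx2 v hv), hM i v]; ring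
      rw [h1, ← add_mul] at hx1
      have hne : N i i + d ≠ 0 := fun h => hNd (eq_of_add_zero h)
      exact (mul_eq_zero.mp hx1).resolve_left hne
    have hdiag : addDiag M {i} i i = M i i + 1 := by simp [addDiag]
    have hz : ∀ a b : ZMod 2, a ≠ b → a + 1 = b := by decide
    have hz' : ∀ a : ZMod 2, a + 1 ≠ a := by decide
    by_cases hid : M i i = d
    · rw [hbig M (fun _ _ _ => rfl) hid, hsmall _ hadd (by rw [hdiag, hid]; exact hz' d)]
      ring
    · rw [hsmall M (fun _ _ _ => rfl) hid, hbig _ hadd (by rw [hdiag]; exact hz _ _ hid)]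
      ring
  -- In the other case a functional kills the column space but not column i. By symmetry its
  -- coefficient vector `z` is a kernel vector of the block on which row i does not vanish. For
  -- either diagonal entry the solutions are the kernel vectors killed by row i, one dimension
  -- fewer.
  · let P : (ℕ → ZMod 2) →ₗ[ZMod 2] (V → ZMod 2) :=
      LinearMap.pi fun v => rowForm V (M v.1)
    have hr : (fun v : V => M v.1 i) ∉ LinearMap.range P := by
      rintro ⟨y, hPy⟩
      refine hy ⟨fun u => if u ∈ V then y u else 0, fun v hv => if_neg hv, fun v hv => ?_⟩
      rw [← congrFun hPy ⟨v, hv⟩]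
      exact sum_congr rfl fun u hu => by simp only [if_pos hu]
    obtain ⟨f, hf1, hf2⟩ := Submodule.exists_le_ker_of_notMem hr
    let z : ℕ → ZMod 2 := fun u => if h : u ∈ V then f (Pi.single ⟨u, h⟩ 1) else 0
    have hfz : ∀ g : ℕ → ZMod 2, f (fun v : V => g v.1) = ∑ v ∈ V, g v * z v := by
      intro g
      have h1 : (fun v : V => g v.1) = ∑ v : V, g v.1 • (Pi.single v 1 : V → ZMod 2) := by
        ext w
        simp [Finset.sum_apply, Pi.single_apply]
      rw [h1, map_sum, ← sum_coe_sort V]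
      refine sum_congr rfl fun v _ => ?_
      rw [map_smul, smul_eq_mul]
      simp only [z, v.2, dif_pos]
    have hzK : ∀ v ∈ V, ∑ u ∈ V, M v u * z u = 0 := by
      intro v hv
      have h1 : (fun w : V => M w.1 v) ∈ LinearMap.range P := by
        refine ⟨Pi.single v 1, funext fun w => ?_⟩
        simp [P, rowForm_apply, Pi.single_apply, hv]
      have h2 := LinearMap.mem_ker.mp (hf2 h1)
      rw [hfz fun w => M w v] at h2
      rw [← h2]
      exact sum_congr rfl fun u _ => by rw [hM v u]
    have hzr : ∑ u ∈ V, M i u * z u ≠ 0 := by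
      rw [hfz fun w => M w i] at hf1
      rwa [sum_congr rfl fun u _ => by rw [hM i u]]
    have hz0 : ∀ v, v ∉ V → z v = 0 := fun v hv => dif_neg hv
    have heq : ∀ N : ℕ → ℕ → ZMod 2, (∀ u v, (u, v) ≠ (i, i) → N u v = M u v) →
        solSpace (insert i V) N = solSpace V M ⊓ LinearMap.ker (rowForm V (M i)) := by
      intro N hN
      ext x
      rw [hsum N hN, Submodule.mem_inf, LinearMap.mem_ker, rowForm_apply, mem_solSpace]
      constructor
      · rintro ⟨hx, hx1, hx2⟩
        have hxi : x i = 0 := by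
          by_contra hne
          have hz1 : ∀ a : ZMod 2, a ≠ 0 → a = 1 := by decide
          refine hy ⟨fun u => if u ∈ V then x u else 0, fun v hv => if_neg hv, fun v hv => ?_⟩
          have := eq_of_add_zero (hx2 v hv)
          rw [hz1 _ hne, mul_one] at this
          rw [this]
          exact sum_congr rfl fun u hu => by simp only [if_pos hu]
        refine ⟨⟨fun v hv => ?_, fun v hv => by simpa [hxi] using hx2 v hv⟩,
          by simpa [hxi] using hx1⟩
        by_cases hvi : v = i
        · rw [hvi, hxi]
        · exact hx v (by simp [hv, hvi])
      · rintro ⟨⟨hx, hx'⟩, hx1⟩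
        refine ⟨fun v hv => hx v fun h => hv (mem_insert_of_mem h), ?_, fun v hv => ?_⟩
        · rw [hx i hi, hx1]; simp
        · rw [hx i hi, hx' v hv]; simp
    rw [nullity, nullity, heq M (fun _ _ _ => rfl), heq _ hadd, nullity,
      finrank_inf_ker (solSpace V M) (rowForm V (M i)) (mem_solSpace.mpr ⟨hz0, hzK⟩) hzr]
    ring

end KnotTheory

namespace KnotTheory

open Finset Module

/-! ### Averages over states -/

/-- The signed average of a function of the state: the sum over all ways `D` to change the diagonal
of `M`, weighted by powers of `-2`. -/
noncomputable def mean (V : Finset ℕ) (M : ℕ → ℕ → ZMod 2) (f : Finset ℕ → ℤ) : ℤ :=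
  (-1) ^ #V * ∑ D ∈ V.powerset, f D * (-2) ^ nullity V (addDiag M D)

/-- The average nullity. -/
noncomputable def kappa (V : Finset ℕ) (M : ℕ → ℕ → ZMod 2) : ℤ :=
  mean V M fun D => nullity V (addDiag M D)

/-- The spin of the vertex `i` in a state. -/
def spin (i : ℕ) (D : Finset ℕ) : ℤ := if i ∈ D then -1 else 1

/-- The sign character of the field with two elements. -/
def chi (c : ZMod 2) : ℤ := if c = 0 then 1 else -1

lemma chi_add : ∀ a b : ZMod 2, chi (a + b) = chi a * chi b := by decide

lemma mean_add (V : Finset ℕ) (M : ℕ → ℕ → ZMod 2) (f g : Finset ℕ → ℤ) :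
    mean V M (fun D => f D + g D) = mean V M f + mean V M g := by
  simp only [mean, add_mul, sum_add_distrib, mul_add]

lemma mean_const_mul (V : Finset ℕ) (M : ℕ → ℕ → ZMod 2) (c : ℤ) (f : Finset ℕ → ℤ) :
    mean V M (fun D => c * f D) = c * mean V M f := by
  simp only [mean, mul_sum]
  exact sum_congr rfl fun D _ => by ring

lemma mean_sum {ι : Type*} (s : Finset ι) (V : Finset ℕ) (M : ℕ → ℕ → ZMod 2)
    (f : ι → Finset ℕ → ℤ) : mean V M (fun D => ∑ i ∈ s, f i D) = ∑ i ∈ s, mean V M (f i) := by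
  simp only [mean, sum_mul]
  rw [sum_comm, mul_sum]

lemma addDiag_symm {M : ℕ → ℕ → ZMod 2} (hM : ∀ u v, M u v = M v u) (D : Finset ℕ) (u v : ℕ) :
    addDiag M D u v = addDiag M D v u := by
  simp only [addDiag, hM u v]
  by_cases h : u = v
  · rw [h]
  · rw [if_neg (fun h' => h h'.1), if_neg (fun h' => h h'.1.symm)]

lemma schur_symm {M : ℕ → ℕ → ZMod 2} (hM : ∀ u v, M u v = M v u) (i u v : ℕ) :
    schur M i u v = schur M i v u := by
  simp only [schur, hM u v, hM u i, hM i v, mul_comm]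

lemma addDiag_insert {M : ℕ → ℕ → ZMod 2} {D : Finset ℕ} {i : ℕ} (hi : i ∉ D) :
    addDiag M (insert i D) = addDiag (addDiag M D) {i} := by
  ext u v
  by_cases huv : u = v
  · by_cases hu : u = i
    · subst hu; simp [addDiag, huv ▸ hi, huv]
    · simp [addDiag, huv, huv ▸ hu]
  · simp [addDiag, huv]

lemma addDiag_self {M : ℕ → ℕ → ZMod 2} {D : Finset ℕ} {i : ℕ} (hi : i ∉ D) :
    addDiag M D i i = M i i := by simp [addDiag, hi]

lemma nullity_insert_of_one {V D : Finset ℕ} {M N : ℕ → ℕ → ZMod 2} {i : ℕ} (hi : i ∉ V)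
    (hN : N i i = 1) (h : ∀ u v, (u, v) ≠ (i, i) → N u v = addDiag M D u v) :
    nullity (insert i V) N = nullity V (addDiag (schur M i) D) := by
  rw [nullity_schur hi hN]
  refine nullity_congr fun u hu v hv => ?_
  have hui : u ≠ i := ne_of_mem_of_not_mem hu hi
  have hvi : v ≠ i := ne_of_mem_of_not_mem hv hi
  simp only [schur, addDiag, h u v (by simp [hui]), h u i (by simp [hui]), h i v (by simp [hvi]),
    hui, hvi.symm, false_and, if_false, add_zero]
  ring

lemma addDiag_singleton_ne {M : ℕ → ℕ → ZMod 2} {i u v : ℕ} (h : (u, v) ≠ (i, i)) :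
    addDiag M {i} u v = M u v := by
  simp only [addDiag, mem_singleton]
  rw [if_neg, add_zero]
  rintro ⟨rfl, rfl⟩; exact h rfl

/-- Summing over both states of a vertex that f ignores is exactly the three-term relation, so the
vertex can be deleted. This is what the base -2 and the sign (-1)^#V are for. -/
lemma mean_insert {V : Finset ℕ} {M : ℕ → ℕ → ZMod 2} {i : ℕ} (hi : i ∉ V)
    (hM : ∀ u v, M u v = M v u) {f : Finset ℕ → ℤ} (hf : ∀ D, f (insert i D) = f D) :
    mean (insert i V) M f = mean V M f := by
  simp only [mean, card_insert_of_notMem hi, sum_powerset_insert hi, hf]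
  rw [← sum_add_distrib, pow_succ, mul_assoc, ← neg_eq_neg_one_mul, ← sum_neg_distrib]
  congr 1
  refine sum_congr rfl fun D hD => ?_
  have hiD : i ∉ D := fun h => hi (mem_powerset.mp hD h)
  rw [addDiag_insert hiD, ← mul_add, nullity_three_terms hi (addDiag_symm hM D)]
  ring

/-- In exactly one of the two states of i the diagonal entry is 1. That term is a Schur complement,
and the three-term relation gives the other one. The factor `chi (M i i)` records which of the two
states has the pivot. -/
lemma mean_insert_spin {V : Finset ℕ} {M : ℕ → ℕ → ZMod 2} {i : ℕ} (hi : i ∉ V)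
    (hM : ∀ u v, M u v = M v u) {f : Finset ℕ → ℤ} (hf : ∀ D, f (insert i D) = f D) :
    mean (insert i V) M (fun D => spin i D * f D) =
      chi (M i i) * (mean V M f + 2 * mean V (schur M i) f) := by
  simp only [mean, card_insert_of_notMem hi, sum_powerset_insert hi, hf]
  have h01 : M i i = 0 ∨ M i i = 1 := by generalize M i i = a; revert a; decide
  have key : ∀ D ∈ V.powerset,
      spin i D * f D * (-2 : ℤ) ^ nullity (insert i V) (addDiag M D) +
        spin i (insert i D) * f D * (-2) ^ nullity (insert i V) (addDiag M (insert i D)) =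
      -chi (M i i) * (f D * (-2) ^ nullity V (addDiag M D) +
        2 * (f D * (-2) ^ nullity V (addDiag (schur M i) D))) := by
    intro D hD
    have hDV := mem_powerset.mp hD
    have hiD : i ∉ D := fun h => hi (hDV h)
    have h3 := nullity_three_terms hi (addDiag_symm hM D)
    rw [← addDiag_insert hiD] at h3
    simp only [spin, hiD, mem_insert_self, if_true, if_false]
    rcases h01 with h | h
    · have h1 : nullity (insert i V) (addDiag M (insert i D)) =
          nullity V (addDiag (schur M i) D) := by
        rw [addDiag_insert hiD]
        refine nullity_insert_of_one hi ?_ fun u v h => addDiag_singleton_ne h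
        simp [addDiag, hiD, h]
      rw [h1] at h3 ⊢
      rw [h, eq_sub_of_add_eq h3, show chi 0 = 1 from rfl]
      ring
    · have h1 : nullity (insert i V) (addDiag M D) = nullity V (addDiag (schur M i) D) :=
        nullity_insert_of_one hi (by rw [addDiag_self hiD, h]) fun u v _ => rfl
      rw [h1] at h3 ⊢
      rw [h, eq_sub_of_add_eq' h3, show chi 1 = -1 from rfl]
      ring
  rw [← sum_add_distrib, sum_congr rfl key, ← mul_sum, sum_add_distrib, ← mul_sum]
  ring

lemma mean_one (V : Finset ℕ) {M : ℕ → ℕ → ZMod 2} (hM : ∀ u v, M u v = M v u) :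
    mean V M (fun _ => 1) = 1 := by
  induction V using Finset.induction_on with
  | empty =>
    have : nullity ∅ (addDiag M ∅) = 0 := by
      have h : solSpace ∅ (addDiag M ∅) = ⊥ := by
        ext x
        simp only [mem_solSpace, notMem_empty, not_false_eq_true, forall_const, Submodule.mem_bot]
        exact ⟨fun h => funext h.1, fun h => by simp [h]⟩
      rw [nullity, h, finrank_bot]
    simp [mean, this]
  | insert i V hi ih => rw [mean_insert hi hM (fun _ => rfl), ih]

lemma spin_insert_of_ne {i j : ℕ} (h : i ≠ j) (D : Finset ℕ) : spin i (insert j D) = spin i D := by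
  simp [spin, h]

/-- Both averages supplied by `mean_insert_spin` are 1, whence 1 + 2 = 3. The same 3 is the exponent
in the writhe factor of the Jones polynomial, so for zero diagonal that normalization exactly
centres the spins. -/
lemma mean_spin {V : Finset ℕ} {M : ℕ → ℕ → ZMod 2} (hM : ∀ u v, M u v = M v u) {i : ℕ}
    (hi : i ∈ V) : mean V M (spin i) = 3 * chi (M i i) := by
  have h := mean_insert_spin (notMem_erase i V) hM (f := fun _ => 1) (fun _ => rfl)
  simp only [mul_one, insert_erase hi] at h
  rw [h, mean_one _ hM, mean_one _ (schur_symm hM i)]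
  ring

lemma mean_spin₂ {V : Finset ℕ} {M : ℕ → ℕ → ZMod 2} (hM : ∀ u v, M u v = M v u) {i j : ℕ}
    (hi : i ∈ V) (hj : j ∈ V) (hij : i ≠ j) :
    mean V M (fun D => spin i D * spin j D) =
      chi (M i i) * chi (M j j) * (3 + 6 * chi (M i j)) := by
  have h := mean_insert_spin (notMem_erase i V) hM (f := spin j) (spin_insert_of_ne hij.symm)
  have hj' : j ∈ V.erase i := mem_erase.mpr ⟨hij.symm, hj⟩
  rw [insert_erase hi, mean_spin hM hj', mean_spin (schur_symm hM i) hj'] at h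
  rw [h, schur, chi_add, hM j i, show ∀ a : ZMod 2, a * a = a by decide]
  ring

lemma mean_spin₃ {V : Finset ℕ} {M : ℕ → ℕ → ZMod 2} (hM : ∀ u v, M u v = M v u)
    (h0 : ∀ u, M u u = 0) {i j k : ℕ} (hi : i ∈ V) (hj : j ∈ V) (hk : k ∈ V)
    (hij : i ≠ j) (hik : i ≠ k) (hjk : j ≠ k) :
    mean V M (fun D => spin i D * (spin j D * spin k D)) =
      3 + 6 * chi (M j k) +
        2 * chi (M i j) * chi (M i k) * (3 + 6 * chi (M j k) * chi (M i j * M i k)) := by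
  have h := mean_insert_spin (notMem_erase i V) hM (f := fun D => spin j D * spin k D)
    (fun D => by simp only [spin_insert_of_ne hij.symm, spin_insert_of_ne hik.symm])
  have hj' : j ∈ V.erase i := mem_erase.mpr ⟨hij.symm, hj⟩
  have hk' : k ∈ V.erase i := mem_erase.mpr ⟨hik.symm, hk⟩
  rw [insert_erase hi, mean_spin₂ hM hj' hk' hjk, mean_spin₂ (schur_symm hM i) hj' hk' hjk] at h
  rw [h]
  simp only [schur, h0, zero_add, hM j i, hM k i, chi_add, show ∀ a : ZMod 2, a * a = a by decide,
    show chi 0 = 1 from rfl]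
  ring

/-- The centred spin. -/
def cspin (i : ℕ) (D : Finset ℕ) : ℤ := spin i D - 3

/-- The integer `0` or `1` with the given residue. -/
def lift01 (c : ZMod 2) : ℤ := if c = 0 then 0 else 1

lemma mean_cspin {V : Finset ℕ} {M : ℕ → ℕ → ZMod 2} (hM : ∀ u v, M u v = M v u)
    (h0 : ∀ u, M u u = 0) {i : ℕ} (hi : i ∈ V) : mean V M (cspin i) = 0 := by
  have h : cspin i = fun D => spin i D + (-3) * 1 := by ext D; simp only [cspin]; ring
  rw [h, mean_add, mean_const_mul, mean_spin hM hi, mean_one V hM, h0]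
  rfl

lemma mean_cspin₂ {V : Finset ℕ} {M : ℕ → ℕ → ZMod 2} (hM : ∀ u v, M u v = M v u)
    (h0 : ∀ u, M u u = 0) {i j : ℕ} (hi : i ∈ V) (hj : j ∈ V) (hij : i ≠ j) :
    mean V M (fun D => cspin i D * cspin j D) = -12 * lift01 (M i j) := by
  have h : (fun D => cspin i D * cspin j D) = fun D =>
      spin i D * spin j D + ((-3) * cspin i D + ((-3) * cspin j D + (-9) * 1)) := by
    ext D; simp only [cspin]; ring
  rw [h]
  simp only [mean_add, mean_const_mul]
  rw [mean_cspin hM h0 hi, mean_cspin hM h0 hj, mean_spin₂ hM hi hj hij, mean_one V hM, h0, h0]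
  generalize M i j = a
  revert a; decide

lemma mean_cspin₃_of_ne {V : Finset ℕ} {M : ℕ → ℕ → ZMod 2} (hM : ∀ u v, M u v = M v u)
    (h0 : ∀ u, M u u = 0) {i j k : ℕ} (hi : i ∈ V) (hj : j ∈ V) (hk : k ∈ V)
    (hij : i ≠ j) (hik : i ≠ k) (hjk : j ≠ k) :
    mean V M (fun D => cspin i D * (cspin j D * cspin k D)) =
      48 * (lift01 (M i j) * lift01 (M j k) + lift01 (M j k) * lift01 (M i k) +
        lift01 (M i k) * lift01 (M i j) - lift01 (M i j) * lift01 (M j k) * lift01 (M i k)) := by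
  have h : (fun D => cspin i D * (cspin j D * cspin k D)) = fun D =>
      spin i D * (spin j D * spin k D) + ((-3) * (cspin i D * cspin j D) +
        ((-3) * (cspin i D * cspin k D) + ((-3) * (cspin j D * cspin k D) +
        ((-9) * cspin i D + ((-9) * cspin j D + ((-9) * cspin k D + (-27) * 1)))))) := by
    ext D; simp only [cspin]; ring
  rw [h]
  simp only [mean_add, mean_const_mul]
  rw [mean_cspin hM h0 hi, mean_cspin hM h0 hj, mean_cspin hM h0 hk, mean_cspin₂ hM h0 hi hj hij,
    mean_cspin₂ hM h0 hi hk hik, mean_cspin₂ hM h0 hj hk hjk,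
    mean_spin₃ hM h0 hi hj hk hij hik hjk, mean_one V hM]
  generalize M i j = a
  generalize M j k = b
  generalize M i k = c
  revert a b c; decide

/-- A centred spin takes only the values -2 and -4, hence satisfies a quadratic equation. Moments
with a repeated index thereby reduce to lower ones. -/
lemma cspin_sq (i : ℕ) (D : Finset ℕ) : cspin i D * cspin i D = -8 - 6 * cspin i D := by
  unfold cspin spin
  split_ifs <;> norm_num

lemma mean_cspin_sq_mul {V : Finset ℕ} {M : ℕ → ℕ → ZMod 2} (hM : ∀ u v, M u v = M v u)
    (h0 : ∀ u, M u u = 0) {i k : ℕ} (hi : i ∈ V) (hk : k ∈ V) :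
    mean V M (fun D => cspin i D * cspin i D * cspin k D) =
      72 * lift01 (M i k) + if i = k then 48 else 0 := by
  by_cases hik : i = k
  · subst hik
    have h : (fun D => cspin i D * cspin i D * cspin i D) = fun D => 48 * 1 + 28 * cspin i D := by
      ext D
      rw [cspin_sq, sub_mul, mul_assoc, cspin_sq]; ring
    rw [h, mean_add, mean_const_mul, mean_const_mul, mean_one V hM, mean_cspin hM h0 hi, h0]
    simp [lift01]
  · have h : (fun D => cspin i D * cspin i D * cspin k D) = fun D =>
        (-8) * cspin k D + (-6) * (cspin i D * cspin k D) := by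
      ext D
      rw [cspin_sq]; ring
    rw [h, mean_add, mean_const_mul, mean_const_mul, mean_cspin hM h0 hk,
      mean_cspin₂ hM h0 hi hk hik, if_neg hik]
    ring

lemma lift01_mul_self (c : ZMod 2) : lift01 c * lift01 c = lift01 c := by revert c; decide

/-- The third moments of the centred spins. -/
lemma mean_cspin₃ {V : Finset ℕ} {M : ℕ → ℕ → ZMod 2} (hM : ∀ u v, M u v = M v u)
    (h0 : ∀ u, M u u = 0) {i j k : ℕ} (hi : i ∈ V) (hj : j ∈ V) (hk : k ∈ V) :
    mean V M (fun D => cspin i D * (cspin j D * cspin k D)) =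
      48 * (lift01 (M i j) * lift01 (M j k) + lift01 (M j k) * lift01 (M i k) +
        lift01 (M i k) * lift01 (M i j) - lift01 (M i j) * lift01 (M j k) * lift01 (M i k)) +
      24 * ((if i = j then lift01 (M i k) else 0) + (if j = k then lift01 (M j i) else 0) +
        (if i = k then lift01 (M i j) else 0)) + (if i = j ∧ j = k then 48 else 0) := by
  have hz : lift01 0 = 0 := rfl
  by_cases hij : i = j
  · subst hij
    have h := mean_cspin_sq_mul hM h0 hi hk
    simp only [mul_assoc] at h
    rw [h, h0, hz]
    have := lift01_mul_self (M i k)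
    by_cases hik : i = k
    · subst hik; rw [h0]; simp [hz]
    · simp only [hik, if_true, if_false, and_false]; linear_combination (-48) * this
  by_cases hjk : j = k
  · subst hjk
    have h := mean_cspin_sq_mul hM h0 hj hi
    rw [show (fun D => cspin i D * (cspin j D * cspin j D)) = fun D =>
      cspin j D * cspin j D * cspin i D by ext; ring, h, h0, hz, hM j i]
    have := lift01_mul_self (M i j)
    simp only [hij, Ne.symm hij, if_true, if_false, false_and]
    linear_combination (-48) * this
  by_cases hik : i = k
  · subst hik
    have h := mean_cspin_sq_mul hM h0 hi hj
    rw [show (fun D => cspin i D * (cspin j D * cspin i D)) = fun D =>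
      cspin i D * cspin i D * cspin j D by ext; ring, h, h0, hz, hM j i]
    have := lift01_mul_self (M i j)
    simp only [hij, hjk, if_true, if_false, false_and]
    linear_combination (-48) * this
  · rw [mean_cspin₃_of_ne hM h0 hi hj hk hij hik hjk]
    simp [hij, hjk, hik]

/-! ### The average nullity: deleting one or two vertices, and correlation with a spin. -/

lemma sum_addDiag_eq {V : Finset ℕ} {M M' : ℕ → ℕ → ZMod 2}
    (h : ∀ u ∈ V, ∀ v ∈ V, u ≠ v → M u v = M' u v) (F : ℕ → ℤ) :
    ∑ D ∈ V.powerset, F (nullity V (addDiag M D)) =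
      ∑ D ∈ V.powerset, F (nullity V (addDiag M' D)) := by
  -- The symmetric difference with `E`, the places where the two diagonals differ, permutes the
  -- states and absorbs the discrepancy.
  let E : Finset ℕ := V.filter fun u => M u u ≠ M' u u
  have hE : E ⊆ V := filter_subset _ _
  have hmem : ∀ D ∈ V.powerset, symmDiff D E ∈ V.powerset := fun D hD =>
    mem_powerset.mpr (symmDiff_le (le_sup_of_le_right (mem_powerset.mp hD))
      (le_sup_of_le_right hE))
  have hinv : ∀ D ∈ V.powerset, symmDiff (symmDiff D E) E = D := fun D _ =>
    symmDiff_symmDiff_cancel_right _ _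
  refine sum_nbij' (fun D => symmDiff D E) (fun D => symmDiff D E) hmem hmem hinv hinv
    fun D hD => congrArg F (nullity_congr fun u hu v hv => ?_)
  by_cases huv : u = v
  · subst huv
    have hz : ∀ a b : ZMod 2, a ≠ b → a + 1 = b := by decide
    have hz' : ∀ a b : ZMod 2, a ≠ b → a = b + 1 := by decide
    by_cases hne : M u u = M' u u <;> by_cases huD : u ∈ D <;>
      simp [addDiag, mem_symmDiff, E, hu, hne, huD]
    · exact hz _ _ hne
    · exact hz' _ _ hne
  · simp [addDiag, huv, h u hu v hv huv]

/-- The average nullity does not depend on the diagonal entries. -/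
lemma kappa_congr {V : Finset ℕ} {M M' : ℕ → ℕ → ZMod 2}
    (h : ∀ u ∈ V, ∀ v ∈ V, u ≠ v → M u v = M' u v) : kappa V M = kappa V M' := by
  simp only [kappa, mean]
  rw [sum_addDiag_eq h fun k => (k : ℤ) * (-2) ^ k]

/-- An isolated vertex raises the nullity by one when its diagonal entry is 0 and does not change it
when the entry is 1. After weighting, the surplus is twice the total mass. -/
lemma kappa_insert_isolated {V : Finset ℕ} {M : ℕ → ℕ → ZMod 2} (hM : ∀ u v, M u v = M v u) {i : ℕ}
    (hi : i ∉ V) (h0 : M i i = 0) (h : ∀ u ∈ V, M i u = 0) :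
    kappa (insert i V) M = kappa V M + 2 := by
  have h1 := mean_one V hM
  simp only [mean, one_mul] at h1
  simp only [kappa, mean, card_insert_of_notMem hi, sum_powerset_insert hi]
  have key : ∀ D ∈ V.powerset,
      (nullity (insert i V) (addDiag M D) : ℤ) * (-2) ^ nullity (insert i V) (addDiag M D) +
      (nullity (insert i V) (addDiag M (insert i D)) : ℤ) *
        (-2) ^ nullity (insert i V) (addDiag M (insert i D)) =
      -((nullity V (addDiag M D) : ℤ) * (-2) ^ nullity V (addDiag M D) +
        2 * (-2) ^ nullity V (addDiag M D)) := by
    intro D hD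
    have hDV := mem_powerset.mp hD
    have hiD : i ∉ D := fun h => hi (hDV h)
    have hrow : ∀ u ∈ V, addDiag M D i u = 0 := fun u hu => by
      simp [addDiag, (ne_of_mem_of_not_mem hu hi).symm, h u hu]
    rw [nullity_isolated hi (by rw [addDiag_self hiD, h0]) hrow
      fun u hu => by rw [addDiag_symm hM, hrow u hu]]
    have h2 : nullity (insert i V) (addDiag M (insert i D)) = nullity V (addDiag M D) := by
      rw [addDiag_insert hiD, nullity_insert_of_one hi (by simp [addDiag, hiD, h0])
        fun u v h => addDiag_singleton_ne h]
      exact nullity_congr fun u hu v hv => by simp [addDiag, schur, h v hv]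
    rw [h2]; push_cast; ring
  rw [← sum_add_distrib, sum_congr rfl key, sum_neg_distrib, sum_add_distrib, ← mul_sum]
  linear_combination 2 * h1

/-- States with i in D have the pivot i, which removes one vertex and reverses the sign. States
without i have the pivot block {i, j}; the two states of j there give the two terms on V, which keep
their sign. -/
lemma kappa_insert_pair {V : Finset ℕ} {M : ℕ → ℕ → ZMod 2} (hM : ∀ u v, M u v = M v u) {i j : ℕ}
    (hij : i ≠ j) (hi : i ∉ V) (hj : j ∉ V) (hii : M i i = 0) (hMij : M i j = 1) :
    kappa (insert i (insert j V)) M = -kappa (insert j V) (schur M i) +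
      kappa V (fun u v => M u v + M u i * M j v + M u j * M i v) +
      kappa V (fun u v => M u v + M u i * M j v + M u j * M i v + M u i * M i v) := by
  -- `kappa` ignores the diagonal, so the entry at j may be toggled. The off-diagonal entries of the
  -- matrices on the right do not involve it.
  wlog hjj : M j j = 0 generalizing M
  · let M' : ℕ → ℕ → ZMod 2 := addDiag M {j}
    have hM' : ∀ u v, M' u v = M' v u := addDiag_symm hM {j}
    have hD : ∀ u v, u ≠ v → M' u v = M u v := fun u v h => by simp [M', addDiag, h]
    have hL : ∀ u v, u ≠ j → M' u v = M u v := fun u v h => by simp [M', addDiag, h]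
    have hR : ∀ u v, v ≠ j → M' u v = M u v := fun u v h => by rw [hM', hL _ _ h, hM]
    have := this hM' (by rw [hL _ _ hij, hii]) (by rw [hL _ _ hij, hMij])
      (by
        have hz : ∀ a : ZMod 2, a ≠ 0 → a + 1 = 0 := by decide
        simp [M', addDiag, hz _ hjj])
    have hVj : ∀ u ∈ V, u ≠ j := fun u hu => ne_of_mem_of_not_mem hu hj
    rw [kappa_congr (M := M) (M' := M') fun u _ v _ huv => (hD u v huv).symm, this]
    congr 1
    · congr 1
      · congr 1
        refine kappa_congr fun u _ v _ huv => ?_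
        simp only [schur]
        rw [hD u v huv, hR u i hij, hL i v hij]
      · refine kappa_congr fun u hu v hv huv => ?_
        rw [hD u v huv, hR u i hij, hL i v hij, hR j v (hVj v hv), hL u j (hVj u hu)]
    · refine kappa_congr fun u hu v hv huv => ?_
      rw [hD u v huv, hR u i hij, hL i v hij, hR j v (hVj v hv), hL u j (hVj u hu)]
  have hi' : i ∉ insert j V := by simp [hij, hi]
  simp only [kappa, mean, card_insert_of_notMem hi', sum_powerset_insert hi']
  have hsecond : ∀ D ∈ (insert j V).powerset,
      nullity (insert i (insert j V)) (addDiag M (insert i D)) =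
        nullity (insert j V) (addDiag (schur M i) D) := by
    intro D hD
    have hiD : i ∉ D := fun h => hi' (mem_powerset.mp hD h)
    rw [addDiag_insert hiD, nullity_insert_of_one hi'
      (by simp [addDiag, hiD, hii]) fun u v h => addDiag_singleton_ne h]
  have hfirst : ∀ D ∈ V.powerset, nullity (insert i (insert j V)) (addDiag M D) =
      nullity V (addDiag (fun u v => M u v + M u i * M j v + M u j * M i v) D) := by
    intro D hD
    have hDV := mem_powerset.mp hD
    have hiD : i ∉ D := fun h => hi (hDV h)
    have hjD : j ∉ D := fun h => hj (hDV h)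
    rw [nullity_schurPair hij hi hj]
    · refine nullity_congr fun u hu v hv => ?_
      have := ne_of_mem_of_not_mem hu hi
      have := ne_of_mem_of_not_mem hu hj
      have := ne_of_mem_of_not_mem hv hi
      have := ne_of_mem_of_not_mem hv hj
      simp_all [schurPair, addDiag, eq_comm]
      ring
    · simp [addDiag, hiD, hii]
    · simp [addDiag, hij, hMij]
    · simp [addDiag, hij.symm, hM j i, hMij]
  have hfirst' : ∀ D ∈ V.powerset, nullity (insert i (insert j V)) (addDiag M (insert j D)) =
      nullity V (addDiag
        (fun u v => M u v + M u i * M j v + M u j * M i v + M u i * M i v) D) := by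
    intro D hD
    have hDV := mem_powerset.mp hD
    have hiD : i ∉ D := fun h => hi (hDV h)
    have hjD : j ∉ D := fun h => hj (hDV h)
    rw [nullity_schurPair hij hi hj]
    · refine nullity_congr fun u hu v hv => ?_
      have := ne_of_mem_of_not_mem hu hi
      have := ne_of_mem_of_not_mem hu hj
      have := ne_of_mem_of_not_mem hv hi
      have := ne_of_mem_of_not_mem hv hj
      simp_all [schurPair, addDiag, eq_comm]
      ring
    · simp [addDiag, hiD, hii, hij]
    · simp [addDiag, hij, hMij]
    · simp [addDiag, hij.symm, hM j i, hMij]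
  have hs₂ : ∑ D ∈ (insert j V).powerset,
      (nullity (insert i (insert j V)) (addDiag M (insert i D)) : ℤ) *
        (-2) ^ nullity (insert i (insert j V)) (addDiag M (insert i D)) = _ :=
    sum_congr rfl fun D hD => by rw [hsecond D hD]
  have hs₁ : ∑ D ∈ V.powerset, (nullity (insert i (insert j V)) (addDiag M D) : ℤ) *
        (-2) ^ nullity (insert i (insert j V)) (addDiag M D) = _ :=
    sum_congr rfl fun D hD => by rw [hfirst D hD]
  have hs₁' : ∑ D ∈ V.powerset, (nullity (insert i (insert j V)) (addDiag M (insert j D)) : ℤ) *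
        (-2) ^ nullity (insert i (insert j V)) (addDiag M (insert j D)) = _ :=
    sum_congr rfl fun D hD => by rw [hfirst' D hD]
  rw [hs₂, sum_powerset_insert hj, hs₁, hs₁', card_insert_of_notMem hj]
  ring

/-- Write the spin as 1 minus twice the indicator of i ∈ D. The states with i ∈ D have a pivot at i
and one vertex fewer, which turns -2 into +2. -/
lemma mean_nullity_mul_spin {V : Finset ℕ} {M : ℕ → ℕ → ZMod 2} {i : ℕ} (hi : i ∉ V)
    (h0 : M i i = 0) :
    mean (insert i V) M (fun D => nullity (insert i V) (addDiag M D) * spin i D) =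
      kappa (insert i V) M + 2 * kappa V (schur M i) := by
  simp only [kappa, mean, card_insert_of_notMem hi, sum_powerset_insert hi]
  have h1 : ∀ D ∈ V.powerset, nullity (insert i V) (addDiag M (insert i D)) =
      nullity V (addDiag (schur M i) D) := by
    intro D hD
    have hiD : i ∉ D := fun h => hi (mem_powerset.mp hD h)
    rw [addDiag_insert hiD, nullity_insert_of_one hi
      (by simp [addDiag, hiD, h0]) fun u v h => addDiag_singleton_ne h]
  have h2 : ∀ D ∈ V.powerset, (nullity (insert i V) (addDiag M D) : ℤ) * spin i D *
      (-2) ^ nullity (insert i V) (addDiag M D) = (nullity (insert i V) (addDiag M D) : ℤ) *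
      (-2) ^ nullity (insert i V) (addDiag M D) := by
    intro D hD
    have hiD : i ∉ D := fun h => hi (mem_powerset.mp hD h)
    simp [spin, hiD]
  have h3 : ∀ D ∈ V.powerset, (nullity (insert i V) (addDiag M (insert i D)) : ℤ) *
      spin i (insert i D) * (-2) ^ nullity (insert i V) (addDiag M (insert i D)) =
      -((nullity V (addDiag (schur M i) D) : ℤ) * (-2) ^ nullity V (addDiag (schur M i) D)) := by
    intro D hD
    rw [h1 D hD]; simp [spin]
  rw [sum_congr rfl h2, sum_congr rfl h3,
    sum_congr (s₁ := V.powerset) (f := fun D => (nullity (insert i V) (addDiag M (insert i D)) : ℤ) *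
      (-2) ^ nullity (insert i V) (addDiag M (insert i D))) rfl fun D hD => by rw [h1 D hD],
    sum_neg_distrib]
  ring

end KnotTheory

namespace KnotTheory

open Finset

/-! ### Third derivatives of the Jones polynomial -/

/-- The power `t ^ β * (t ^ (1 / 2) + t ^ (-1 / 2)) ^ k`. -/
noncomputable def stateTerm (β : ℝ) (k : ℕ) (t : ℝ) : ℝ :=
  t ^ β * (t ^ (1 / 2 : ℝ) + t ^ (-(1 / 2) : ℝ)) ^ k

lemma contDiffAt_stateTerm (β : ℝ) (k n : ℕ) : ContDiffAt ℝ n (stateTerm β k) 1 := by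
  unfold stateTerm
  have h : ∀ r : ℝ, ContDiffAt ℝ n (fun t : ℝ => t ^ r) 1 := fun r =>
    Real.contDiffAt_rpow_const_of_ne one_ne_zero
  exact (h β).mul (((h _).add (h _)).pow k)

/-- The combination of derivatives at `1` that computes `-144 v₃`. -/
noncomputable def jet (f : ℝ → ℝ) : ℝ := iteratedDeriv 3 f 1 + 3 * iteratedDeriv 2 f 1

lemma jet_congr {f g : ℝ → ℝ} (h : ∀ t > 0, f t = g t) : jet f = jet g := by
  have h' : f =ᶠ[nhds 1] g := by
    filter_upwards [lt_mem_nhds (zero_lt_one' ℝ)] with t ht using h t ht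
  rw [jet, jet, h'.iteratedDeriv_eq 3, h'.iteratedDeriv_eq 2]

lemma jet_sum {ι : Type*} (s : Finset ι) (c : ι → ℝ) (β : ι → ℝ) (k : ι → ℕ) :
    jet (fun t => ∑ i ∈ s, c i * stateTerm (β i) (k i) t) =
      ∑ i ∈ s, c i * jet (stateTerm (β i) (k i)) := by
  have h : ∀ n : ℕ, iteratedDeriv n (fun t => ∑ i ∈ s, c i * stateTerm (β i) (k i) t) 1 =
      ∑ i ∈ s, c i * iteratedDeriv n (stateTerm (β i) (k i)) 1 := by
    intro n
    rw [iteratedDeriv_fun_sum fun i _ => contDiffAt_const.mul (contDiffAt_stateTerm _ _ n)]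
    exact sum_congr rfl fun i _ => iteratedDeriv_const_mul_field _ _
  simp only [jet, h, mul_sum, mul_add, ← sum_add_distrib]
  exact sum_congr rfl fun i _ => by ring

/-- At t = 1 the operator f''' + 3f'' equals θ³ - θ with θ = t d/dt, so it takes t^β to β³ - β.
Expanding the k-th power moves β by k independent steps ±1/2; the variance k/4 accounts for the term
3kβ/4. -/
lemma jet_stateTerm (β : ℝ) (k : ℕ) :
    jet (stateTerm β k) = 2 ^ k * (β ^ 3 + 3 / 4 * k * β - β) := by
  induction k generalizing β with
  | zero =>
    have h : stateTerm β 0 = fun t => t ^ β := by ext t; simp [stateTerm]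
    rw [jet, h, iteratedDeriv_eq_iterate, iteratedDeriv_eq_iterate, Real.iter_deriv_rpow_const,
      Real.iter_deriv_rpow_const]
    simp only [Real.one_rpow, mul_one, descPochhammer_succ_right, descPochhammer_zero,
      Polynomial.eval_mul, Polynomial.eval_sub, Polynomial.eval_X, Polynomial.eval_natCast,
      Polynomial.eval_one]
    push_cast
    ring
  | succ k ih =>
    have h : ∀ t > 0, stateTerm β (k + 1) t = ∑ i ∈ (univ : Finset Bool),
        (1 : ℝ) * stateTerm (if i then β + 1 / 2 else β + -(1 / 2)) k t := by
      intro t ht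
      simp only [Fintype.sum_bool, stateTerm, if_true, Bool.false_eq_true, if_false,
        Real.rpow_add ht]
      ring
    rw [jet_congr h, jet_sum]
    simp only [Fintype.sum_bool, if_true, Bool.false_eq_true, if_false, ih]
    push_cast
    ring

lemma neg_one_zpow_sum (V : Finset ℕ) (s : ℕ → ℤ) (hs : ∀ i ∈ V, s i = 1 ∨ s i = -1) :
    (-1 : ℝ) ^ (-∑ i ∈ V, s i) = (-1) ^ #V := by
  induction V using Finset.induction_on with
  | empty => simp
  | insert i V hi ih =>
    rw [sum_insert hi, card_insert_of_notMem hi, neg_add, zpow_add₀ (by norm_num),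
      ih fun j hj => hs j (mem_insert_of_mem hj), pow_succ']
    congr 1
    rcases hs i (mem_insert_self _ _) with h | h <;> rw [h] <;> norm_num

/-- The sum of the centred spins with the signs `s`. -/
def spinSum (V : Finset ℕ) (s : ℕ → ℤ) (D : Finset ℕ) : ℤ := ∑ i ∈ V, s i * cspin i D

/-- The degree three invariant as an average over states. -/
theorem v3_eq_mean (K : Diagram) {M : ℕ → ℕ → ZMod 2} {s : ℕ → ℤ}
    (hs : ∀ i ∈ crossings K.code, s i = 1 ∨ s i = -1)
    (hw : writhe K.code = ∑ i ∈ crossings K.code, s i)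
    (hcirc : ∀ S ⊆ crossings K.code, numCircles K.code S - 1 = nullity (crossings K.code)
      (addDiag M (symmDiff S ((crossings K.code).filter fun i => s i = 1)))) :
    2304 * (4 * K.v3) = ((mean (crossings K.code) M fun D =>
      spinSum (crossings K.code) s D ^ 3 + 12 * nullity (crossings K.code) (addDiag M D) *
        spinSum (crossings K.code) s D : ℤ) : ℝ) - 16 * ((mean (crossings K.code) M
          (spinSum (crossings K.code) s) : ℤ) : ℝ) := by
  set V := crossings K.code with hV
  set P : Finset ℕ := V.filter fun i => s i = 1 with hP
  have hPV : P ⊆ V := filter_subset _ _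
  let k : Finset ℕ → ℕ := fun D => nullity V (addDiag M D)
  let Y : Finset ℕ → ℤ := spinSum V s
  -- States are reindexed by the set D of crossings smoothed against the orientation. The exponents
  -- of A from the smoothings and from the writhe then combine to Y, the signed sum of spins minus
  -- 3.
  have hjones : ∀ t > 0, K.jones t = ∑ D ∈ V.powerset,
      ((-1) ^ #V * (-1) ^ k D) * stateTerm (-(Y D) / 4) (k D) t := by
    intro t ht
    rw [Diagram.jones, kauffmanBracket, mul_sum]
    set A : ℝ := t ^ (-(1 / 4) : ℝ) with hA
    have hA0 : 0 < A := Real.rpow_pos_of_pos ht _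
    have hAz : ∀ z : ℤ, A ^ z = t ^ (-(z : ℝ) / 4) := by
      intro z
      rw [hA, ← Real.rpow_intCast, ← Real.rpow_mul ht.le]
      congr 1; ring
    have hd : -A ^ 2 - A ^ (-2 : ℤ) = -(t ^ (1 / 2 : ℝ) + t ^ (-(1 / 2) : ℝ)) := by
      have h2 : A ^ 2 = A ^ (2 : ℤ) := by norm_cast
      rw [h2, hAz, hAz]
      norm_num
      ring
    have hmem : ∀ D ∈ V.powerset, symmDiff D P ∈ V.powerset := fun D hD =>
      mem_powerset.mpr (symmDiff_le (le_sup_of_le_right (mem_powerset.mp hD))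
        (le_sup_of_le_right hPV))
    have hinv : ∀ D ∈ V.powerset, symmDiff (symmDiff D P) P = D := fun D _ =>
      symmDiff_symmDiff_cancel_right _ _
    refine sum_nbij' (fun D => symmDiff D P) (fun D => symmDiff D P) hmem hmem hinv hinv
      fun S hS => ?_
    have hSV := mem_powerset.mp hS
    rw [hcirc S hSV, hd, hw]
    have hexp : (#S : ℤ) - (#(V \ S) : ℤ) = ∑ i ∈ V, s i * spin i (symmDiff S P) := by
      have h1 : ∀ i ∈ V, s i * spin i (symmDiff S P) = if i ∈ S then 1 else -1 := by
        intro i hi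
        have hiP : i ∈ P ↔ s i = 1 := by simp [hP, hi]
        simp only [spin, mem_symmDiff, hiP]
        rcases hs i hi with h | h <;> by_cases hiS : i ∈ S <;> simp [h, hiS]
      rw [sum_congr rfl h1, sum_ite, sum_const, sum_const, filter_mem_eq_inter,
        inter_eq_right.mpr hSV, filter_notMem_eq_sdiff]
      simp
      ring
    have hY : (Y (symmDiff S P) : ℤ) = ((#S : ℤ) - (#(V \ S) : ℤ)) + 3 * -∑ i ∈ V, s i := by
      rw [hexp]
      simp only [Y, spinSum, cspin, mul_sub, sum_sub_distrib, ← sum_mul]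
      ring
    rw [neg_eq_neg_one_mul (A ^ 3), mul_zpow, neg_one_zpow_sum V s hs, stateTerm,
      ← hAz, hY, zpow_add₀ hA0.ne', neg_eq_neg_one_mul (_ + _), mul_pow, ← zpow_natCast A 3,
      ← zpow_mul]
    simp only [k, ← hV]
    push_cast
    ring
  have hjet : jet K.jones = -144 * K.v3 := by
    rw [jet, Diagram.v3]; ring
  have h := jet_congr hjones
  rw [hjet, jet_sum] at h
  simp only [jet_stateTerm] at h
  -- The factor -64 clears β = -Y/4: the terms β³, 3kβ/4 and -β become Y³, 12kY and -16Y.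
  have h1 : 2304 * (4 * K.v3) = -64 * (-144 * K.v3) := by ring
  rw [h1, h, mean, mean]
  push_cast
  simp only [mul_sum, ← sum_sub_distrib]
  refine sum_congr rfl fun D _ => ?_
  have h2 : ((-2 : ℝ)) ^ nullity V (addDiag M D) = (-1) ^ k D * 2 ^ k D := by
    rw [← mul_pow]; norm_num [k]
  rw [h2]
  simp only [Y, k]
  ring

end KnotTheory

namespace KnotTheory

/-! ### Iterated sums over lists -/

section ListSums

variable {α β R : Type*} [CommRing R]

/-- The sum over the entries of a list. -/
def sum₁ (f : α → R) : List α → R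
  | [] => 0
  | x :: l => f x + sum₁ f l

/-- The sum over the pairs of entries of a list, in order. -/
def sum₂ (g : α → α → R) : List α → R
  | [] => 0
  | x :: l => sum₁ (g x) l + sum₂ g l

/-- The sum over the triples of entries of a list, in order. -/
def sum₃ (g : α → α → α → R) : List α → R
  | [] => 0
  | x :: l => sum₂ (g x) l + sum₃ g l

/-- The sum over the quadruples of entries of a list, in order. -/
def sum₄ (g : α → α → α → α → R) : List α → R
  | [] => 0
  | x :: l => sum₃ (g x) l + sum₄ g l

lemma sum₁_congr {f g : α → R} {l : List α} (h : ∀ x ∈ l, f x = g x) : sum₁ f l = sum₁ g l := by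
  induction l with
  | nil => rfl
  | cons x l ih =>
    rw [sum₁, sum₁, h x (by simp), ih fun y hy => h y (by simp [hy])]

lemma sum₂_congr {f g : α → α → R} {l : List α} (h : ∀ x ∈ l, ∀ y ∈ l, f x y = g x y) :
    sum₂ f l = sum₂ g l := by
  induction l with
  | nil => rfl
  | cons x l ih =>
    rw [sum₂, sum₂, sum₁_congr fun y hy => h x (by simp) y (by simp [hy]),
      ih fun y hy z hz => h y (by simp [hy]) z (by simp [hz])]

lemma sum₃_congr {f g : α → α → α → R} {l : List α}
    (h : ∀ x ∈ l, ∀ y ∈ l, ∀ z ∈ l, f x y z = g x y z) : sum₃ f l = sum₃ g l := by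
  induction l with
  | nil => rfl
  | cons x l ih =>
    rw [sum₃, sum₃, sum₂_congr fun y hy z hz => h x (by simp) y (by simp [hy]) z (by simp [hz]),
      ih fun y hy z hz t ht => h y (by simp [hy]) z (by simp [hz]) t (by simp [ht])]

@[simp] lemma sum₁_zero (l : List α) : sum₁ (fun _ => (0 : R)) l = 0 := by
  induction l with
  | nil => rfl
  | cons x l ih => rw [sum₁, ih, add_zero]

@[simp] lemma sum₂_zero (l : List α) : sum₂ (fun _ _ => (0 : R)) l = 0 := by
  induction l with
  | nil => rfl
  | cons x l ih => rw [sum₂, ih, sum₁_zero, add_zero]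

@[simp] lemma sum₃_zero (l : List α) : sum₃ (fun _ _ _ => (0 : R)) l = 0 := by
  induction l with
  | nil => rfl
  | cons x l ih => rw [sum₃, ih, sum₂_zero, add_zero]

lemma sum₁_eq_zero {f : α → R} {l : List α} (h : ∀ x ∈ l, f x = 0) : sum₁ f l = 0 := by
  rw [sum₁_congr h, sum₁_zero]

lemma sum₂_eq_zero {f : α → α → R} {l : List α} (h : ∀ x ∈ l, ∀ y ∈ l, f x y = 0) :
    sum₂ f l = 0 := by
  rw [sum₂_congr h, sum₂_zero]

lemma sum₃_eq_zero {f : α → α → α → R} {l : List α}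
    (h : ∀ x ∈ l, ∀ y ∈ l, ∀ z ∈ l, f x y z = 0) : sum₃ f l = 0 := by
  rw [sum₃_congr h, sum₃_zero]

lemma sum₁_add (f g : α → R) (l : List α) : sum₁ (fun x => f x + g x) l = sum₁ f l + sum₁ g l := by
  induction l with
  | nil => simp [sum₁]
  | cons x l ih => simp only [sum₁, ih]; ring

lemma sum₁_mul_left (c : R) (f : α → R) (l : List α) : sum₁ (fun x => c * f x) l = c * sum₁ f l := by
  induction l with
  | nil => simp [sum₁]
  | cons x l ih => simp only [sum₁, ih]; ring

lemma sum₁_mul_right (c : R) (f : α → R) (l : List α) :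
    sum₁ (fun x => f x * c) l = sum₁ f l * c := by
  simp only [mul_comm _ c, sum₁_mul_left]

lemma sum₁_neg (f : α → R) (l : List α) : sum₁ (fun x => -f x) l = -sum₁ f l := by
  have := sum₁_mul_left (-1) f l
  simpa using this

lemma sum₁_sub (f g : α → R) (l : List α) : sum₁ (fun x => f x - g x) l = sum₁ f l - sum₁ g l := by
  simp only [sub_eq_add_neg, sum₁_add, sum₁_neg]

lemma sum₂_add (f g : α → α → R) (l : List α) :
    sum₂ (fun x y => f x y + g x y) l = sum₂ f l + sum₂ g l := by
  induction l with
  | nil => simp [sum₂]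
  | cons x l ih => simp only [sum₂, ih, sum₁_add]; ring

lemma sum₂_mul_left (c : R) (f : α → α → R) (l : List α) :
    sum₂ (fun x y => c * f x y) l = c * sum₂ f l := by
  induction l with
  | nil => simp [sum₂]
  | cons x l ih => simp only [sum₂, ih, sum₁_mul_left]; ring

lemma sum₂_neg (f : α → α → R) (l : List α) : sum₂ (fun x y => -f x y) l = -sum₂ f l := by
  have := sum₂_mul_left (-1) f l
  simpa using this

lemma sum₃_mul_left (c : R) (f : α → α → α → R) (l : List α) :
    sum₃ (fun x y z => c * f x y z) l = c * sum₃ f l := by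
  induction l with
  | nil => simp [sum₃]
  | cons x l ih => simp only [sum₃, ih, sum₂_mul_left]; ring

lemma sum₃_neg (f : α → α → α → R) (l : List α) :
    sum₃ (fun x y z => -f x y z) l = -sum₃ f l := by
  have := sum₃_mul_left (-1) f l
  simpa using this

lemma sum₁_append (f : α → R) (A B : List α) : sum₁ f (A ++ B) = sum₁ f A + sum₁ f B := by
  induction A with
  | nil => simp [sum₁]
  | cons x A ih => simp only [List.cons_append, sum₁, ih]; ring

lemma sum₂_append (g : α → α → R) (A B : List α) :
    sum₂ g (A ++ B) = sum₂ g A + sum₁ (fun x => sum₁ (g x) B) A + sum₂ g B := by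
  induction A with
  | nil => simp [sum₁, sum₂]
  | cons x A ih => simp only [List.cons_append, sum₁, sum₂, ih, sum₁_append]; ring

lemma sum₃_append (g : α → α → α → R) (A B : List α) :
    sum₃ g (A ++ B) = sum₃ g A + sum₂ (fun x y => sum₁ (g x y) B) A +
      sum₁ (fun x => sum₂ (g x) B) A + sum₃ g B := by
  induction A with
  | nil => simp [sum₁, sum₂, sum₃]
  | cons x A ih => simp only [List.cons_append, sum₁, sum₂, sum₃, ih, sum₂_append]; ring

lemma sum₄_append (g : α → α → α → α → R) (A B : List α) :
    sum₄ g (A ++ B) = sum₄ g A + sum₃ (fun x y z => sum₁ (g x y z) B) A +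
      sum₂ (fun x y => sum₂ (g x y) B) A + sum₁ (fun x => sum₃ (g x) B) A + sum₄ g B := by
  induction A with
  | nil => simp [sum₁, sum₂, sum₃, sum₄]
  | cons x A ih =>
    simp only [List.cons_append, sum₁, sum₂, sum₃, sum₄, ih, sum₃_append]; ring

lemma sum₁_reverse (f : α → R) (l : List α) : sum₁ f l.reverse = sum₁ f l := by
  induction l with
  | nil => rfl
  | cons x l ih => simp only [List.reverse_cons, sum₁_append, sum₁, ih]; ring

lemma sum₁_sum₁_comm (g : α → β → R) (A : List α) (B : List β) :
    sum₁ (fun x => sum₁ (g x) B) A = sum₁ (fun y => sum₁ (fun x => g x y) A) B := by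
  induction A with
  | nil => simp [sum₁]
  | cons x A ih => simp only [sum₁, ih, sum₁_add]

lemma sum₂_sum₁_comm (g : α → α → β → R) (A : List α) (B : List β) :
    sum₂ (fun x x' => sum₁ (g x x') B) A = sum₁ (fun y => sum₂ (fun x x' => g x x' y) A) B := by
  induction A with
  | nil => simp [sum₂]
  | cons x A ih => simp only [sum₂, ih, sum₁_add, sum₁_sum₁_comm (g x) A B]

lemma sum₂_reverse (g : α → α → R) (l : List α) :
    sum₂ g l.reverse = sum₂ (fun x y => g y x) l := by
  induction l with
  | nil => rfl
  | cons x l ih =>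
    simp only [List.reverse_cons, sum₂_append, sum₂, sum₁, ih, sum₁_reverse, add_zero]; ring

lemma sum₃_reverse (g : α → α → α → R) (l : List α) :
    sum₃ g l.reverse = sum₃ (fun x y z => g z y x) l := by
  induction l with
  | nil => rfl
  | cons x l ih =>
    simp only [List.reverse_cons, sum₃_append, sum₃, sum₂, sum₁, ih, sum₂_reverse, sum₁_zero,
      add_zero]
    ring

lemma sum₄_reverse (g : α → α → α → α → R) (l : List α) :
    sum₄ g l.reverse = sum₄ (fun x y z t => g t z y x) l := by
  induction l with
  | nil => rfl
  | cons x l ih =>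
    simp only [List.reverse_cons, sum₄_append, sum₄, sum₃, sum₂, sum₁, ih, sum₃_reverse, sum₁_zero,
      sum₂_zero, add_zero]
    ring

lemma sum₁_map (f : β → R) (φ : α → β) (l : List α) :
    sum₁ f (l.map φ) = sum₁ (fun x => f (φ x)) l := by
  induction l with
  | nil => rfl
  | cons x l ih => simp only [List.map_cons, sum₁, ih]

lemma sum₂_map (f : β → β → R) (φ : α → β) (l : List α) :
    sum₂ f (l.map φ) = sum₂ (fun x y => f (φ x) (φ y)) l := by
  induction l with
  | nil => rfl
  | cons x l ih => simp only [List.map_cons, sum₂, ih, sum₁_map]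

lemma sum₃_map (f : β → β → β → R) (φ : α → β) (l : List α) :
    sum₃ f (l.map φ) = sum₃ (fun x y z => f (φ x) (φ y) (φ z)) l := by
  induction l with
  | nil => rfl
  | cons x l ih => simp only [List.map_cons, sum₃, ih, sum₂_map]

lemma sum₄_map (f : β → β → β → β → R) (φ : α → β) (l : List α) :
    sum₄ f (l.map φ) = sum₄ (fun x y z t => f (φ x) (φ y) (φ z) (φ t)) l := by
  induction l with
  | nil => rfl
  | cons x l ih => simp only [List.map_cons, sum₄, ih, sum₃_map]

/-- Products of intersection numbers arise from ordered pairs in this way. In the uses below the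
diagonal term vanishes, or survives as a count such as `crossNum` or `passCount`. -/
lemma sum₂_symm_mul (f h : α → R) (l : List α) :
    sum₂ (fun x y => f x * h y + f y * h x) l = sum₁ f l * sum₁ h l - sum₁ (fun x => f x * h x) l := by
  induction l with
  | nil => simp [sum₁, sum₂]
  | cons x l ih => simp only [sum₁, sum₂, ih, sum₁_add, sum₁_mul_left, sum₁_mul_right]; ring

end ListSums

/-! ### Flat curves and their crossing signs -/

/-- A passage of a closed curve through a transversal crossing: the name of the crossing, which of
the two branches is passed, and in which direction.  At each crossing the two branches come with
fixed directions such that the pair (first branch, second branch) is positively oriented. -/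
structure Pass where
  label : ℕ
  isFst : Bool
  fwd : Bool

/-- The branch of a passage. -/
def Pass.branch (x : Pass) : ℕ × Bool := (x.label, x.isFst)

/-- The same passage in the opposite direction. -/
def Pass.rev (x : Pass) : Pass := ⟨x.label, x.isFst, !x.fwd⟩

/-- The sign of a Boolean. -/
def sg (b : Bool) : ℤ := if b then 1 else -1

/-- The orientation of a pair of passages through one crossing. -/
def eps (x y : Pass) : ℤ :=
  if x.label = y.label ∧ x.isFst ≠ y.isFst then sg x.isFst * sg x.fwd * sg y.fwd else 0

lemma sg_not (b : Bool) : sg (!b) = -sg b := by cases b <;> rfl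

lemma sg_mul_self (b : Bool) : sg b * sg b = 1 := by cases b <;> rfl

lemma eps_swap (x y : Pass) : eps y x = -eps x y := by
  unfold eps
  by_cases h : x.label = y.label ∧ x.isFst ≠ y.isFst
  · have hs : sg y.isFst = -sg x.isFst := by
      rw [← sg_not]; congr 1
      cases hx : x.isFst <;> cases hy : y.isFst <;> simp_all
    rw [if_pos h, if_pos ⟨h.1.symm, h.2.symm⟩, hs]; ring
  · rw [if_neg h, if_neg fun h' => h ⟨h'.1.symm, h'.2.symm⟩, neg_zero]

lemma eps_rev_left (x y : Pass) : eps x.rev y = -eps x y := by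
  simp only [eps, Pass.rev, sg_not]
  split_ifs <;> ring

lemma eps_rev_right (x y : Pass) : eps x y.rev = -eps x y := by
  rw [eps_swap, eps_rev_left, eps_swap x y, neg_neg]

lemma eps_of_label_ne {x y : Pass} (h : x.label ≠ y.label) : eps x y = 0 := if_neg fun h' => h h'.1

lemma eps_mul_self_of_match {x y : Pass} (h : x.label = y.label) (h' : x.isFst ≠ y.isFst) :
    eps x y * eps x y = 1 := by
  rw [eps, if_pos ⟨h, h'⟩]
  have h1 := sg_mul_self x.isFst
  have h2 := sg_mul_self x.fwd
  have h3 := sg_mul_self y.fwd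
  linear_combination sg x.fwd * sg x.fwd * sg y.fwd * sg y.fwd * h1 +
    sg y.fwd * sg y.fwd * h2 + h3

/-- A common partner of two passages forces them to be on the same branch. -/
lemma eps_mul_eps_of_branch_ne {x x' y : Pass} (h : x.branch ≠ x'.branch) :
    eps x y * eps x' y = 0 := by
  by_contra hne
  have h1 : x.label = y.label ∧ x.isFst ≠ y.isFst := by
    by_contra h'; exact hne (by rw [eps, if_neg h', zero_mul])
  have h2 : x'.label = y.label ∧ x'.isFst ≠ y.isFst := by
    by_contra h'; exact hne (by rw [show eps x' y = 0 from if_neg h', mul_zero])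
  refine h (Prod.ext (h1.1.trans h2.1.symm) ?_)
  show x.isFst = x'.isFst
  have h3 := h1.2
  have h4 := h2.2
  revert h3 h4
  cases x.isFst <;> cases x'.isFst <;> cases y.isFst <;> simp

/-- The passages of a list are on different branches. -/
def BranchNodup (l : List Pass) : Prop := (l.map Pass.branch).Nodup

lemma sum₂_eps_mul_eps {l : List Pass} (h : BranchNodup l) (y : Pass) :
    sum₂ (fun x x' => eps x y * eps x' y) l = 0 := by
  induction l with
  | nil => rfl
  | cons x l ih =>
    simp only [BranchNodup, List.map_cons, List.nodup_cons] at h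
    rw [sum₂, ih h.2, add_zero]
    exact sum₁_eq_zero fun z hz => eps_mul_eps_of_branch_ne fun hb =>
      h.1 (hb ▸ List.mem_map_of_mem hz)

/-- The signed number of crossings between two pieces of a curve. -/
def cross (A B : List Pass) : ℤ := sum₁ (fun x => sum₁ (eps x) B) A

lemma cross_swap (A B : List Pass) : cross B A = -cross A B := by
  rw [cross, sum₁_sum₁_comm, cross, ← sum₁_neg]
  simp only [← sum₁_neg]
  exact sum₁_congr fun x _ => sum₁_congr fun y _ => eps_swap x y

lemma cross_append_right (A B C : List Pass) : cross A (B ++ C) = cross A B + cross A C := by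
  simp only [cross, sum₁_append, sum₁_add]

lemma cross_cons_left (x : Pass) (A B : List Pass) : cross (x :: A) B = sum₁ (eps x) B + cross A B :=
  rfl

lemma cross_self (A : List Pass) : cross A A = 0 := by
  have := cross_swap A A
  omega

/-- The number of crossings between two pieces of a curve. -/
def crossNum (A B : List Pass) : ℤ := sum₁ (fun x => sum₁ (eps x) B * sum₁ (eps x) B) A

/-- The sum over the pairs of interlaced crossings of the product of the orientations of the two
crossings, each in the order of passage. -/
def Phi (l : List Pass) : ℤ := sum₄ (fun a b c d => eps a c * eps b d) l

/-- The part of `Phi (A ++ B)` coming from pairs of interlaced crossings one of which joins `A` to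
`B` and the other one joins `B` to itself. -/
def PhiMix (A B : List Pass) : ℤ :=
  sum₁ (fun x => sum₃ (fun a b c => eps x b * eps a c) B) A

/-! ### Joining two arcs directly, and with one of them reversed. -/

/-- The reversed curve. -/
def revPath (l : List Pass) : List Pass := (l.map Pass.rev).reverse

lemma revPath_append (A B : List Pass) : revPath (A ++ B) = revPath B ++ revPath A := by
  simp [revPath]

lemma Phi_revPath (l : List Pass) : Phi (revPath l) = Phi l := by
  rw [Phi, revPath, sum₄_reverse, sum₄_map, Phi]
  congr 1
  ext a b c d
  rw [eps_rev_left, eps_rev_right, eps_rev_left, eps_rev_right, eps_swap b d, eps_swap a c]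
  ring

lemma sum₁_revPath (x : Pass) (l : List Pass) : sum₁ (eps x) (revPath l) = -sum₁ (eps x) l := by
  rw [revPath, sum₁_reverse, sum₁_map, ← sum₁_neg]
  exact sum₁_congr fun y _ => eps_rev_right x y

/-- The quadruples are sorted by how many of their entries lie in A: four, three, two, one or none.
-/
lemma Phi_append (A B : List Pass) : Phi (A ++ B) = Phi A +
    sum₃ (fun a b c => eps a c * sum₁ (eps b) B) A +
    sum₂ (fun a b => sum₂ (fun c d => eps a c * eps b d) B) A + PhiMix A B + Phi B := by
  rw [Phi, sum₄_append]
  simp only [sum₁_mul_left]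
  rfl

/-- Against `Phi_append`, the term with a single entry in B has one sign change, hence is negated.
With two entries in B the signs cancel but their order along B is exchanged. -/
lemma Phi_append_revPath (A B : List Pass) : Phi (A ++ revPath B) = Phi A -
    sum₃ (fun a b c => eps a c * sum₁ (eps b) B) A +
    sum₂ (fun a b => sum₂ (fun c d => eps a d * eps b c) B) A + PhiMix A B + Phi B := by
  rw [Phi_append, Phi_revPath]
  have h1 : sum₃ (fun a b c => eps a c * sum₁ (eps b) (revPath B)) A =
      -sum₃ (fun a b c => eps a c * sum₁ (eps b) B) A := by
    rw [← sum₃_neg]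
    congr 1; ext a b c; rw [sum₁_revPath]; ring
  have h2 : ∀ a b : Pass, sum₂ (fun c d => eps a c * eps b d) (revPath B) =
      sum₂ (fun c d => eps a d * eps b c) B := by
    intro a b
    rw [revPath, sum₂_reverse, sum₂_map]
    congr 1; ext c d; rw [eps_rev_right, eps_rev_right]; ring
  have h3 : PhiMix A (revPath B) = PhiMix A B := by
    refine sum₁_congr fun x _ => ?_
    rw [revPath, sum₃_reverse, sum₃_map]
    congr 1; ext a b c
    rw [eps_rev_right, eps_rev_left, eps_rev_right, eps_swap a c]; ring
  simp only [h1, h2, h3]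
  ring

/-- Two crossings joining A to B occur along B in one order or the other, so together these are all
pairs: half the square of the signed count, less the diagonal. Distinct branches in A exclude that
two entries of A meet the same passage of B. -/
lemma sum₂_sum₂_eps {A B : List Pass} (hA : BranchNodup A) :
    2 * (sum₂ (fun a b => sum₂ (fun c d => eps a c * eps b d) B) A +
      sum₂ (fun a b => sum₂ (fun c d => eps a d * eps b c) B) A) =
    cross A B * cross A B - crossNum A B := by
  have h1 : sum₂ (fun a b => sum₂ (fun c d => eps a c * eps b d) B) A +
      sum₂ (fun a b => sum₂ (fun c d => eps a d * eps b c) B) A =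
      sum₂ (fun a b => sum₁ (eps a) B * sum₁ (eps b) B) A := by
    rw [← sum₂_add]
    have h2 : ∀ a b : Pass, sum₂ (fun c d => eps a c * eps b d) B +
        sum₂ (fun c d => eps a d * eps b c) B =
        sum₁ (eps a) B * sum₁ (eps b) B + -sum₁ (fun c => eps a c * eps b c) B := by
      intro a b
      rw [← sum₂_add, ← sub_eq_add_neg, ← sum₂_symm_mul]
    simp only [h2]
    rw [sum₂_add, sum₂_neg, sum₂_sum₁_comm, sum₁_eq_zero fun y _ => sum₂_eps_mul_eps hA y,
      neg_zero, add_zero]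
  rw [h1, cross, crossNum, ← sum₂_symm_mul, ← sum₂_mul_left]
  congr 1; ext a b; ring

/-- The terms with three entries in A cancel between the two ways of joining, and the terms with two
entries in each arc combine to a square. -/
lemma Phi_append_add_revPath {A B : List Pass} (hA : BranchNodup A) :
    2 * (Phi (A ++ B) + Phi (A ++ revPath B)) =
      4 * Phi A + 4 * Phi B + 4 * PhiMix A B + cross A B * cross A B - crossNum A B := by
  have := sum₂_sum₂_eps (B := B) hA
  rw [Phi_append, Phi_append_revPath]
  linear_combination this

lemma Phi_remove {P Q : List Pass} {x : Pass} (hP : ∀ y ∈ P, eps x y = 0)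
    (hQ : ∀ y ∈ Q, eps x y = 0) : Phi (P ++ x :: Q) = Phi (P ++ Q) := by
  have hx : ∀ y ∈ P, eps y x = 0 := fun y hy => by rw [eps_swap, hP y hy, neg_zero]
  have h1 : Phi (x :: Q) = Phi Q := by
    rw [Phi, sum₄, sum₃_eq_zero, zero_add, Phi]
    intro a _ b hb c _
    rw [hQ b hb, zero_mul]
  have h2 : ∀ y ∈ P, sum₁ (eps y) (x :: Q) = sum₁ (eps y) Q := fun y hy => by
    rw [sum₁, hx y hy, zero_add]
  rw [Phi_append, Phi_append, h1]
  congr 1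
  congr 1
  · congr 1
    · rw [sum₃_congr fun a _ b hb c _ => by rw [h2 b hb]]
    · refine sum₂_congr fun a ha b hb => ?_
      rw [sum₂, sum₁_eq_zero, zero_add]
      intro c _
      rw [hx a ha, zero_mul]
  · refine sum₁_congr fun a ha => ?_
    rw [sum₃, sum₂_eq_zero, zero_add]
    intro b hb c hc
    rw [hQ c hc, mul_zero]

lemma sum₃_eps_append_cons {A B : List Pass} {i i' : Pass} (hA : ∀ y ∈ A, eps i y = 0)
    (hB : ∀ y ∈ B, eps i y = 0) :
    sum₃ (fun a b c => eps i b * eps a c) (A ++ i' :: B) = eps i i' * cross A B := by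
  rw [sum₃_append, sum₃_eq_zero fun a _ b hb c _ => by rw [hA b hb, zero_mul],
    sum₂_eq_zero fun a _ b hb => by rw [sum₁_mul_left, hA b hb, zero_mul]]
  have h3 : sum₃ (fun a b c => eps i b * eps a c) (i' :: B) = 0 := by
    rw [sum₃, sum₂_eq_zero fun a ha b _ => by rw [hB a ha, zero_mul],
      sum₃_eq_zero fun a _ b hb c _ => by rw [hB b hb, zero_mul], add_zero]
  rw [h3, zero_add, zero_add, add_zero, cross, ← sum₁_mul_left]
  refine sum₁_congr fun a ha => ?_
  rw [sum₂, sum₁_mul_left, sum₂_eq_zero fun b hb c _ => by rw [hB b hb, zero_mul], add_zero]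

/-- The crossings interlaced with i are those joining its two loops, so i contributes its own sign
times the intersection number of the loops. -/
lemma Phi_cons_append_cons {A B : List Pass} {i i' : Pass} (hA : ∀ y ∈ A, y.label ≠ i.label)
    (hB : ∀ y ∈ B, y.label ≠ i.label) (hi : i'.label = i.label) :
    Phi (i :: (A ++ i' :: B)) = eps i i' * cross A B + Phi (A ++ B) := by
  have hA0 : ∀ y ∈ A, eps i y = 0 := fun y hy => eps_of_label_ne (hA y hy).symm
  have hB0 : ∀ y ∈ B, eps i y = 0 := fun y hy => eps_of_label_ne (hB y hy).symm
  have hA0' : ∀ y ∈ A, eps i' y = 0 := fun y hy => eps_of_label_ne (hi ▸ (hA y hy).symm)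
  have hB0' : ∀ y ∈ B, eps i' y = 0 := fun y hy => eps_of_label_ne (hi ▸ (hB y hy).symm)
  rw [← Phi_remove hA0' hB0', Phi, sum₄, ← Phi]
  congr 1
  exact sum₃_eps_append_cons hA0 hB0

/-- In first and in last position x contributes the same triple sum up to sign; the hypothesis makes
it zero. -/
lemma Phi_rotate_one {x : Pass} {l : List Pass}
    (h : sum₃ (fun a b c => eps x b * eps a c) l = 0) : Phi (l ++ [x]) = Phi (x :: l) := by
  have h1 : Phi (x :: l) = Phi l := by rw [Phi, sum₄, h, zero_add, Phi]
  rw [h1, Phi_append]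
  have h2 : sum₃ (fun a b c => eps a c * sum₁ (eps b) [x]) l = 0 := by
    rw [← neg_eq_zero, ← sum₃_neg, ← h]
    congr 1; ext a b c
    rw [sum₁, sum₁, eps_swap x b]; ring
  have h3 : PhiMix l [x] = 0 := sum₁_eq_zero fun y _ => rfl
  have h4 : sum₂ (fun a b => sum₂ (fun c d => eps a c * eps b d) [x]) l = 0 :=
    sum₂_eq_zero fun y _ z _ => by simp [sum₂, sum₁]
  rw [h2, h3, h4]
  simp [Phi, sum₄, sum₃]

/-- For fixed x in Y only the triples that meet both Z and W feel the exchange. Sorted by the arc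
containing b, each half is the count of x against that arc times `cross Z W`. The diagonal terms
vanish because one passage cannot meet both x and the other arc. -/
lemma PhiMix_sub {Y Z W : List Pass} (hYZ : BranchNodup (Y ++ Z ++ W)) :
    PhiMix Y (Z ++ W) - PhiMix Y (W ++ Z) = cross Y (Z ++ W) * cross Z W := by
  have hne : ∀ x ∈ Y, ∀ z ∈ Z, ∀ w ∈ W, x.branch ≠ w.branch ∧ x.branch ≠ z.branch := by
    intro x hx z hz w hw
    simp only [BranchNodup, List.map_append, List.nodup_append, List.mem_append, List.mem_map] at hYZ
    exact ⟨hYZ.2.2 _ (Or.inl ⟨x, hx, rfl⟩) _ ⟨w, hw, rfl⟩,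
      hYZ.1.2.2 _ ⟨x, hx, rfl⟩ _ ⟨z, hz, rfl⟩⟩
  rw [PhiMix, PhiMix, ← sum₁_sub, cross, ← sum₁_mul_right]
  refine sum₁_congr fun x hx => ?_
  rw [sum₃_append, sum₃_append, sum₁_append]
  have hA : sum₂ (fun a b => sum₁ (fun c => eps x b * eps a c) W) Z -
      sum₁ (fun a => sum₂ (fun b c => eps x b * eps a c) Z) W = sum₁ (eps x) Z * cross Z W := by
    have h1 : sum₁ (fun a => sum₂ (fun b c => eps x b * eps a c) Z) W =
        -sum₂ (fun b c => eps x b * sum₁ (eps c) W) Z := by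
      rw [← sum₂_sum₁_comm, ← sum₂_neg]
      refine sum₂_congr fun b _ c _ => ?_
      rw [sum₁_mul_left, neg_mul_eq_mul_neg, ← sum₁_neg]
      congr 1
      exact sum₁_congr fun a _ => eps_swap c a
    have h2 : sum₁ (fun y => eps x y * sum₁ (eps y) W) Z = 0 := by
      refine sum₁_eq_zero fun z hz => ?_
      rw [← sum₁_mul_left]
      refine sum₁_eq_zero fun w hw => ?_
      rw [eps_swap w z, mul_neg, eps_mul_eps_of_branch_ne (hne x hx z hz w hw).1, neg_zero]
    have h3 := sum₂_symm_mul (eps x) (fun z => sum₁ (eps z) W) Z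
    rw [h2, sub_zero, sum₂_add] at h3
    rw [h1, cross, ← h3, sub_neg_eq_add, add_comm]
    congr 1
    exact sum₂_congr fun a _ b _ => by rw [sum₁_mul_left]
  have hB : sum₁ (fun a => sum₂ (fun b c => eps x b * eps a c) W) Z -
      sum₂ (fun a b => sum₁ (fun c => eps x b * eps a c) Z) W = sum₁ (eps x) W * cross Z W := by
    have h1 : sum₂ (fun a b => sum₁ (fun c => eps x b * eps a c) Z) W =
        -sum₂ (fun a b => eps x b * sum₁ (fun c => eps c a) Z) W := by
      rw [← sum₂_neg]
      refine sum₂_congr fun a _ b _ => ?_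
      rw [sum₁_mul_left, neg_mul_eq_mul_neg, ← sum₁_neg]
      congr 1
      exact sum₁_congr fun c _ => eps_swap c a
    have h0 : sum₁ (fun a => sum₂ (fun b c => eps x b * eps a c) W) Z =
        sum₂ (fun b c => eps x b * sum₁ (fun a => eps a c) Z) W := by
      rw [← sum₂_sum₁_comm]
      exact sum₂_congr fun b _ c _ => by rw [sum₁_mul_left]
    have h2 : sum₁ (fun y => eps x y * sum₁ (fun a => eps a y) Z) W = 0 := by
      refine sum₁_eq_zero fun w hw => ?_
      rw [← sum₁_mul_left]
      exact sum₁_eq_zero fun z hz => eps_mul_eps_of_branch_ne (hne x hx z hz w hw).2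
    have h3 := sum₂_symm_mul (eps x) (fun w => sum₁ (fun a => eps a w) Z) W
    rw [h2, sub_zero, sum₂_add] at h3
    rw [h0, h1, sub_neg_eq_add, cross, sum₁_sum₁_comm, ← h3]
  linear_combination hA + hB

/-- The recursion for `Phi` under the smoothings of a crossing `i` and of a crossing `j` that is
passed right after `i`. -/
lemma Phi_recursion {i i' j j' : Pass} {Y Z W : List Pass} (hnd : BranchNodup (Y ++ Z ++ W))
    (hi : i'.label = i.label) (hj : j'.label = j.label) (hj' : j.isFst ≠ j'.isFst)
    (hij : j.label ≠ i.label) (hiY : ∀ y ∈ Y ++ Z ++ W, y.label ≠ i.label)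
    (hjY : ∀ y ∈ Y ++ Z ++ W, y.label ≠ j.label) (hrow : cross (j :: Y) (Z ++ j' :: W) = 0)
    (hrot : Phi (Z ++ W) = Phi (W ++ Z)) :
    Phi (i :: j :: (Y ++ i' :: (Z ++ j' :: W))) + Phi (j :: Y ++ revPath (Z ++ j' :: W)) -
      Phi (Y ++ (W ++ Z)) - Phi (Y ++ revPath (W ++ Z)) = -1 := by
  simp only [List.mem_append] at hiY hjY
  have hY : BranchNodup Y := by
    simp only [BranchNodup, List.map_append] at hnd ⊢
    exact hnd.of_append_left.of_append_left
  have hbr : j.branch ∉ Y.map Pass.branch := by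
    rw [List.mem_map]
    rintro ⟨y, hy, hb⟩
    exact hjY y (by tauto) (congrArg Prod.fst hb)
  have hjYnd : BranchNodup (j :: Y) := by
    rw [BranchNodup, List.map_cons, List.nodup_cons]
    exact ⟨hbr, hY⟩
  have h0 : ∀ y, (y ∈ Y ∨ y ∈ Z) ∨ y ∈ W → eps j y = 0 ∧ eps j' y = 0 ∧ eps y j' = 0 := by
    intro y hy
    exact ⟨eps_of_label_ne (hjY y hy).symm, eps_of_label_ne (hj ▸ (hjY y hy).symm),
      eps_of_label_ne (hj ▸ hjY y hy)⟩
  -- The loops at i have intersection number zero by `hrow`, so i can be dropped.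
  have e1 : Phi (i :: j :: (Y ++ i' :: (Z ++ j' :: W))) = Phi (j :: Y ++ (Z ++ j' :: W)) := by
    have := Phi_cons_append_cons (A := j :: Y) (B := Z ++ j' :: W) (i := i) (i' := i')
      (by simp only [List.mem_cons]; rintro y (rfl | hy); exacts [hij, hiY y (by tauto)])
      (by
        simp only [List.mem_append, List.mem_cons]
        rintro y (hy | rfl | hy)
        exacts [hiY y (by tauto), hj ▸ hij, hiY y (by tauto)]) hi
    rw [hrow, mul_zero, zero_add] at this
    exact this
  have e2 := Phi_append_add_revPath (B := Z ++ j' :: W) hjYnd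
  have e3 := Phi_append_add_revPath (B := W ++ Z) hY
  have e4 : Phi (j :: Y) = Phi Y :=
    Phi_remove (P := []) (by simp) fun y hy => (h0 y (by tauto)).1
  have e5 : Phi (Z ++ j' :: W) = Phi (Z ++ W) :=
    Phi_remove (fun y hy => (h0 y (by tauto)).2.1) fun y hy => (h0 y (by tauto)).2.1
  have hsum : ∀ y ∈ Y, sum₁ (eps y) (Z ++ j' :: W) = sum₁ (eps y) (Z ++ W) := by
    intro y hy
    simp only [sum₁_append, sum₁, (h0 y (by tauto)).2.2, zero_add]
  have hsumj : sum₁ (eps j) (Z ++ j' :: W) = eps j j' := by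
    rw [sum₁_append, sum₁, sum₁_eq_zero fun y hy => (h0 y (by tauto)).1,
      sum₁_eq_zero fun y hy => (h0 y (by tauto)).1]
    ring
  -- Without j the vanishing intersection number becomes ±1. Its square here and the additional
  -- crossing in `hN` each contribute -1 to twice the left side, which is where the constant -1
  -- comes from.
  have hc : cross Y (Z ++ W) = -eps j j' := by
    rw [cross_cons_left, hsumj] at hrow
    have : cross Y (Z ++ j' :: W) = cross Y (Z ++ W) := sum₁_congr hsum
    omega
  have hc' : cross Y (W ++ Z) = -eps j j' := by
    rw [cross_append_right, add_comm, ← cross_append_right, hc]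
  have hN : crossNum (j :: Y) (Z ++ j' :: W) = 1 + crossNum Y (W ++ Z) := by
    rw [crossNum, sum₁, hsumj, eps_mul_self_of_match hj.symm hj', crossNum]
    congr 1
    refine sum₁_congr fun y hy => ?_
    rw [hsum y hy, sum₁_append, sum₁_append]
    ring
  have hmixj : sum₃ (fun a b c => eps j b * eps a c) (Z ++ j' :: W) = eps j j' * cross Z W := by
    exact sum₃_eps_append_cons (fun y hy => (h0 y (by tauto)).1) fun y hy => (h0 y (by tauto)).1
  have hmixY : PhiMix Y (Z ++ j' :: W) = PhiMix Y (Z ++ W) := by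
    refine sum₁_congr fun y hy => ?_
    have hyj := (h0 y (by tauto)).2.2
    rw [sum₃_append, sum₃_append, sum₃]
    congr 1
    · congr 1
      · congr 1
        refine sum₂_congr fun a ha b _ => ?_
        rw [sum₁, (h0 a (by tauto)).2.2, mul_zero, zero_add]
      · refine sum₁_congr fun a _ => ?_
        rw [sum₂, sum₁_eq_zero fun b _ => by rw [hyj, zero_mul], zero_add]
    · rw [sum₂_eq_zero, zero_add]
      intro a _ b hb
      rw [(h0 b (by tauto)).2.1, mul_zero]
  have hmix : PhiMix (j :: Y) (Z ++ j' :: W) = eps j j' * cross Z W + PhiMix Y (Z ++ W) := by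
    rw [← hmixY, ← hmixj]; rfl
  -- The exchange of Z and W costs a multiple of `cross Z W`, which cancels the contribution of j in
  -- `hmix`.
  have hsub := PhiMix_sub hnd
  rw [hc] at hsub
  rw [hrow, e4, e5, hN, hmix] at e2
  rw [hc'] at e3
  have hsq := eps_mul_self_of_match hj.symm hj'
  rw [e1]
  linarith

end KnotTheory

namespace KnotTheory

/-! ### Colourings of the faces -/

/-- Numbers attached to the four corners at a crossing, where the first branch runs from west to
east and the second branch from south to north. -/
structure Corners where
  nw : ℚ
  ne : ℚ
  se : ℚ
  sw : ℚ

/-- The colours to the left and to the right before a passage. -/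
def inn (q : ℕ → Corners) (x : Pass) : ℚ × ℚ :=
  match x.isFst, x.fwd with
  | true, true => ((q x.label).nw, (q x.label).sw)
  | true, false => ((q x.label).se, (q x.label).ne)
  | false, true => ((q x.label).sw, (q x.label).se)
  | false, false => ((q x.label).ne, (q x.label).nw)

/-- The colours to the left and to the right after a passage. -/
def out (q : ℕ → Corners) (x : Pass) : ℚ × ℚ :=
  match x.isFst, x.fwd with
  | true, true => ((q x.label).ne, (q x.label).se)
  | true, false => ((q x.label).sw, (q x.label).nw)
  | false, true => ((q x.label).nw, (q x.label).ne)
  | false, false => ((q x.label).se, (q x.label).sw)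

/-- The colours fit along the curve `l`, which starts between the colours `s` and ends between the
colours `r`. -/
def Fits (q : ℕ → Corners) : ℚ × ℚ → List Pass → ℚ × ℚ → Prop
  | s, [], r => s = r
  | s, x :: l, r => s = inn q x ∧ Fits q (out q x) l r

/-- The jump of the weight of an edge at a crossing. -/
def Corners.jump (c : Corners) : ℚ := c.ne - c.se - c.nw + c.sw

/-- The weight of an edge. -/
def width (p : ℚ × ℚ) : ℚ := p.1 - p.2

/-- The sum of the jumps along a curve. -/
def total (x : ℕ → ℚ) (l : List Pass) : ℚ := sum₁ (fun y => (sg y.isFst : ℚ) * x y.label) l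

lemma fits_append {q : ℕ → Corners} {A B : List Pass} {s r : ℚ × ℚ} :
    Fits q s (A ++ B) r ↔ ∃ t, Fits q s A t ∧ Fits q t B r := by
  induction A generalizing s with
  | nil => simp [Fits]
  | cons x A ih => simp [Fits, ih, and_assoc]

lemma inn_rev (q : ℕ → Corners) (x : Pass) : inn q x.rev = (out q x).swap := by
  obtain ⟨u, b, d⟩ := x
  cases b <;> cases d <;> rfl

lemma out_rev (q : ℕ → Corners) (x : Pass) : out q x.rev = (inn q x).swap := by
  obtain ⟨u, b, d⟩ := x
  cases b <;> cases d <;> rfl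

lemma Fits.revPath {q : ℕ → Corners} {l : List Pass} {s r : ℚ × ℚ} (h : Fits q s l r) :
    Fits q r.swap (revPath l) s.swap := by
  induction l generalizing s with
  | nil => exact congrArg Prod.swap (Eq.symm h)
  | cons x l ih =>
    have : KnotTheory.revPath (x :: l) = KnotTheory.revPath l ++ [x.rev] := by
      simp [KnotTheory.revPath]
    rw [this, fits_append]
    refine ⟨_, ih h.2, ?_, ?_⟩
    · rw [inn_rev]
    · show _ = _
      rw [out_rev, h.1]

lemma width_out (q : ℕ → Corners) (x : Pass) :
    width (out q x) = width (inn q x) + sg x.isFst * (q x.label).jump := by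
  obtain ⟨u, b, d⟩ := x
  cases b <;> cases d <;> simp [width, inn, out, sg, Corners.jump] <;> ring

lemma Fits.width_eq {q : ℕ → Corners} {l : List Pass} {s r : ℚ × ℚ} (h : Fits q s l r) {x : ℕ → ℚ}
    (hx : ∀ y ∈ l, (q y.label).jump = x y.label) : width r = width s + total x l := by
  induction l generalizing s with
  | nil => rw [show s = r from h]; simp [total, sum₁]
  | cons y l ih =>
    rw [ih h.2 fun z hz => hx z (by simp [hz]), width_out, ← h.1, hx y (by simp), total, total, sum₁]
    ring

/-- The two passages of a crossing. -/
def Match (x y : Pass) : Prop := y.label = x.label ∧ y.isFst ≠ x.isFst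

lemma Match.symm {x y : Pass} (h : Match x y) : Match y x := ⟨h.1.symm, h.2.symm⟩

lemma Match.isFst {x y : Pass} (h : Match x y) : y.isFst = !x.isFst := by
  have := h.2
  revert this
  cases y.isFst <;> cases x.isFst <;> simp

lemma Match.sg {x y : Pass} (h : Match x y) : sg y.isFst = -sg x.isFst := by rw [h.isFst, sg_not]

/-- Opposite incoming widths mean that two opposite corners have the same colour. These are the
corners merged by the smoothing against the orientation, so the colouring survives it. -/
lemma Match.eq_swap {q : ℕ → Corners} {x y : Pass} (h : Match x y)
    (hw : width (inn q y) = -width (inn q x)) :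
    inn q y = (inn q x).swap ∧ out q y = (out q x).swap := by
  have h2 := h.isFst
  have h1 := h.1
  obtain ⟨u, b, d⟩ := x
  obtain ⟨v, b', d'⟩ := y
  simp only at h1 h2
  subst h1 h2
  cases b <;> cases d <;> cases d' <;> simp only [width, inn, out, Bool.not_true, Bool.not_false] at * <;>
    refine ⟨Prod.ext ?_ ?_, Prod.ext ?_ ?_⟩ <;> simp only [Prod.fst_swap, Prod.snd_swap] <;> linarith

/-- The analogue for the smoothing along the orientation, which merges the other two opposite
corners. -/
lemma Match.eq_out {q : ℕ → Corners} {x y : Pass} (h : Match x y)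
    (hw : width (inn q x) = width (out q y)) : inn q x = out q y ∧ inn q y = out q x := by
  have h2 := h.isFst
  have h1 := h.1
  obtain ⟨u, b, d⟩ := x
  obtain ⟨v, b', d'⟩ := y
  simp only at h1 h2
  subst h1 h2
  cases b <;> cases d <;> cases d' <;> simp only [width, inn, out, Bool.not_true, Bool.not_false] at * <;>
    refine ⟨Prod.ext ?_ ?_, Prod.ext ?_ ?_⟩ <;> linarith

/-- Every crossing of the curve is passed once on each branch. -/
structure IsCurve (l : List Pass) : Prop where
  nodup : BranchNodup l
  exists_match : ∀ x ∈ l, ∃ y ∈ l, Match x y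

/-- Every weight function on the edges of the curve that satisfies Kirchhoff's law is the difference
of the colours to the left and to the right for a colouring of the faces. -/
def IsColourable (l : List Pass) : Prop :=
  ∀ (x : ℕ → ℚ) (z : ℚ), ∃ (q : ℕ → Corners) (s : ℚ × ℚ), Fits q s l s ∧ width s = z ∧
    ∀ y ∈ l, (q y.label).jump = x y.label

lemma IsColourable.rotate {A B : List Pass} (h : IsColourable (A ++ B)) : IsColourable (B ++ A) := by
  intro x z
  obtain ⟨q, s, hs, hz, hx⟩ := h x (z - total x A)
  obtain ⟨t, h1, h2⟩ := fits_append.mp hs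
  refine ⟨q, t, fits_append.mpr ⟨s, h2, h1⟩, ?_, fun y hy => hx y (by simp_all [or_comm])⟩
  rw [h1.width_eq fun y hy => hx y (by simp [hy]), hz]
  ring

lemma sg_mul_self_rat (b : Bool) : (sg b : ℚ) * sg b = 1 := by exact_mod_cast sg_mul_self b

/-- Smoothing a crossing against the orientation. -/
lemma IsColourable.smooth {i i' : Pass} {A B : List Pass} (h : IsColourable (i :: (A ++ i' :: B)))
    (hm : Match i i') (hi : ∀ y ∈ A ++ B, y.label ≠ i.label) : IsColourable (A ++ revPath B) := by
  simp only [List.mem_append] at hi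
  intro x z
  -- The starting width and the jump at i are chosen so that the width is z right after i, and the
  -- width on arrival at i' is the negative of the starting one.
  obtain ⟨q, s, hs, hz, hx⟩ := h (Function.update x i.label (sg i.isFst * (2 * z + total x A)))
    (-z - total x A)
  have hxi := hx i (by simp)
  rw [Function.update_self] at hxi
  have hxy : ∀ y, y ∈ A ∨ y ∈ B → (q y.label).jump = x y.label := by
    intro y hy
    rw [hx y (by simp; tauto), Function.update_of_ne (hi y hy)]
  obtain ⟨h1, h2⟩ := hs
  obtain ⟨t, h3, h4, h5⟩ := fits_append.mp h2
  have hw1 : width (out q i) = z := by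
    rw [width_out, ← h1, hz, hxi]
    linear_combination (2 * z + total x A) * sg_mul_self_rat i.isFst
  have hw2 : width t = z + total x A := by
    rw [h3.width_eq fun y hy => hxy y (Or.inl hy), hw1]
  obtain ⟨h6, h7⟩ := hm.eq_swap (q := q) (by rw [← h1, ← h4, hw2, hz]; ring)
  refine ⟨q, out q i, fits_append.mpr ⟨t, h3, ?_⟩, hw1, fun y hy => ?_⟩
  · have := h5.revPath
    rwa [h7, h1, ← h6, ← h4, Prod.swap_swap] at this
  · rw [List.mem_append, KnotTheory.revPath, List.mem_reverse, List.mem_map] at hy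
    rcases hy with hy | ⟨y, hy, rfl⟩
    exacts [hxy y (Or.inl hy), hxy y (Or.inr hy)]

/-- Smoothing two crossings along the orientation. -/
lemma IsColourable.smooth_pair (h : IsColourable (i :: j :: (Y ++ i' :: (Z ++ j' :: W))))
    (hmi : Match i i') (hmj : Match j j') (hij : j.label ≠ i.label)
    (hi : ∀ y ∈ Y ++ Z ++ W, y.label ≠ i.label) (hj : ∀ y ∈ Y ++ Z ++ W, y.label ≠ j.label) :
    IsColourable (Y ++ (W ++ Z)) := by
  simp only [List.mem_append] at hi hj
  intro x z
  -- The jumps at i and j are solved from the requirement that the widths along Y, W, Z continue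
  -- each other: at each of the two crossings the width coming in on one passage equals the width
  -- going out on the other.
  obtain ⟨q, s, hs, hz, hx⟩ := h (Function.update (Function.update x i.label
    (sg i.isFst * (total x Y + total x Z))) j.label (sg j.isFst * (-total x Y))) (z - total x Z)
  have hxi := hx i (by simp)
  have hxj := hx j (by simp)
  rw [Function.update_of_ne hij.symm, Function.update_self] at hxi
  rw [Function.update_self] at hxj
  have hxy : ∀ y, (y ∈ Y ∨ y ∈ Z) ∨ y ∈ W → (q y.label).jump = x y.label := by
    intro y hy
    rw [hx y (by simp; tauto), Function.update_of_ne (hj y hy), Function.update_of_ne (hi y hy)]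
  obtain ⟨h1, h2, h3⟩ := hs
  obtain ⟨t, h4, h5, h6⟩ := fits_append.mp h3
  obtain ⟨t', h7, h8, h9⟩ := fits_append.mp h6
  have hwi : width (out q i) = z + total x Y := by
    rw [width_out, ← h1, hz, hxi]
    linear_combination (total x Y + total x Z) * sg_mul_self_rat i.isFst
  have hwj : width (out q j) = z := by
    rw [width_out, ← h2, hwi, hxj]
    linear_combination (-total x Y) * sg_mul_self_rat j.isFst
  have hwt : width t = z + total x Y := by
    rw [h4.width_eq fun y hy => hxy y (by tauto), hwj]
  have hwi' : width (out q i') = z - total x Z := by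
    rw [width_out, ← h5, hwt, hmi.1, hmi.sg, hxi]
    push_cast
    linear_combination (-(total x Y + total x Z)) * sg_mul_self_rat i.isFst
  have hwt' : width t' = z := by
    rw [h7.width_eq fun y hy => hxy y (by tauto), hwi']
    ring
  obtain ⟨h10, h11⟩ := hmi.eq_out (q := q) (by rw [← h1, hz, hwi'])
  obtain ⟨h12, h13⟩ := hmj.symm.eq_out (q := q) (by rw [← h8, hwt', hwj])
  refine ⟨q, out q j, ?_, hwj, fun y hy => hxy y (by simp at hy; tauto)⟩
  refine fits_append.mpr ⟨t, h4, fits_append.mpr ⟨s, ?_, ?_⟩⟩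
  · rwa [h5, h11, h2, h13]
  · rwa [h1, h10, ← h12, ← h8]

/-- Smoothing two crossings, the first one along the orientation and the second one against it. -/
lemma IsColourable.smooth_pair' (h : IsColourable (i :: j :: (Y ++ i' :: (Z ++ j' :: W))))
    (hmi : Match i i') (hmj : Match j j') (hij : j.label ≠ i.label)
    (hi : ∀ y ∈ Y ++ Z ++ W, y.label ≠ i.label) (hj : ∀ y ∈ Y ++ Z ++ W, y.label ≠ j.label) :
    IsColourable (Y ++ revPath (W ++ Z)) := by
  simp only [List.mem_append] at hi hj
  intro x z
  -- The jumps now make the widths at i agree along the orientation and those at j opposite, since W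
  -- and Z are run backwards after the smoothing.
  obtain ⟨q, s, hs, hz, hx⟩ := h (Function.update (Function.update x i.label
    (sg i.isFst * (2 * z + 2 * total x Y + total x Z))) j.label (sg j.isFst * (-total x Y)))
    (-z - total x Y - total x Z)
  have hxi := hx i (by simp)
  have hxj := hx j (by simp)
  rw [Function.update_of_ne hij.symm, Function.update_self] at hxi
  rw [Function.update_self] at hxj
  have hxy : ∀ y, (y ∈ Y ∨ y ∈ Z) ∨ y ∈ W → (q y.label).jump = x y.label := by
    intro y hy
    rw [hx y (by simp; tauto), Function.update_of_ne (hj y hy), Function.update_of_ne (hi y hy)]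
  obtain ⟨h1, h2, h3⟩ := hs
  obtain ⟨t, h4, h5, h6⟩ := fits_append.mp h3
  obtain ⟨t', h7, h8, h9⟩ := fits_append.mp h6
  have hwi : width (out q i) = z + total x Y := by
    rw [width_out, ← h1, hz, hxi]
    linear_combination (2 * z + 2 * total x Y + total x Z) * sg_mul_self_rat i.isFst
  have hwj : width (out q j) = z := by
    rw [width_out, ← h2, hwi, hxj]
    linear_combination (-total x Y) * sg_mul_self_rat j.isFst
  have hwt : width t = z + total x Y := by
    rw [h4.width_eq fun y hy => hxy y (by tauto), hwj]
  have hwi' : width (out q i') = -z - total x Y - total x Z := by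
    rw [width_out, ← h5, hwt, hmi.1, hmi.sg, hxi]
    push_cast
    linear_combination (-(2 * z + 2 * total x Y + total x Z)) * sg_mul_self_rat i.isFst
  have hwt' : width t' = -z - total x Y := by
    rw [h7.width_eq fun y hy => hxy y (by tauto), hwi']
    ring
  obtain ⟨h10, h11⟩ := hmi.eq_out (q := q) (by rw [← h1, hz, hwi'])
  obtain ⟨h12, h13⟩ := hmj.eq_swap (q := q) (by rw [← h8, hwt', ← h2, hwi]; ring)
  refine ⟨q, out q j, ?_, hwj, fun y hy => ?_⟩
  · rw [revPath_append]
    refine fits_append.mpr ⟨t, h4, fits_append.mpr ⟨s.swap, ?_, ?_⟩⟩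
    · have := h7.revPath
      rwa [← h10, ← h1, h8, h12, Prod.swap_swap, ← h2, ← h11, ← h5] at this
    · have := h9.revPath
      rwa [h13, Prod.swap_swap] at this
  · rw [List.mem_append, KnotTheory.revPath, List.mem_reverse, List.mem_map] at hy
    rcases hy with hy | ⟨y, hy, rfl⟩
    · exact hxy y (by tauto)
    · exact hxy y (by rw [List.mem_append] at hy; tauto)

/-! ### Intersection numbers read off from the change of a colour along an arc. -/

/-- The weight of a branch at a crossing where the weights do not jump. -/
def strandWidth (q : ℕ → Corners) (u : ℕ) (b : Bool) : ℚ :=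
  if b then (q u).nw - (q u).sw else (q u).sw - (q u).se

lemma strandWidth_eq (q : ℕ → Corners) (x : Pass) (h : (q x.label).jump = 0) :
    strandWidth q x.label x.isFst = sg x.fwd * width (inn q x) := by
  obtain ⟨u, b, d⟩ := x
  cases b <;> cases d <;> simp [width, inn, sg, Corners.jump, strandWidth] at * <;> linarith

lemma Fits.width_const {q : ℕ → Corners} {l : List Pass} {s r : ℚ × ℚ} (h : Fits q s l r)
    (hx : ∀ y ∈ l, (q y.label).jump = 0) :
    width r = width s ∧ ∀ y ∈ l, strandWidth q y.label y.isFst = sg y.fwd * width s := by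
  induction l generalizing s with
  | nil => exact ⟨by rw [show s = r from h], by simp⟩
  | cons x l ih =>
    obtain ⟨h1, h2⟩ := ih h.2 fun y hy => hx y (by simp [hy])
    have h3 := hx x (by simp)
    rw [width_out, h3, mul_zero, add_zero, ← h.1] at h1 h2
    refine ⟨h1, ?_⟩
    intro y hy
    rcases List.mem_cons.mp hy with rfl | hy
    · rw [strandWidth_eq q y h3, h.1]
    · exact h2 y hy

lemma out_fst_sub (q : ℕ → Corners) (x : Pass) (h : (q x.label).jump = 0) :
    (out q x).1 = (inn q x).1 - sg x.isFst * sg x.fwd * strandWidth q x.label (!x.isFst) := by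
  obtain ⟨u, b, d⟩ := x
  cases b <;> cases d <;> simp [inn, out, sg, Corners.jump, strandWidth] at * <;> linarith

/-- The colour to the left changes along a curve by its intersection number with the cycle formed by
the weights. -/
lemma Fits.fst_eq {q : ℕ → Corners} {Q Γ : List Pass} {s r : ℚ × ℚ} (h : Fits q s Q r)
    (hx : ∀ y ∈ Q, (q y.label).jump = 0)
    (hΓ : ∀ x ∈ Q, ((sum₁ (eps x) Γ : ℤ) : ℚ) =
      sg x.isFst * sg x.fwd * strandWidth q x.label (!x.isFst)) :
    r.1 = s.1 - (cross Q Γ : ℤ) := by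
  induction Q generalizing s with
  | nil => rw [show s = r from h]; simp [cross, sum₁]
  | cons x Q ih =>
    rw [ih h.2 (fun y hy => hx y (by simp [hy])) fun y hy => hΓ y (by simp [hy]),
      out_fst_sub q x (hx x (by simp)), ← hΓ x (by simp), h.1, cross_cons_left]
    push_cast; ring

lemma sum₁_eps_of_match {l : List Pass} (hl : BranchNodup l) {x y : Pass} (hy : y ∈ l)
    (h : Match x y) : sum₁ (eps x) l = eps x y := by
  induction l with
  | nil => simp at hy
  | cons z l ih =>
    simp only [BranchNodup, List.map_cons, List.nodup_cons] at hl
    rw [sum₁]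
    have hz : ∀ z', z'.branch ≠ y.branch → eps x z' = 0 := by
      intro z' hne
      refine if_neg fun h' => hne (Prod.ext (h'.1.symm.trans h.1.symm) ?_)
      show z'.isFst = y.isFst
      rw [h.isFst]
      have := h'.2
      revert this
      cases z'.isFst <;> cases x.isFst <;> simp
    rcases List.mem_cons.mp hy with rfl | hy
    · rw [sum₁_eq_zero fun z' hz' => hz z' fun hb => hl.1 (hb ▸ List.mem_map_of_mem hz'), add_zero]
    · rw [hz z fun hb => hl.1 (hb ▸ List.mem_map_of_mem hy), zero_add]
      exact ih hl.2 hy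

lemma sum₁_eps_of_not_match {l : List Pass} {x : Pass} (h : ∀ y ∈ l, ¬ Match x y) :
    sum₁ (eps x) l = 0 :=
  sum₁_eq_zero fun y hy => if_neg fun h' => h y hy ⟨h'.1.symm, h'.2.symm⟩

lemma Match.eps_eq {x y : Pass} (h : Match x y) : eps x y = KnotTheory.sg x.isFst * KnotTheory.sg x.fwd * KnotTheory.sg y.fwd :=
  if_pos ⟨h.1.symm, h.2.symm⟩

/-- The closed curve `l`, run through with weight one, bounds a colouring of the faces.  The list
may contain passages through crossings with other curves, which have weight zero. -/
def IsBounding (l : List Pass) : Prop :=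
  ∃ (q : ℕ → Corners) (s : ℚ × ℚ), Fits q s l s ∧ width s = 1 ∧ (∀ y ∈ l, (q y.label).jump = 0) ∧
    ∀ x ∈ l, (∀ y ∈ l, ¬ Match x y) → strandWidth q x.label (!x.isFst) = 0

lemma IsBounding.rotate {A B : List Pass} (h : IsBounding (A ++ B)) : IsBounding (B ++ A) := by
  obtain ⟨q, s, hs, hz, hx, hu⟩ := h
  obtain ⟨t, h1, h2⟩ := fits_append.mp hs
  refine ⟨q, t, fits_append.mpr ⟨s, h2, h1⟩, ?_, fun y hy => hx y (by simp_all [or_comm]),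
    fun x hx' hy => hu x (by simp_all [or_comm]) fun y hy' => hy y (by simp_all [or_comm])⟩
  rw [(h1.width_const fun y hy => hx y (by simp [hy])).1, hz]

/-- With equal widths on both branches and no jump, the corner to the left after x and the corner to
the left before y have the same colour. A loop based at the crossing thus returns to the colour with
which it started. -/
lemma Match.fst_eq {q : ℕ → Corners} {x y : Pass} (h : Match x y) (hx : (q x.label).jump = 0) {z : ℚ}
    (h1 : width (inn q x) = z) (h2 : width (inn q y) = z) : (inn q y).1 = (out q x).1 := by
  have h3 := h.isFst
  have h4 := h.1
  obtain ⟨u, b, d⟩ := x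
  obtain ⟨v, b', d'⟩ := y
  simp only at h3 h4
  subst h3 h4
  cases b <;> cases d <;> cases d' <;>
    simp only [width, inn, out, Bool.not_true, Bool.not_false, Corners.jump] at * <;> linarith

/-- The index of a crossing of a bounding curve vanishes. -/
lemma IsBounding.cross_eq_zero {x x' : Pass} {Q S : List Pass}
    (h : IsBounding (x :: (Q ++ x' :: S))) (hnd : BranchNodup (x :: (Q ++ x' :: S)))
    (hm : Match x x') : cross Q S = 0 := by
  obtain ⟨q, s, hs, hz, hx, hu⟩ := h
  have hw := hs.width_const hx
  obtain ⟨h1, h2⟩ := hs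
  obtain ⟨t, h3, h4, h5⟩ := fits_append.mp h2
  have hwx : width (out q x) = 1 := by
    rw [width_out, hx x (by simp), ← h1, hz]; ring
  have hwt : width t = 1 := by
    rw [(h3.width_const fun y hy => hx y (by simp [hy])).1, hwx]
  -- Along the loop Q the left colour drops by the intersection number of Q with the whole curve,
  -- and it returns to its initial value. Neither Q itself nor the two passages x, x' contribute, so
  -- only S is left.
  have key := h3.fst_eq (Γ := x :: (Q ++ x' :: S)) (fun y hy => hx y (by simp [hy])) ?_
  · rw [h4, hm.fst_eq (hx x (by simp)) (by rw [← h1, hz]) (by rw [← h4, hwt])] at key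
    have hc : cross Q (x :: (Q ++ x' :: S)) = 0 := by
      have : ((cross Q (x :: (Q ++ x' :: S)) : ℤ) : ℚ) = 0 := by linarith
      exact_mod_cast this
    have hQ : ∀ y ∈ Q, y.label ≠ x.label := by
      intro y hy hl
      simp only [BranchNodup, List.map_cons, List.map_append, List.nodup_cons, List.nodup_append,
        List.mem_append, List.mem_cons, List.mem_map] at hnd
      by_cases hb : y.isFst = x.isFst
      · exact hnd.1 (Or.inl ⟨y, hy, Prod.ext hl hb⟩)
      · refine hnd.2.2.2 _ ⟨y, hy, rfl⟩ _ (Or.inl rfl) (Prod.ext (hl.trans hm.1.symm) ?_)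
        show y.isFst = x'.isFst
        rw [hm.isFst]
        revert hb
        cases y.isFst <;> cases x.isFst <;> simp
    rw [show x :: (Q ++ x' :: S) = [x] ++ (Q ++ ([x'] ++ S)) from rfl, cross_append_right,
      cross_append_right, cross_append_right, cross_self] at hc
    have e1 : cross Q [x] = 0 := sum₁_eq_zero fun y hy => by
      rw [sum₁, eps_of_label_ne (hQ y hy)]; rfl
    have e2 : cross Q [x'] = 0 := sum₁_eq_zero fun y hy => by
      rw [sum₁, eps_of_label_ne (hm.1 ▸ hQ y hy)]; rfl
    omega
  · intro y hy
    by_cases hmy : ∃ y' ∈ x :: (Q ++ x' :: S), Match y y'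
    · obtain ⟨y', hy', hm'⟩ := hmy
      rw [sum₁_eps_of_match hnd hy' hm', hm'.eps_eq, ← hm'.isFst, ← hm'.1, hw.2 y' hy', hz]
      push_cast; ring
    · push Not at hmy
      rw [sum₁_eps_of_not_match hmy, hu y (by simp [hy]) hmy]
      simp

/-- Passages go from the front to the back one at a time. If the partner of a passage is in the
list, the obstruction is the intersection number of its two loops, which vanishes; otherwise the
passage meets nothing. -/
lemma Phi_rotate {A B : List Pass} (h : IsBounding (A ++ B)) (hnd : BranchNodup (A ++ B)) :
    Phi (A ++ B) = Phi (B ++ A) := by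
  induction A generalizing B with
  | nil => simp
  | cons x A ih =>
    have h1 : Phi (A ++ B ++ [x]) = Phi (x :: (A ++ B)) := by
      refine Phi_rotate_one ?_
      by_cases hm : ∃ x' ∈ A ++ B, Match x x'
      · obtain ⟨x', hx', hm⟩ := hm
        obtain ⟨Q, S, hQS⟩ := List.append_of_mem hx'
        rw [List.cons_append, hQS] at h hnd
        rw [hQS, sum₃_eps_append_cons, h.cross_eq_zero hnd hm, mul_zero]
        all_goals
          intro y hy
          refine if_neg fun h' => ?_
          have hb : y.branch = x'.branch := by
            refine Prod.ext (h'.1.symm.trans hm.1.symm) ?_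
            show y.isFst = x'.isFst
            rw [hm.isFst]
            have := h'.2
            revert this
            cases y.isFst <;> cases x.isFst <;> simp
          simp only [BranchNodup, List.map_cons, List.map_append, List.nodup_cons,
            List.nodup_append, List.mem_append, List.mem_cons, List.mem_map] at hnd
        · exact hnd.2.2.2 _ ⟨y, hy, rfl⟩ _ (Or.inl rfl) hb
        · exact hnd.2.2.1.1 ⟨y, hy, hb⟩
      · push Not at hm
        exact sum₃_eq_zero fun a _ b hb c _ => by
          rw [show eps x b = 0 from if_neg fun h' => hm b hb ⟨h'.1.symm, h'.2.symm⟩, zero_mul]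
    have h2 : IsBounding (A ++ (B ++ [x])) := by
      have := IsBounding.rotate (A := [x]) (B := A ++ B) h
      rwa [List.append_assoc] at this
    have h3 : BranchNodup (A ++ (B ++ [x])) := by
      have hp : (A ++ (B ++ [x])).Perm (x :: A ++ B) := by
        rw [← List.append_assoc]
        exact List.perm_append_comm.trans (by simp)
      exact (hp.map _).nodup_iff.mpr hnd
    have h4 := ih h2 h3
    rw [List.cons_append, ← h1, List.append_assoc, h4]
    simp

lemma IsColourable.isBounding {l : List Pass} (h : IsColourable l) (hl : IsCurve l) :
    IsBounding l := by
  obtain ⟨q, s, hs, hz, hx⟩ := h 0 1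
  refine ⟨q, s, hs, hz, hx, fun x hx' hu => ?_⟩
  obtain ⟨y, hy, hm⟩ := hl.exists_match x hx'
  exact absurd hm (hu y hy)

lemma IsCurve.label_ne {i i' : Pass} {A B : List Pass} (h : IsCurve (i :: (A ++ i' :: B)))
    (hm : Match i i') : ∀ y ∈ A ++ B, y.label ≠ i.label := by
  intro y hy hl
  have hp : (i :: (A ++ i' :: B)).Perm (i :: i' :: (A ++ B)) := List.perm_middle.cons i
  have hnd := (hp.map Pass.branch).nodup_iff.mp h.nodup
  simp only [List.map_cons, List.nodup_cons, List.mem_cons, not_or, List.mem_map] at hnd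
  by_cases hb : y.isFst = i.isFst
  · exact hnd.1.2 ⟨y, hy, Prod.ext hl hb⟩
  · refine hnd.2.1 ⟨y, hy, Prod.ext (hl.trans hm.1.symm) ?_⟩
    show y.isFst = i'.isFst
    rw [hm.isFst]
    revert hb
    cases y.isFst <;> cases i.isFst <;> simp

/-- Weight one on the loop B and zero on the loop A satisfies Kirchhoff's law, so B bounds. Its
crossings with A are the reason for the last clause of `IsBounding`: there the other branch has
weight zero. -/
lemma IsColourable.isBounding_right {i i' : Pass} {A B : List Pass}
    (h : IsColourable (i :: (A ++ i' :: B))) (hl : IsCurve (i :: (A ++ i' :: B)))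
    (hm : Match i i') : IsBounding B := by
  have hne := hl.label_ne hm
  simp only [List.mem_append] at hne
  obtain ⟨q, s, hs, hz, hx⟩ := h (Function.update 0 i.label (-sg i.isFst)) 1
  have hxi := hx i (by simp)
  rw [Function.update_self] at hxi
  have hxy : ∀ y, y ∈ A ∨ y ∈ B → (q y.label).jump = 0 := by
    intro y hy
    rw [hx y (by simp; tauto), Function.update_of_ne (hne y hy)]
    rfl
  obtain ⟨h1, h2⟩ := hs
  obtain ⟨t, h3, h4, h5⟩ := fits_append.mp h2
  have hsq := sg_mul_self_rat i.isFst
  have hwi : width (out q i) = 0 := by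
    rw [width_out, ← h1, hz, hxi]
    linear_combination -hsq
  have hA := h3.width_const fun y hy => hxy y (Or.inl hy)
  have hwi' : width (out q i') = 1 := by
    rw [width_out, ← h4, hA.1, hwi, hm.1, hm.sg, hxi]
    push_cast
    linear_combination hsq
  have hB := h5.width_const fun y hy => hxy y (Or.inr hy)
  have hso : s = out q i' := by
    have h6 : width s = width (out q i') := by rw [hz, hwi']
    rw [h1] at h6 ⊢
    exact (hm.eq_out h6).1
  refine ⟨q, s, ?_, hz, fun y hy => hxy y (Or.inr hy), fun x hxB hu => ?_⟩
  · rw [← hso] at h5; exact h5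
  · obtain ⟨y, hy, hmy⟩ := hl.exists_match x (by simp [hxB])
    have hyA : y ∈ A := by
      simp only [List.mem_cons, List.mem_append] at hy
      rcases hy with rfl | hy | rfl | hy
      · exact absurd hmy.1.symm (hne x (Or.inr hxB))
      · exact hy
      · exact absurd (hmy.1.symm.trans hm.1) (hne x (Or.inr hxB))
      · exact absurd hmy (hu y hy)
    rw [← hmy.isFst, ← hmy.1, hA.2 y hyA, hwi, mul_zero]

/-- The loops at two disjoint crossings of a closed plane curve have intersection number zero. -/
lemma IsColourable.cross_eq_zero_of_disjoint {a a' c c' : Pass} {P Q R S T : List Pass}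
    (h : IsColourable (P ++ a :: (Q ++ a' :: (R ++ c :: (S ++ c' :: T)))))
    (hl : IsCurve (P ++ a :: (Q ++ a' :: (R ++ c :: (S ++ c' :: T)))))
    (hma : Match a a') (hmc : Match c c') : cross Q S = 0 := by
  have hpa : (P ++ a :: (Q ++ a' :: (R ++ c :: (S ++ c' :: T)))).Perm
      (a :: (Q ++ a' :: (R ++ c :: (S ++ c' :: T) ++ P))) := by
    refine List.perm_append_comm.trans ?_
    simp
  have hpc : (P ++ a :: (Q ++ a' :: (R ++ c :: (S ++ c' :: T)))).Perm
      (c :: (S ++ c' :: (T ++ (P ++ a :: (Q ++ a' :: R))))) := by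
    have : P ++ a :: (Q ++ a' :: (R ++ c :: (S ++ c' :: T))) =
      (P ++ a :: (Q ++ a' :: R)) ++ (c :: (S ++ c' :: T)) := by simp
    rw [this]
    refine List.perm_append_comm.trans ?_
    simp
  have hcurve : ∀ l l' : List Pass, l.Perm l' → IsCurve l → IsCurve l' := fun l l' hp h =>
    ⟨(hp.map _).nodup_iff.mp h.nodup, fun x hx => by
      obtain ⟨y, hy, hm⟩ := h.exists_match x (hp.mem_iff.mpr hx)
      exact ⟨y, hp.mem_iff.mp hy, hm⟩⟩
  have hnea := (hcurve _ _ hpa hl).label_ne hma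
  have hnec := (hcurve _ _ hpc hl).label_ne hmc
  simp only [List.mem_append, List.mem_cons] at hnea hnec
  -- The weights are one on the loop S at c and zero elsewhere. Along Q the left colour therefore
  -- changes by `cross Q S`, and at a' it is back at its value.
  obtain ⟨q, s, hs, hz, hx⟩ := h (Function.update 0 c.label (sg c.isFst)) 0
  have hxc := hx c (by simp)
  rw [Function.update_self] at hxc
  have hxy : ∀ y, y ∈ P ∨ y = a ∨ y ∈ Q ∨ y = a' ∨ y ∈ R ∨ y ∈ S ∨ y ∈ T →
      (q y.label).jump = 0 := by
    intro y hy
    rw [hx y (by simp; tauto), Function.update_of_ne (hnec y (by tauto))]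
    rfl
  obtain ⟨t₁, h1, h2, h3⟩ := fits_append.mp hs
  obtain ⟨t₂, h4, h5, h6⟩ := fits_append.mp h3
  obtain ⟨t₃, h7, h8, h9⟩ := fits_append.mp h6
  obtain ⟨t₄, h10, h11, h12⟩ := fits_append.mp h9
  have hsq := sg_mul_self_rat c.isFst
  have hP := h1.width_const fun y hy => hxy y (by tauto)
  have hwa : width (out q a) = 0 := by
    rw [width_out, hxy a (by tauto), ← h2, hP.1, hz]; ring
  have hQ := h4.width_const fun y hy => hxy y (by tauto)
  have hwa' : width (out q a') = 0 := by
    rw [width_out, hxy a' (by tauto), ← h5, hQ.1, hwa]; ring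
  have hR := h7.width_const fun y hy => hxy y (by tauto)
  have hwc : width (out q c) = 1 := by
    rw [width_out, hxc, ← h8, hR.1, hwa', hsq]; ring
  have hS := h10.width_const fun y hy => hxy y (by tauto)
  have hwc' : width (out q c') = 0 := by
    rw [width_out, ← h11, hS.1, hwc, hmc.1, hmc.sg, hxc]
    push_cast
    linear_combination -hsq
  have hT := h12.width_const fun y hy => hxy y (by tauto)
  have hSnd : BranchNodup S := by
    have := hl.nodup
    simp only [BranchNodup, List.map_append, List.map_cons, List.nodup_append, List.nodup_cons]
      at this ⊢
    tauto
  have key := h4.fst_eq (Γ := S) (fun y hy => hxy y (by tauto)) ?_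
  · rw [h5, hma.fst_eq (hxy a (by tauto)) (by rw [← h2, hP.1, hz]) (by rw [← h5, hQ.1, hwa])] at key
    have : ((cross Q S : ℤ) : ℚ) = 0 := by linarith
    exact_mod_cast this
  · intro x hxQ
    obtain ⟨y, hy, hmy⟩ := hl.exists_match x (by simp [hxQ])
    by_cases hyS : y ∈ S
    · rw [sum₁_eps_of_match hSnd hyS hmy, hmy.eps_eq, ← hmy.isFst, ← hmy.1, hS.2 y hyS, hwc]
      push_cast; ring
    · have h0 : strandWidth q y.label y.isFst = 0 := by
        simp only [List.mem_append, List.mem_cons] at hy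
        rcases hy with hy | rfl | hy | rfl | hy | rfl | hy | rfl | hy
        · rw [hP.2 y hy, hz, mul_zero]
        · exact absurd hmy.1.symm (hnea x (by tauto))
        · rw [hQ.2 y hy, hwa, mul_zero]
        · exact absurd (hmy.1.symm.trans hma.1) (hnea x (by tauto))
        · rw [hR.2 y hy, hwa', mul_zero]
        · exact absurd hmy.1.symm (hnec x (by tauto))
        · exact absurd hy hyS
        · exact absurd (hmy.1.symm.trans hmc.1) (hnec x (by tauto))
        · rw [hT.2 y hy, hwc', mul_zero]
      rw [← hmy.isFst, ← hmy.1, h0, sum₁_eps_of_not_match, mul_zero, Int.cast_zero]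
      intro y' hy' hmy'
      have hb : y'.branch = y.branch :=
        Prod.ext (hmy'.1.trans hmy.1.symm) (hmy'.isFst.trans hmy.isFst.symm)
      have hnd := hl.nodup
      have hinj := List.inj_on_of_nodup_map hnd
      exact hyS (hinj (by simp [hy']) hy hb ▸ hy')

end KnotTheory

namespace KnotTheory

/-! ### The interlacement graph of a curve -/

/-- The number of passages through the crossing `u`, modulo two. -/
def parity (u : ℕ) (l : List Pass) : ZMod 2 := sum₁ (fun x => if x.label = u then 1 else 0) l

/-- The number of pairs of passages through `u` and `v`, in this order, modulo two. -/
def pairParity (u v : ℕ) (l : List Pass) : ZMod 2 :=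
  sum₂ (fun x y => (if x.label = u then 1 else 0) * if y.label = v then 1 else 0) l

/-- The adjacency matrix of the interlacement graph of the crossings. -/
def interlacement (l : List Pass) (u v : ℕ) : ZMod 2 := if u = v then 0 else pairParity u v l

/-- The crossings of a curve. -/
def labels (l : List Pass) : Finset ℕ := (l.map Pass.label).toFinset

lemma mem_labels {l : List Pass} {u : ℕ} : u ∈ labels l ↔ ∃ x ∈ l, x.label = u := by
  simp [labels]

lemma parity_append (u : ℕ) (A B : List Pass) : parity u (A ++ B) = parity u A + parity u B :=
  sum₁_append _ _ _

lemma parity_cons (u : ℕ) (x : Pass) (A : List Pass) :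
    parity u (x :: A) = (if x.label = u then 1 else 0) + parity u A := rfl

lemma parity_cons_of_ne {u : ℕ} {x : Pass} (h : x.label ≠ u) (A : List Pass) :
    parity u (x :: A) = parity u A := by rw [parity_cons, if_neg h, zero_add]

lemma parity_eq_zero {u : ℕ} {l : List Pass} (h : ∀ x ∈ l, x.label ≠ u) : parity u l = 0 :=
  sum₁_eq_zero fun x hx => if_neg (h x hx)

lemma parity_revPath (u : ℕ) (l : List Pass) : parity u (revPath l) = parity u l := by
  rw [parity, revPath, sum₁_reverse, sum₁_map]; rfl

lemma pairParity_append (u v : ℕ) (A B : List Pass) : pairParity u v (A ++ B) =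
    pairParity u v A + parity u A * parity v B + pairParity u v B := by
  rw [pairParity, sum₂_append]
  simp only [sum₁_mul_left, sum₁_mul_right]
  rfl

lemma pairParity_revPath (u v : ℕ) (l : List Pass) :
    pairParity u v (revPath l) = pairParity v u l := by
  rw [pairParity, revPath, sum₂_reverse, sum₂_map]
  simp only [mul_comm]
  rfl

lemma pairParity_add_swap {u v : ℕ} (h : u ≠ v) (l : List Pass) :
    pairParity u v l + pairParity v u l = parity u l * parity v l := by
  have := sum₂_symm_mul (R := ZMod 2) (fun x : Pass => if x.label = u then 1 else 0)
    (fun x => if x.label = v then 1 else 0) l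
  rw [sum₂_add, sum₁_eq_zero (f := fun x : Pass => (if x.label = u then (1 : ZMod 2) else 0) *
    (if x.label = v then 1 else 0)), sub_zero] at this
  · have e : pairParity v u l = sum₂ (R := ZMod 2) (fun x y : Pass =>
        (if y.label = u then 1 else 0) * (if x.label = v then 1 else 0)) l :=
      sum₂_congr fun x _ y _ => mul_comm _ _
    rw [e]
    exact this
  · intro x _
    split_ifs with h1 h2
    · exact absurd (h1.symm.trans h2) h
    all_goals simp

lemma pairParity_eq_add {u v : ℕ} (h : u ≠ v) (l : List Pass) :
    pairParity v u l = pairParity u v l + parity u l * parity v l := by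
  rw [← pairParity_add_swap h, ← add_assoc, two_self, zero_add]

lemma pairParity_cons_of_ne {u v : ℕ} {x : Pass} (h : x.label ≠ u) (l : List Pass) :
    pairParity u v (x :: l) = pairParity u v l := by
  rw [pairParity, sum₂, sum₁_eq_zero, zero_add]
  · rfl
  · intro y _; rw [if_neg h, zero_mul]

lemma pairParity_cons_self {v : ℕ} {x : Pass} (l : List Pass) :
    pairParity x.label v (x :: l) = parity v l + pairParity x.label v l := by
  rw [pairParity, sum₂]
  simp only [if_true, one_mul]
  rfl

lemma pairParity_eq_zero {u v : ℕ} {l : List Pass} (h : ∀ x ∈ l, x.label ≠ u) :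
    pairParity u v l = 0 :=
  sum₂_eq_zero fun x hx y _ => by rw [if_neg (h x hx), zero_mul]

lemma pairParity_remove {u v : ℕ} {i i' : Pass} {A B : List Pass} (hi : i'.label = i.label)
    (hu : u ≠ i.label) (hv : v ≠ i.label) :
    pairParity u v (i :: (A ++ i' :: B)) = pairParity u v (A ++ B) := by
  rw [pairParity_cons_of_ne hu.symm, pairParity_append, pairParity_append,
    pairParity_cons_of_ne (hi ▸ hu.symm), parity_cons_of_ne (hi ▸ hv.symm)]

/-- A crossing interlaces with i exactly when it is passed an odd number of times on the loop A; the
passages in B are counted twice and drop out. -/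
lemma pairParity_self_left {v : ℕ} {i i' : Pass} {A B : List Pass} (hi : i'.label = i.label)
    (hv : v ≠ i.label) (hA : ∀ y ∈ A ++ B, y.label ≠ i.label) :
    pairParity i.label v (i :: (A ++ i' :: B)) = parity v A := by
  simp only [List.mem_append] at hA
  rw [pairParity_cons_self, pairParity_append, parity_append, parity_cons_of_ne (hi ▸ hv.symm),
    pairParity_eq_zero fun x hx => hA x (Or.inl hx), parity_eq_zero fun x hx => hA x (Or.inl hx),
    ← hi, pairParity_cons_self, pairParity_eq_zero fun x hx => hi ▸ hA x (Or.inr hx), add_assoc]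
  simp [two_self]

/-! ### Closed curves -/

lemma IsCurve.of_perm {l l' : List Pass} (h : IsCurve l)
    (hp : (l.map Pass.branch).Perm (l'.map Pass.branch)) : IsCurve l' := by
  refine ⟨hp.nodup_iff.mp h.nodup, fun x hx => ?_⟩
  obtain ⟨y, hy, hyx⟩ := List.mem_map.mp (hp.mem_iff.mpr (List.mem_map_of_mem hx))
  obtain ⟨z, hz, hm⟩ := h.exists_match y hy
  obtain ⟨t, ht, htz⟩ := List.mem_map.mp (hp.mem_iff.mp (List.mem_map_of_mem hz))
  refine ⟨t, ht, (congrArg Prod.fst htz).trans (hm.1.trans (congrArg Prod.fst hyx)), fun h' => hm.2 ?_⟩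
  exact (congrArg Prod.snd htz).symm.trans (h'.trans (congrArg Prod.snd hyx).symm)

lemma map_branch_revPath (l : List Pass) :
    ((revPath l).map Pass.branch).Perm (l.map Pass.branch) := by
  rw [revPath, List.map_reverse, List.map_map]
  exact List.reverse_perm _

lemma IsCurve.remove {i i' : Pass} {l : List Pass} (h : IsCurve (i :: i' :: l))
    (hm : Match i i') : IsCurve l := by
  have hnd := h.nodup
  have hne := IsCurve.label_ne (A := []) h hm
  simp only [BranchNodup, List.map_cons, List.nodup_cons] at hnd
  refine ⟨hnd.2.2, fun x hx => ?_⟩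
  obtain ⟨y, hy, hxy⟩ := h.exists_match x (by simp [hx])
  simp only [List.mem_cons] at hy
  rcases hy with rfl | rfl | hy
  · exact absurd hxy.1.symm (hne x hx)
  · exact absurd (hxy.1.symm.trans hm.1) (hne x hx)
  · exact ⟨y, hy, hxy⟩

lemma IsCurve.parity_eq_zero {l : List Pass} (h : IsCurve l) (u : ℕ) : parity u l = 0 := by
  by_cases hu : ∃ x ∈ l, x.label = u
  · obtain ⟨x, hx, rfl⟩ := hu
    obtain ⟨P, Q, rfl⟩ := List.append_of_mem hx
    have h' : IsCurve (x :: (Q ++ P)) := h.of_perm (List.perm_append_comm.map _)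
    obtain ⟨y, hy, hm⟩ := h'.exists_match x (by simp)
    rcases List.mem_cons.mp hy with rfl | hy
    · exact absurd rfl hm.2
    obtain ⟨R, S, hRS⟩ := List.append_of_mem hy
    have hRS' := h'
    rw [hRS] at hRS'
    have hne := hRS'.label_ne hm
    simp only [List.mem_append] at hne
    rw [parity_append, add_comm, ← parity_append, List.cons_append, parity_cons, if_pos rfl, hRS,
      parity_append, parity_cons, if_pos hm.1,
      KnotTheory.parity_eq_zero fun z hz => hne z (Or.inl hz),
      KnotTheory.parity_eq_zero fun z hz => hne z (Or.inr hz)]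
    simp [two_self]
  · push Not at hu
    exact KnotTheory.parity_eq_zero hu

lemma IsCurve.interlacement_symm {l : List Pass} (h : IsCurve l) (u v : ℕ) :
    interlacement l u v = interlacement l v u := by
  by_cases huv : u = v
  · rw [huv]
  · rw [interlacement, interlacement, if_neg huv, if_neg (Ne.symm huv), pairParity_eq_add huv,
      h.parity_eq_zero, zero_mul, add_zero]

lemma interlacement_self (l : List Pass) (u : ℕ) : interlacement l u u = 0 := if_pos rfl

lemma interlacement_of_ne {l : List Pass} {u v : ℕ} (h : u ≠ v) :
    interlacement l u v = pairParity u v l := if_neg h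

lemma IsCurve.parity_append {A B : List Pass} (h : IsCurve (A ++ B)) (u : ℕ) :
    parity u B = parity u A := by
  have := h.parity_eq_zero u
  rw [KnotTheory.parity_append] at this
  exact (eq_of_add_zero this).symm

lemma IsCurve.interlacement_rotate {A B : List Pass} (h : IsCurve (A ++ B)) :
    interlacement (B ++ A) = interlacement (A ++ B) := by
  ext u v
  by_cases huv : u = v
  · rw [huv, interlacement_self, interlacement_self]
  · rw [interlacement_of_ne huv, interlacement_of_ne huv, pairParity_append, pairParity_append,
      h.parity_append, h.parity_append]
    ring

lemma labels_eq_of_perm {l l' : List Pass}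
    (hp : (l.map Pass.branch).Perm (l'.map Pass.branch)) : labels l = labels l' := by
  have : (l.map Pass.label).Perm (l'.map Pass.label) := by
    have := hp.map Prod.fst
    rwa [List.map_map, List.map_map] at this
  exact List.toFinset_eq_of_perm _ _ this

lemma labels_cons (x : Pass) (l : List Pass) : labels (x :: l) = insert x.label (labels l) := by
  simp [labels]

/-- All data of the induction are independent of the base point, so any crossing may be brought to
the front. For `Phi` this needs colourability. -/
lemma IsCurve.rotation_eq {l l' : List Pass} (h : IsCurve l) (hc : IsColourable l)
    (hr : l ~r l') : IsCurve l' ∧ IsColourable l' ∧ labels l' = labels l ∧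
      interlacement l' = interlacement l ∧ Phi l' = Phi l ∧ l'.length = l.length := by
  obtain ⟨n, rfl⟩ := hr
  rw [List.rotate_eq_drop_append_take_mod]
  set A := l.take (n % l.length)
  set B := l.drop (n % l.length)
  have hl : A ++ B = l := List.take_append_drop _ _
  rw [← hl] at h hc ⊢
  have hp := (List.perm_append_comm (l₁ := A) (l₂ := B)).map Pass.branch
  exact ⟨h.of_perm hp, hc.rotate, (labels_eq_of_perm hp).symm, h.interlacement_rotate,
    (Phi_rotate (hc.isBounding h) h.nodup).symm, by simp [add_comm]⟩

/-- Some crossing of a curve is a kink, or is followed by a crossing that is interlaced with it. -/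
lemma IsCurve.exists_innermost {i i' : Pass} {A B : List Pass} (h : IsCurve (i :: (A ++ i' :: B)))
    (hm : Match i i') :
    (∃ (j j' : Pass) (C : List Pass), Match j j' ∧ i :: (A ++ i' :: B) ~r j :: j' :: C) ∨
    ∃ (j j' k k' : Pass) (Y Z W : List Pass), Match j j' ∧ Match k k' ∧
      i :: (A ++ i' :: B) ~r j :: k :: (Y ++ j' :: (Z ++ k' :: W)) := by
  -- The induction is on the length of the loop at i. The partner of the first passage j of this
  -- loop lies in the loop, which gives a shorter loop, or beyond i', which gives an interlaced pair
  -- passed in succession.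
  induction hn : A.length using Nat.strong_induction_on generalizing i i' A B with
  | _ n ih =>
    cases A with
    | nil => exact Or.inl ⟨i, i', B, hm, List.IsRotated.refl _⟩
    | cons j Y =>
      obtain ⟨j', hj', hmj⟩ := h.exists_match j (by simp)
      have hne := h.label_ne hm j (by simp)
      simp only [List.mem_cons, List.mem_append, List.cons_append] at hj'
      rcases hj' with rfl | rfl | hj' | rfl | hj'
      · exact absurd hmj.1.symm hne
      · exact absurd rfl hmj.2
      · obtain ⟨Y₁, Y₂, rfl⟩ := List.append_of_mem hj'
        have hrot : i :: (j :: (Y₁ ++ j' :: Y₂) ++ i' :: B) ~r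
            j :: (Y₁ ++ j' :: (Y₂ ++ i' :: B ++ [i])) := ⟨1, by simp⟩
        have h' := ih Y₁.length (by simp at hn; omega) (h.of_perm (hrot.perm.map _)) hmj rfl
        rcases h' with ⟨k, k', C, h1, h2⟩ | ⟨k, k', t, t', Y', Z, W, h1, h2, h3⟩
        · exact Or.inl ⟨k, k', C, h1, hrot.trans h2⟩
        · exact Or.inr ⟨k, k', t, t', Y', Z, W, h1, h2, hrot.trans h3⟩
      · exact absurd (hmj.1.symm.trans hm.1) hne
      · obtain ⟨Z, W, rfl⟩ := List.append_of_mem hj'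
        exact Or.inr ⟨i, i', j, j', Y, Z, W, hm, hmj, List.IsRotated.refl _⟩

lemma IsCurve.smooth {i i' : Pass} {A B : List Pass} (h : IsCurve (i :: (A ++ i' :: B)))
    (hm : Match i i') : IsCurve (A ++ B) := by
  refine IsCurve.remove (i := i) (i' := i') (h.of_perm (List.Perm.map _ ?_)) hm
  exact List.perm_middle.cons i

lemma map_branch_append_revPath (A B : List Pass) :
    ((A ++ revPath B).map Pass.branch).Perm ((A ++ B).map Pass.branch) := by
  rw [List.map_append, List.map_append]
  exact (map_branch_revPath B).append_left _

/-- Smoothing a crossing against the orientation complements the interlacement graph on the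
neighbourhood of the crossing. -/
lemma IsCurve.schur_interlacement {i i' : Pass} {A B : List Pass}
    (h : IsCurve (i :: (A ++ i' :: B))) (hm : Match i i') {u v : ℕ} (hu : u ≠ i.label)
    (hv : v ≠ i.label) (huv : u ≠ v) :
    schur (interlacement (i :: (A ++ i' :: B))) i.label u v = interlacement (A ++ revPath B) u v := by
  have hAB := h.smooth hm
  rw [schur, h.interlacement_symm u i.label, interlacement_of_ne huv, interlacement_of_ne hu.symm,
    interlacement_of_ne hv.symm, interlacement_of_ne huv, pairParity_remove hm.1 hu hv,
    pairParity_self_left hm.1 hu (h.label_ne hm), pairParity_self_left hm.1 hv (h.label_ne hm),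
    pairParity_append, pairParity_append, parity_revPath, pairParity_revPath,
    pairParity_eq_add huv, hAB.parity_append, hAB.parity_append]
  ring

/-! ### Two interlaced crossings passed in succession. -/

section Pair

variable {i i' j j' : Pass} {Y Z W : List Pass}

lemma IsCurve.label_ne_pair (h : IsCurve (i :: j :: (Y ++ i' :: (Z ++ j' :: W)))) (hi : Match i i')
    (hj : Match j j') : j.label ≠ i.label ∧ (∀ y ∈ Y ++ Z ++ W, y.label ≠ i.label) ∧
      ∀ y ∈ Y ++ Z ++ W, y.label ≠ j.label := by
  have h1 := IsCurve.label_ne (A := j :: Y) (B := Z ++ j' :: W) h hi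
  have hr : i :: j :: (Y ++ i' :: (Z ++ j' :: W)) ~r j :: ((Y ++ i' :: Z) ++ j' :: (W ++ [i])) :=
    ⟨1, by simp⟩
  have h2 := IsCurve.label_ne (h.of_perm (hr.perm.map _)) hj
  refine ⟨h1 j (by simp), fun y hy => h1 y ?_, fun y hy => h2 y ?_⟩ <;>
  · simp only [List.mem_append, List.mem_cons] at hy ⊢
    tauto

/-- The loop at i is j followed by Y, the loop at j runs through Y, i' and Z; the parities of u on
these loops decide its adjacency to i and j. -/
lemma IsCurve.interlacement_pair (h : IsCurve (i :: j :: (Y ++ i' :: (Z ++ j' :: W))))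
    (hi : Match i i') (hj : Match j j') {u v : ℕ} (hui : u ≠ i.label) (huj : u ≠ j.label)
    (hvi : v ≠ i.label) (hvj : v ≠ j.label) (huv : u ≠ v) :
    interlacement (i :: j :: (Y ++ i' :: (Z ++ j' :: W))) i.label u = parity u Y ∧
    interlacement (i :: j :: (Y ++ i' :: (Z ++ j' :: W))) j.label u = parity u Y + parity u Z ∧
    interlacement (i :: j :: (Y ++ i' :: (Z ++ j' :: W))) u v = pairParity u v (Y ++ (Z ++ W)) := by
  obtain ⟨hij, h1, h2⟩ := h.label_ne_pair hi hj
  simp only [List.mem_append] at h1 h2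
  have hr : i :: j :: (Y ++ i' :: (Z ++ j' :: W)) = [i] ++ (j :: ((Y ++ i' :: Z) ++ j' :: W)) := by
    simp
  have hr' : j :: ((Y ++ i' :: Z) ++ j' :: W) ++ [i] = j :: ((Y ++ i' :: Z) ++ j' :: (W ++ [i])) := by
    simp
  refine ⟨?_, ?_, ?_⟩
  · rw [interlacement_of_ne hui.symm]
    have := pairParity_self_left (A := j :: Y) (B := Z ++ j' :: W) hi.1 hui (h.label_ne hi)
    rw [List.cons_append, parity_cons_of_ne huj.symm] at this
    exact this
  · have hne : ∀ y ∈ (Y ++ i' :: Z) ++ (W ++ [i]), y.label ≠ j.label := by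
      intro y hy
      simp only [List.mem_append, List.mem_cons, List.not_mem_nil, or_false] at hy
      rcases hy with (hy | rfl | hy) | hy | rfl
      exacts [h2 y (by tauto), by rw [hi.1]; exact hij.symm, h2 y (by tauto), h2 y (by tauto),
        hij.symm]
    rw [hr, ← IsCurve.interlacement_rotate (A := [i]) (B := j :: ((Y ++ i' :: Z) ++ j' :: W))
      (by rwa [← hr]), interlacement_of_ne huj.symm, hr',
      pairParity_self_left hj.1 huj hne, KnotTheory.parity_append, parity_cons_of_ne (hi.1 ▸ hui.symm)]
  · rw [interlacement_of_ne huv]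
    have := pairParity_remove (A := j :: Y) (B := Z ++ j' :: W) hi.1 hui hvi
    rw [List.cons_append] at this
    rw [this, List.cons_append, ← List.append_assoc, pairParity_remove hj.1 huj hvj,
      List.append_assoc]

end Pair

lemma nullity_empty (M : ℕ → ℕ → ZMod 2) : nullity ∅ M = 0 := by
  have : solSpace ∅ M = ⊥ := by
    rw [eq_bot_iff]
    intro x hx
    rw [mem_solSpace] at hx
    ext u
    exact hx.1 u (by simp)
  rw [nullity, this, finrank_bot]

/-- The average number of circles of the states of a curve. -/
theorem kappa_eq_Phi {l : List Pass} (h : IsCurve l) (hc : IsColourable l) :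
    kappa (labels l) (interlacement l) = l.length + 6 * Phi l := by
  induction hn : l.length using Nat.strong_induction_on generalizing l with
  | _ n ih =>
    rcases l with _ | ⟨i, l⟩
    · simp [kappa, mean, labels, nullity_empty, Phi, sum₄, ← hn]
    · obtain ⟨i', hi', hm⟩ := h.exists_match i (by simp)
      rcases List.mem_cons.mp hi' with rfl | hi'
      · exact absurd rfl hm.2
      obtain ⟨A, B, rfl⟩ := List.append_of_mem hi'
      -- Both sides are invariant under rotation. A kink changes `kappa` and the length by 2 and
      -- leaves `Phi` alone; an interlaced pair passed in succession is handled by the two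
      -- recursions.
      rcases h.exists_innermost hm with ⟨j, j', C, hmj, hr⟩ | ⟨j, j', k, k', Y, Z, W, hmj, hmk, hr⟩
      · obtain ⟨h1, h2, h3, h4, h5, h6⟩ := h.rotation_eq hc hr
        rw [← h3, ← h4, ← h5]
        have hne := IsCurve.label_ne (A := []) h1 hmj
        rw [List.nil_append] at hne
        have hC := h1.remove hmj
        have hC' : IsCurve (revPath C) := hC.of_perm (map_branch_revPath C).symm
        -- The kink is removed by smoothing it against the orientation, for which colourability is
        -- already known. The reversal affects neither `Phi` nor the interlacement graph.
        have hcol : IsColourable (revPath C) := IsColourable.smooth (A := []) h2 hmj hne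
        have hlen : (revPath C).length + 2 = n := by rw [← hn, ← h6]; simp [revPath]
        have hj : j.label ∉ labels C := by
          rw [mem_labels]; rintro ⟨x, hx, hxj⟩; exact hne x hx hxj
        have key := ih _ (by omega) hC' hcol rfl
        rw [Phi_revPath, labels_eq_of_perm (map_branch_revPath C)] at key
        have hPhi : Phi (j :: j' :: C) = Phi C := by
          have := Phi_cons_append_cons (A := []) (B := C) (i := j) (i' := j') (by simp) hne hmj.1
          simpa [cross, sum₁] using this
        have hV : labels (j :: j' :: C) = insert j.label (labels C) := by
          rw [labels_cons, labels_cons, hmj.1, Finset.insert_idem]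
        rw [hV, kappa_insert_isolated h1.interlacement_symm hj (interlacement_self _ _), hPhi,
          ← hlen]
        · rw [kappa_congr (M' := interlacement (revPath C)), key]
          · push_cast; ring
          · intro u hu v hv huv
            have hu' : u ≠ j.label := ne_of_mem_of_not_mem hu hj
            have hv' : v ≠ j.label := ne_of_mem_of_not_mem hv hj
            have := pairParity_remove (A := []) (B := C) hmj.1 hu' hv'
            rw [interlacement_of_ne huv, interlacement_of_ne huv, pairParity_revPath,
              pairParity_eq_add huv, hC.parity_eq_zero, zero_mul, add_zero]
            exact this
        · intro u hu
          have hu' : u ≠ j.label := ne_of_mem_of_not_mem hu hj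
          rw [interlacement_of_ne hu'.symm]
          exact pairParity_self_left (A := []) (B := C) hmj.1 hu' hne
      · obtain ⟨h1, h2, h3, h4, h5, h6⟩ := h.rotation_eq hc hr
        rw [← h3, ← h4, ← h5]
        set w := j :: k :: (Y ++ j' :: (Z ++ k' :: W)) with hw
        have h1' : IsCurve (j :: ((k :: Y) ++ j' :: (Z ++ k' :: W))) := h1
        obtain ⟨hkj, hneJ, hneK⟩ := h1.label_ne_pair hmj hmk
        set V := labels (Y ++ Z ++ W) with hV
        have hjV : j.label ∉ V := by
          rw [hV, mem_labels]; rintro ⟨x, hx, hxj⟩; exact hneJ x hx hxj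
        have hkV : k.label ∉ V := by
          rw [hV, mem_labels]; rintro ⟨x, hx, hxj⟩; exact hneK x hx hxj
        classical
        have hpw : (w.map Pass.branch).Perm ((j :: j' :: (k :: k' :: (Y ++ Z ++ W))).map Pass.branch) := by
          refine List.Perm.map _ ?_
          rw [List.perm_iff_count]
          intro x
          simp only [hw, List.count_cons, List.count_append]
          omega
        have hcB : IsCurve (k :: k' :: (Y ++ Z ++ W)) := (h1.of_perm hpw).remove hmj
        have hcV : IsCurve (Y ++ Z ++ W) := hcB.remove hmk
        have hp1 : ((Y ++ Z ++ W).map Pass.branch).Perm ((Y ++ (W ++ Z)).map Pass.branch) := by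
          rw [List.append_assoc]
          exact (List.perm_append_comm.append_left _).map _
        have hc1 : IsCurve (Y ++ (W ++ Z)) := hcV.of_perm hp1
        have hp2 := map_branch_append_revPath Y (W ++ Z)
        have hc2 : IsCurve (Y ++ revPath (W ++ Z)) := hc1.of_perm hp2.symm
        have hp0 : ((k :: Y ++ revPath (Z ++ k' :: W)).map Pass.branch).Perm
            ((k :: k' :: (Y ++ Z ++ W)).map Pass.branch) := by
          refine (map_branch_append_revPath _ _).trans (List.Perm.map _ ?_)
          rw [List.perm_iff_count]
          intro x
          simp only [List.count_cons, List.count_append, List.cons_append]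
          omega
        have hc0 : IsCurve (k :: Y ++ revPath (Z ++ k' :: W)) := hcB.of_perm hp0.symm
        have hlen : w.length = n := by rw [← hn, ← h6]
        have hlw : w.length = Y.length + Z.length + W.length + 4 := by simp [hw]; omega
        have hl0 : (k :: Y ++ revPath (Z ++ k' :: W)).length = Y.length + Z.length + W.length + 2 := by
          simp [revPath]; omega
        have hl1 : (Y ++ (W ++ Z)).length = Y.length + Z.length + W.length := by simp; omega
        have hl2 : (Y ++ revPath (W ++ Z)).length = Y.length + Z.length + W.length := by
          simp [revPath]; omega
        -- The three curves match the terms of `kappa_insert_pair`: j smoothed against the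
        -- orientation, then j and k both smoothed along it, then j along and k against it.
        have key0 := ih _ (by omega) hc0 (IsColourable.smooth (A := k :: Y) h2 hmj (h1'.label_ne hmj)) rfl
        have key1 := ih _ (by omega) hc1 (h2.smooth_pair hmj hmk hkj hneJ hneK) rfl
        have key2 := ih _ (by omega) hc2 (h2.smooth_pair' hmj hmk hkj hneJ hneK) rfl
        have hb : IsBounding (Z ++ k' :: W) :=
          IsColourable.isBounding_right (i := j) (i' := j') (A := k :: Y) h2 h1' hmj
        have hnd : BranchNodup (Z ++ k' :: W) := by
          have := h1.nodup
          rw [hw, BranchNodup, List.map_cons, List.map_cons, List.map_append, List.map_cons] at this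
          exact (List.nodup_cons.mp ((List.nodup_cons.mp (List.nodup_cons.mp this).2).2.of_append_right)).2
        simp only [List.mem_append] at hneK
        have hk0 : ∀ y, (y ∈ Y ∨ y ∈ Z) ∨ y ∈ W → eps k' y = 0 := fun y hy =>
          eps_of_label_ne (hmk.1 ▸ (hneK y hy).symm)
        have hrot : Phi (Z ++ W) = Phi (W ++ Z) := by
          have := Phi_rotate hb hnd
          rw [Phi_remove (fun y hy => hk0 y (by tauto)) fun y hy => hk0 y (by tauto)] at this
          rw [this, List.cons_append]
          exact Phi_remove (P := []) (by simp) fun y hy => hk0 y (by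
            rw [List.mem_append] at hy; tauto)
        have hrow : cross (k :: Y) (Z ++ k' :: W) = 0 :=
          IsBounding.cross_eq_zero (x := j) (x' := j') (h2.isBounding h1) h1.nodup hmj
        have hrec := Phi_recursion hcV.nodup hmj.1 hmk.1 hmk.2.symm hkj hneJ
          (by simpa only [List.mem_append] using hneK) hrow hrot
        have hVw : labels w = insert j.label (insert k.label V) := by
          rw [labels_eq_of_perm hpw, labels_cons, labels_cons, labels_cons, labels_cons, hmj.1, hmk.1,
            Finset.insert_idem, Finset.insert_idem]
        have hV0 : labels (k :: Y ++ revPath (Z ++ k' :: W)) = insert k.label V := by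
          rw [labels_eq_of_perm hp0, labels_cons, labels_cons, hmk.1, Finset.insert_idem]
        rw [hV0] at key0
        rw [← labels_eq_of_perm hp1, ← hV] at key1
        rw [labels_eq_of_perm hp2, ← labels_eq_of_perm hp1, ← hV] at key2
        have hMjk : interlacement w j.label k.label = 1 := by
          have := pairParity_self_left (A := k :: Y) (B := Z ++ k' :: W) hmj.1 hkj (h1'.label_ne hmj)
          rw [interlacement_of_ne hkj.symm]
          refine this.trans ?_
          rw [parity_cons, if_pos rfl, parity_eq_zero fun y hy => hneK y (by tauto), add_zero]
        have hpar : ∀ u, parity u W = parity u Y + parity u Z := by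
          intro u
          rw [hcV.parity_append, parity_append]
        have hM : ∀ u ∈ V, ∀ v ∈ V, u ≠ v → _ := fun u hu v hv huv =>
          h1.interlacement_pair hmj hmk (ne_of_mem_of_not_mem hu hjV) (ne_of_mem_of_not_mem hu hkV)
            (ne_of_mem_of_not_mem hv hjV) (ne_of_mem_of_not_mem hv hkV) huv
        have hM1 : kappa V (fun u v => interlacement w u v +
            interlacement w u j.label * interlacement w k.label v +
            interlacement w u k.label * interlacement w j.label v) =
            kappa V (interlacement (Y ++ (W ++ Z))) := by
          refine kappa_congr fun u hu v hv huv => ?_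
          obtain ⟨e1, e2, e3⟩ := hM u hu v hv huv
          obtain ⟨e4, e5, -⟩ := hM v hv u hu huv.symm
          rw [h1.interlacement_symm u j.label, h1.interlacement_symm u k.label, e1, e2, e3, e4, e5,
            interlacement_of_ne huv]
          simp only [pairParity_append, parity_append, hpar]
          generalize parity u Y = a, parity v Y = b, parity u Z = c, parity v Z = d,
            pairParity u v Y = e, pairParity u v Z = f, pairParity u v W = g
          revert a b c d e f g
          decide
        have hM2 : kappa V (fun u v => interlacement w u v +
            interlacement w u j.label * interlacement w k.label v +
            interlacement w u k.label * interlacement w j.label v +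
            interlacement w u j.label * interlacement w j.label v) =
            kappa V (interlacement (Y ++ revPath (W ++ Z))) := by
          refine kappa_congr fun u hu v hv huv => ?_
          obtain ⟨e1, e2, e3⟩ := hM u hu v hv huv
          obtain ⟨e4, e5, -⟩ := hM v hv u hu huv.symm
          rw [h1.interlacement_symm u j.label, h1.interlacement_symm u k.label, e1, e2, e3, e4, e5,
            interlacement_of_ne huv]
          simp only [pairParity_append, pairParity_revPath, parity_revPath, parity_append,
            pairParity_eq_add huv, hpar]
          generalize parity u Y = a, parity v Y = b, parity u Z = c, parity v Z = d,
            pairParity u v Y = e, pairParity u v Z = f, pairParity u v W = g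
          revert a b c d e f g
          decide
        have hM0 : kappa (insert k.label V) (schur (interlacement w) j.label) =
            kappa (insert k.label V) (interlacement (k :: Y ++ revPath (Z ++ k' :: W))) := by
          refine kappa_congr fun u hu v hv huv => ?_
          have hne : ∀ t ∈ insert k.label V, t ≠ j.label := by
            intro t ht
            rcases Finset.mem_insert.mp ht with rfl | ht
            exacts [hkj, ne_of_mem_of_not_mem ht hjV]
          exact h1'.schur_interlacement hmj (hne u hu) (hne v hv) huv
        -- For length n the three smaller lengths n-2, n-4, n-4 enter with signs -, +, + and give n
        -- - 6; the missing 6 is six times the constant in `hrec`.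
        rw [hVw, kappa_insert_pair h1.interlacement_symm hkj.symm hjV hkV (interlacement_self _ _) hMjk,
          hM0, hM1, hM2, key0, key1, key2, hl0, hl1, hl2, ← hlen, hlw]
        push_cast
        linarith

end KnotTheory

namespace KnotTheory

open Module

/-! ### From Gauss codes to flat curves -/

/-- The first branch of a crossing is the one that is passed by the strand whose direction, followed
by the direction of the other strand, is positively oriented. -/
def Letter.IsFst (x : Letter) : Prop := x.isOver = true ↔ x.sign = 1

open Classical in
/-- The passage of the underlying flat curve. -/
noncomputable def shadow (x : Letter) : Pass := ⟨x.label, decide x.IsFst, true⟩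

lemma Letter.flip_flip (x : Letter) : x.flip.flip = x := by
  ext <;> simp [Letter.flip]

lemma Letter.isFst_flip (x : Letter) : x.flip.IsFst ↔ ¬ x.IsFst := by
  obtain ⟨u, b, s⟩ := x
  cases b <;> simp [Letter.IsFst, Letter.flip]

lemma match_shadow_flip (x : Letter) : Match (shadow x) (shadow x.flip) := by
  refine ⟨rfl, ?_⟩
  have := x.isFst_flip
  by_cases h : x.IsFst <;> simp_all [shadow]

namespace IsGaussCode

variable {w : List Letter}

lemma eq_of_label (h : IsGaussCode w) {x y : Letter} (hx : x ∈ w) (hy : y ∈ w)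
    (hl : x.label = y.label) (ht : x.IsFst ↔ y.IsFst) : x = y := by
  have hs := h.sign_eq x hx y hy hl
  obtain ⟨u, b, s⟩ := x
  obtain ⟨v, c, t⟩ := y
  simp only at hl hs
  subst hl hs
  by_cases hs : s = 1 <;> cases b <;> cases c <;> simp_all [Letter.IsFst]

lemma isCurve (h : IsGaussCode w) : IsCurve (w.map shadow) := by
  refine ⟨?_, ?_⟩
  · rw [BranchNodup, List.map_map]
    refine h.nodup.map_on fun x hx y hy hxy => ?_
    have h1 : x.label = y.label := congrArg Prod.fst hxy
    have h2 := congrArg Prod.snd hxy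
    refine h.eq_of_label hx hy h1 ?_
    simpa [Pass.branch, shadow] using h2
  · simp only [List.mem_map]
    rintro _ ⟨x, hx, rfl⟩
    exact ⟨_, ⟨x.flip, h.flip_mem x hx, rfl⟩, match_shadow_flip x⟩

lemma labels_shadow (w : List Letter) : labels (w.map shadow) = crossings w := by
  rw [labels, crossings, List.map_map]; rfl

lemma exists_flip (h : IsGaussCode w) (i : Fin w.length) : ∃ j, w.get j = (w.get i).flip :=
  List.get_of_mem (h.flip_mem _ (List.get_mem w i))

lemma mem_crossings {u : ℕ} : u ∈ crossings w ↔ ∃ x ∈ w, x.label = u := by simp [crossings]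

lemma label_mem (i : Fin w.length) : (w.get i).label ∈ crossings w :=
  mem_crossings.mpr ⟨_, List.get_mem w i, rfl⟩

lemma exists_isFst (h : IsGaussCode w) {u : ℕ} (hu : u ∈ crossings w) :
    ∃ i : Fin w.length, (w.get i).label = u ∧ (w.get i).IsFst := by
  obtain ⟨x, hx, rfl⟩ := mem_crossings.mp hu
  by_cases ht : x.IsFst
  · obtain ⟨i, hi⟩ := List.get_of_mem hx
    exact ⟨i, by rw [hi], by rwa [hi]⟩
  · obtain ⟨i, hi⟩ := List.get_of_mem (h.flip_mem x hx)
    exact ⟨i, by rw [hi]; rfl, by rw [hi]; exact (x.isFst_flip).mpr ht⟩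

lemma get_injective (h : IsGaussCode w) : Function.Injective w.get :=
  List.nodup_iff_injective_get.mp h.nodup

lemma isFst_unique (h : IsGaussCode w) {i j : Fin w.length} (hi : (w.get i).IsFst)
    (hj : (w.get j).IsFst) (hl : (w.get i).label = (w.get j).label) : i = j :=
  h.get_injective (h.eq_of_label (List.get_mem w i) (List.get_mem w j) hl (iff_of_true hi hj))

/-- Every passage is a first passage, or the flip of one. -/
lemma isFst_or (h : IsGaussCode w) (i : Fin w.length) : (w.get i).IsFst ∨
    ∃ j, (w.get j).IsFst ∧ w.get i = (w.get j).flip := by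
  by_cases hi : (w.get i).IsFst
  · exact Or.inl hi
  · obtain ⟨j, hj⟩ := h.exists_flip i
    exact Or.inr ⟨j, by rw [hj]; exact (Letter.isFst_flip _).mpr hi, by rw [hj, Letter.flip_flip]⟩

end IsGaussCode

/-! ### The faces of a planar code -/

/-- The jump of a colouring of the faces at a passage. -/
def faceJump {w : List Letter} (g : Quot (FaceRel w) → ℚ) (i : Fin w.length) : ℚ :=
  g (Quot.mk _ (i.succ, true)) - g (Quot.mk _ (i.succ, false)) -
    g (Quot.mk _ (i.castSucc, true)) + g (Quot.mk _ (i.castSucc, false))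

section Faces

variable {w : List Letter} {g : Quot (FaceRel w) → ℚ}

lemma face_out_out {i j : Fin w.length} (hij : w.get j = (w.get i).flip) (hi : (w.get i).IsFst) :
    g (Quot.mk _ (i.succ, true)) = g (Quot.mk _ (j.succ, false)) :=
  congrArg g (Quot.sound (FaceRel.out_out i j hij hi))

lemma face_in_out {i j : Fin w.length} (hij : w.get j = (w.get i).flip) (hi : (w.get i).IsFst) :
    g (Quot.mk _ (i.castSucc, true)) = g (Quot.mk _ (j.succ, true)) :=
  congrArg g (Quot.sound (FaceRel.in_out i j hij hi))

lemma face_in_in {i j : Fin w.length} (hij : w.get j = (w.get i).flip) (hi : (w.get i).IsFst) :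
    g (Quot.mk _ (i.castSucc, false)) = g (Quot.mk _ (j.castSucc, true)) :=
  congrArg g (Quot.sound (FaceRel.in_in i j hij hi))

lemma face_out_in {i j : Fin w.length} (hij : w.get j = (w.get i).flip) (hi : (w.get i).IsFst) :
    g (Quot.mk _ (i.succ, false)) = g (Quot.mk _ (j.castSucc, false)) :=
  congrArg g (Quot.sound (FaceRel.out_in i j hij hi))

/-- If the initial width and all jumps vanish, both sides of every arc have the same colour, and
successive arcs share it through the corners. The constants are thus the whole kernel in the
dimension count below. -/
lemma face_eq_const (h : IsGaussCode w)
    (h0 : g (Quot.mk _ (0, true)) = g (Quot.mk _ (0, false)))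
    (hj : ∀ i, (w.get i).IsFst → faceJump g i = 0) (a : Quot (FaceRel w)) :
    g a = g (Quot.mk _ (0, true)) := by
  have hw : ∀ k : Fin (w.length + 1), g (Quot.mk _ (k, true)) = g (Quot.mk _ (k, false)) := by
    intro k
    induction k using Fin.induction with
    | zero => exact h0
    | succ k ih =>
      rcases h.isFst_or k with hk | ⟨i, hi, hik⟩
      · have e := hj k hk
        simp only [faceJump] at e
        linarith
      · have e := hj i hi
        have e1 := face_out_out (g := g) hik hi
        have e2 := face_in_out (g := g) hik hi
        have e3 := face_in_in (g := g) hik hi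
        have e4 := face_out_in (g := g) hik hi
        simp only [faceJump] at e
        linarith
  have key : ∀ k : Fin (w.length + 1), g (Quot.mk _ (k, true)) = g (Quot.mk _ (0, true)) := by
    intro k
    induction k using Fin.induction with
    | zero => rfl
    | succ k ih =>
      rcases h.isFst_or k with hk | ⟨i, hi, hik⟩
      · obtain ⟨j, hkj⟩ := h.exists_flip k
        rw [face_out_out (g := g) hkj hk, ← hw, ← face_in_out (g := g) hkj hk, ih]
      · rw [← face_in_out (g := g) hik hi, hw, face_in_in (g := g) hik hi, ih]
  obtain ⟨⟨k, b⟩⟩ := a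
  cases b
  exacts [(hw k).symm.trans (key k), key k]

/-- Colourings modulo constants inject into systems of weights, given by the initial width and one
jump per crossing. For n crossings the target has dimension n + 1, so a sphere, with n + 2 faces, is
the case of surjectivity. -/
lemma exists_linearMap (h : IsGaussCode w) :
    ∃ L : (Quot (FaceRel w) → ℚ) →ₗ[ℚ] ℚ × (crossings w → ℚ),
      finrank ℚ (LinearMap.ker L) ≤ 1 ∧ ∀ g, (L g).1 = g (Quot.mk _ (0, true)) -
        g (Quot.mk _ (0, false)) ∧ ∀ i, (w.get i).IsFst →
          (L g).2 ⟨(w.get i).label, IsGaussCode.label_mem i⟩ = faceJump g i := by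
  choose t htl htf using fun u : crossings w => h.exists_isFst u.2
  let L : (Quot (FaceRel w) → ℚ) →ₗ[ℚ] ℚ × (crossings w → ℚ) :=
    { toFun := fun g => (g (Quot.mk _ (0, true)) - g (Quot.mk _ (0, false)),
        fun u => faceJump g (t u))
      map_add' := fun g g' => by
        refine Prod.ext ?_ (funext fun u => ?_) <;>
          simp only [faceJump, Pi.add_apply, Prod.fst_add, Prod.snd_add] <;> ring
      map_smul' := fun c g => by
        refine Prod.ext ?_ (funext fun u => ?_) <;>
          simp only [faceJump, Pi.smul_apply, Prod.smul_fst, Prod.smul_snd, smul_eq_mul,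
            RingHom.id_apply] <;> ring }
  have ht : ∀ i (hi : (w.get i).IsFst), t ⟨(w.get i).label, IsGaussCode.label_mem i⟩ = i :=
    fun i hi => h.isFst_unique (htf _) hi (htl _)
  have hL : ∀ g i (hi : (w.get i).IsFst),
      (L g).2 ⟨(w.get i).label, IsGaussCode.label_mem i⟩ = faceJump g i := fun g i hi =>
    congrArg (faceJump g) (ht i hi)
  refine ⟨L, ?_, fun g => ⟨rfl, hL g⟩⟩
  refine finrank_le_one ⟨fun _ => 1, ?_⟩ ?_
  · refine Prod.ext ?_ (funext fun u => ?_) <;> simp [L, faceJump]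
  · rintro ⟨g, hg⟩
    refine ⟨g (Quot.mk _ (0, true)), Subtype.ext (funext fun a => ?_)⟩
    have hg' : L g = 0 := hg
    have h1 : g (Quot.mk _ (0, true)) = g (Quot.mk _ (0, false)) := by
      have : (L g).1 = 0 := by rw [hg']; rfl
      exact sub_eq_zero.mp this
    have h2 : ∀ i, (w.get i).IsFst → faceJump g i = 0 := fun i hi => by
      rw [← hL g i hi, hg']; rfl
    have := face_eq_const h h1 h2 a
    simp [this]

/-- The genus is not negative. -/
theorem IsGaussCode.numFaces_le (h : IsGaussCode w) : numFaces w ≤ (crossings w).card + 2 := by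
  obtain ⟨L, hL, -⟩ := exists_linearMap h
  have := Fintype.ofFinite (Quot (FaceRel w))
  have h1 := L.finrank_range_add_finrank_ker
  have h2 := (LinearMap.range L).finrank_le
  rw [finrank_fintype_fun_eq_card] at h1
  simp only [finrank_prod, finrank_self, finrank_fintype_fun_eq_card, Fintype.card_coe] at h2
  rw [numFaces, Nat.card_eq_fintype_card]
  omega

lemma fits_of_get {q : ℕ → Corners} {l : List Pass} {c : ℕ → ℚ × ℚ}
    (h : ∀ k (hk : k < l.length), c k = inn q l[k] ∧ out q l[k] = c (k + 1)) :
    Fits q (c 0) l (c l.length) := by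
  induction l generalizing c with
  | nil => rfl
  | cons x l ih =>
    obtain ⟨h1, h2⟩ := h 0 (by simp)
    refine ⟨h1, ?_⟩
    have := ih (c := fun k => c (k + 1)) fun k hk => h (k + 1) (by simpa using hk)
    rw [List.getElem_cons_zero] at h2
    rw [h2]
    exact this

/-- Every system of weights on the edges of a planar code comes from a colouring of the faces. -/
theorem IsGaussCode.isColourable (h : IsGaussCode w) (hp : IsPlanar w) :
    IsColourable (w.map shadow) := by
  obtain ⟨L, hL, hLg⟩ := exists_linearMap h
  have := Fintype.ofFinite (Quot (FaceRel w))
  -- With n + 2 faces and a kernel of dimension at most one, the rank is the full dimension n + 1.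
  have hsurj : Function.Surjective L := by
    rw [← LinearMap.range_eq_top]
    refine Submodule.eq_top_of_finrank_eq ?_
    have h1 := L.finrank_range_add_finrank_ker
    have h2 := (LinearMap.range L).finrank_le
    rw [finrank_fintype_fun_eq_card] at h1
    rw [IsPlanar, numFaces, Nat.card_eq_fintype_card] at hp
    simp only [finrank_prod, finrank_self, finrank_fintype_fun_eq_card, Fintype.card_coe] at h2 ⊢
    omega
  intro x z
  obtain ⟨g, hg⟩ := hsurj (z, fun u => x u)
  obtain ⟨h1, h2⟩ := hLg g
  rw [hg] at h1 h2
  choose t htl htf using fun u : crossings w => h.exists_isFst u.2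
  have ht : ∀ i (hi : (w.get i).IsFst), t ⟨(w.get i).label, IsGaussCode.label_mem i⟩ = i :=
    fun i hi => h.isFst_unique (htf _) hi (htl _)
  -- The first branch runs from west to east, so the sides of its incoming arc are the western
  -- corners and those of its outgoing arc the eastern ones. Labels that are not crossings get a
  -- dummy value.
  let q : ℕ → Corners := fun u => if hu : u ∈ crossings w then
    ⟨g (Quot.mk _ ((t ⟨u, hu⟩).castSucc, true)), g (Quot.mk _ ((t ⟨u, hu⟩).succ, true)),
      g (Quot.mk _ ((t ⟨u, hu⟩).succ, false)), g (Quot.mk _ ((t ⟨u, hu⟩).castSucc, false))⟩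
    else ⟨0, 0, 0, 0⟩
  have hq : ∀ i (hi : (w.get i).IsFst), q (w.get i).label =
      ⟨g (Quot.mk _ (i.castSucc, true)), g (Quot.mk _ (i.succ, true)),
        g (Quot.mk _ (i.succ, false)), g (Quot.mk _ (i.castSucc, false))⟩ := by
    intro i hi
    simp only [q]
    rw [dif_pos (IsGaussCode.label_mem i), ht i hi]
  let c : ℕ → ℚ × ℚ := fun k => (g (Quot.mk _ (Fin.ofNat (w.length + 1) k, true)),
    g (Quot.mk _ (Fin.ofNat (w.length + 1) k, false)))
  have hc : ∀ i : Fin w.length, Fin.ofNat (w.length + 1) i = i.castSucc ∧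
      Fin.ofNat (w.length + 1) (i + 1) = i.succ := fun i =>
    ⟨Fin.ext (Nat.mod_eq_of_lt (by omega)), Fin.ext (Nat.mod_eq_of_lt (by omega))⟩
  have hfit : Fits q (c 0) (w.map shadow) (c (w.map shadow).length) := by
    refine fits_of_get fun k hk => ?_
    rw [List.length_map] at hk
    have hck := hc ⟨k, hk⟩
    simp only at hck
    rw [List.getElem_map]
    have hwk : w[k] = w.get ⟨k, hk⟩ := rfl
    rw [hwk]
    simp only [c, hck]
    rcases h.isFst_or ⟨k, hk⟩ with hf | ⟨i, hi, hik⟩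
    · simp only [inn, out, shadow, hf, decide_true, hq _ hf, and_self]
    · have hnf : ¬ (w.get ⟨k, hk⟩).IsFst := by
        rw [hik, Letter.isFst_flip, not_not]; exact hi
      have hl : (w.get ⟨k, hk⟩).label = (w.get i).label := by rw [hik]; rfl
      simp only [inn, out, shadow, hnf, decide_false, hl, hq _ hi]
      rw [face_in_in (g := g) hik hi, face_out_in (g := g) hik hi, face_in_out (g := g) hik hi,
        face_out_out (g := g) hik hi]
      exact ⟨rfl, rfl⟩
  have hlast : c (w.map shadow).length = c 0 := by
    have e : Fin.ofNat (w.length + 1) w.length = Fin.last _ :=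
      Fin.ext (Nat.mod_eq_of_lt (by omega))
    rw [List.length_map]
    simp only [c, e]
    exact (Prod.ext (congrArg g (Quot.sound (FaceRel.base true)))
      (congrArg g (Quot.sound (FaceRel.base false)))).symm
  rw [hlast] at hfit
  refine ⟨q, c 0, hfit, ?_, ?_⟩
  · exact h1.symm
  · simp only [List.mem_map]
    rintro _ ⟨y, hy, rfl⟩
    obtain ⟨i, hi, hif⟩ := h.exists_isFst (IsGaussCode.mem_crossings.mpr ⟨y, hy, rfl⟩)
    have e := h2 i hif
    show (q y.label).jump = x y.label
    rw [← hi, hq i hif]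
    exact e.symm

end Faces

end KnotTheory

namespace KnotTheory

open Module Finset

/-! ### The circles of a state -/

/-- The sum of `x` along a curve. -/
def labelSum (x : ℕ → ZMod 2) (l : List Pass) : ZMod 2 := sum₁ (fun y => x y.label) l

lemma labelSum_append (x : ℕ → ZMod 2) (A B : List Pass) :
    labelSum x (A ++ B) = labelSum x A + labelSum x B := sum₁_append _ _ _

lemma labelSum_eq {V : Finset ℕ} (x : ℕ → ZMod 2) {l : List Pass} (h : ∀ y ∈ l, y.label ∈ V) :
    labelSum x l = ∑ v ∈ V, parity v l * x v := by
  induction l with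
  | nil => simp [labelSum, parity, sum₁]
  | cons y l ih =>
    rw [labelSum, sum₁, ← labelSum, ih fun z hz => h z (by simp [hz])]
    simp only [parity_cons, add_mul, sum_add_distrib, ite_mul, one_mul, zero_mul]
    rw [sum_ite_eq, if_pos (h y (by simp))]

lemma IsCurve.interlacement_eq_parity {a b : Pass} {P Q R : List Pass}
    (h : IsCurve (P ++ a :: (Q ++ b :: R))) (hm : Match a b) (v : ℕ) :
    interlacement (P ++ a :: (Q ++ b :: R)) a.label v = parity v Q := by
  rw [← h.interlacement_rotate]
  have hr : a :: (Q ++ b :: R) ++ P = a :: (Q ++ b :: (R ++ P)) := by simp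
  rw [hr]
  have h' : IsCurve (a :: (Q ++ b :: (R ++ P))) := by
    rw [← hr]; exact h.of_perm (List.perm_append_comm.map _)
  have hne := h'.label_ne hm
  by_cases hv : v = a.label
  · rw [hv, interlacement_self, KnotTheory.parity_eq_zero fun y hy => hne y (by simp [hy])]
  · rw [interlacement_of_ne (Ne.symm hv), pairParity_self_left hm.1 hv hne]

lemma exists_decomp {α : Type*} {l : List α} {p q : ℕ} (hpq : p < q) (hq : q < l.length) :
    ∃ Q R, l = l.take p ++ l[p] :: (Q ++ l[q] :: R) ∧ l.take q = l.take (p + 1) ++ Q := by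
  refine ⟨(l.take q).drop (p + 1), l.drop (q + 1), ?_, ?_⟩
  · have h1 : l.take (p + 1) = l.take p ++ [l[p]] := by simp
    have h2 : l.take (p + 1) ++ (l.take q).drop (p + 1) = l.take q := by
      have := List.take_append_drop (p + 1) (l.take q)
      rwa [List.take_take, min_eq_left (by omega)] at this
    have h3 : l.drop q = l[q] :: l.drop (q + 1) := List.drop_eq_getElem_cons hq
    calc l = l.take q ++ l.drop q := (List.take_append_drop _ _).symm
      _ = l.take p ++ [l[p]] ++ (l.take q).drop (p + 1) ++ l.drop q := by rw [← h1, h2]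
      _ = _ := by rw [h3, List.append_assoc, List.append_assoc]; rfl
  · have := List.take_append_drop (p + 1) (l.take q)
    rw [List.take_take, min_eq_left (by omega)] at this
    exact this.symm

section Circles

variable {w : List Letter} {S : Finset ℕ}

/-- The crossings that are smoothed against the orientation. -/
def unoriented (w : List Letter) (S : Finset ℕ) (s : ℕ → ℤ) : Finset ℕ :=
  symmDiff S ((crossings w).filter fun i => s i = 1)

lemma mem_unoriented {s : ℕ → ℤ} (hs : ∀ x ∈ w, s x.label = x.sign) (i : Fin w.length) :
    (w.get i).label ∈ unoriented w S s ↔ ¬ ((w.get i).label ∈ S ↔ (w.get i).sign = 1) := by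
  have h1 : s (w.get i).label = 1 ↔ (w.get i).sign = 1 := by
    rw [hs _ (List.get_mem w i)]
    exact ⟨fun h => Units.ext h, fun h => by rw [h]; rfl⟩
  rw [unoriented, mem_symmDiff, mem_filter, h1]
  have := IsGaussCode.label_mem i
  tauto

/-- The equation at a crossing of the linear system of a state. -/
lemma IsGaussCode.sum_addDiag (h : IsGaussCode w) {i j : Fin w.length}
    (hij : w.get j = (w.get i).flip) (hlt : i < j) (x : ℕ → ZMod 2) (D : Finset ℕ) :
    ∑ v ∈ crossings w, addDiag (interlacement (w.map shadow)) D (w.get i).label v * x v =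
      labelSum x ((w.map shadow).take (i + 1)) + labelSum x ((w.map shadow).take j) +
        if (w.get i).label ∈ D then x (w.get i).label else 0 := by
  have hc := h.isCurve
  obtain ⟨Q, R, h1, h2⟩ := exists_decomp (l := w.map shadow) (p := i) (q := j) hlt (by simp)
  have e1 : (w.map shadow)[(i : ℕ)]'(by simp) = shadow (w.get i) := by simp
  have e2 : (w.map shadow)[(j : ℕ)]'(by simp) = shadow (w.get i).flip := by rw [← hij]; simp
  rw [e1, e2] at h1
  have hQ : ∀ y ∈ Q, y.label ∈ crossings w := by
    intro y hy
    rw [← IsGaussCode.labels_shadow, mem_labels]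
    exact ⟨y, by rw [h1]; simp [hy], rfl⟩
  have hI : ∀ v, interlacement (w.map shadow) (w.get i).label v = parity v Q := by
    intro v
    rw [h1] at hc ⊢
    exact hc.interlacement_eq_parity (match_shadow_flip _) v
  have hD : ∀ v, addDiag (interlacement (w.map shadow)) D (w.get i).label v * x v =
      parity v Q * x v + if v = (w.get i).label then
        (if (w.get i).label ∈ D then x (w.get i).label else 0) else 0 := by
    intro v
    rw [addDiag, hI]
    by_cases hv : v = (w.get i).label
    · rw [if_pos hv, hv]
      by_cases hd : (w.get i).label ∈ D
      · rw [if_pos ⟨rfl, hd⟩, if_pos hd]; ring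
      · rw [if_neg fun h => hd h.2, if_neg hd]; ring
    · rw [if_neg hv, if_neg fun h => hv h.1.symm]; ring
  rw [sum_congr rfl fun v _ => hD v, sum_add_distrib, ← labelSum_eq x hQ, sum_ite_eq',
    if_pos (IsGaussCode.label_mem i), h2, labelSum_append, ← add_assoc, two_self, zero_add]

lemma labelSum_take_succ (x : ℕ → ZMod 2) (i : Fin w.length) :
    labelSum x ((w.map shadow).take (i + 1)) =
      labelSum x ((w.map shadow).take i) + x (w.get i).label := by
  rw [List.take_add_one, labelSum_append]
  congr 1
  simp [labelSum, sum₁, shadow]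

lemma IsGaussCode.exists_pair (h : IsGaussCode w) {u : ℕ} (hu : u ∈ crossings w) :
    ∃ i j : Fin w.length, i < j ∧ w.get j = (w.get i).flip ∧ (w.get i).label = u := by
  obtain ⟨i, hi, -⟩ := h.exists_isFst hu
  obtain ⟨j, hj⟩ := h.exists_flip i
  rcases lt_trichotomy i j with hlt | rfl | hlt
  · exact ⟨i, j, hlt, hj, hi⟩
  · have : (w.get i).isOver = !(w.get i).isOver := congrArg Letter.isOver hj
    simp at this
  · exact ⟨j, i, hlt, by rw [hj, Letter.flip_flip], by rw [hj]; exact hi⟩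

/-- The solutions of the linear system of a state are constant along the circles of the state. -/
lemma IsGaussCode.labelSum_eq_of_stateRel (h : IsGaussCode w) {s : ℕ → ℤ}
    (hs : ∀ x ∈ w, s x.label = x.sign) {x : ℕ → ZMod 2}
    (hx : x ∈ solSpace (crossings w)
      (addDiag (interlacement (w.map shadow)) (unoriented w S s)))
    {a b : Fin (w.length + 1)} (hab : StateRel w S a b) :
    labelSum x ((w.map shadow).take a) = labelSum x ((w.map shadow).take b) := by
  rw [mem_solSpace] at hx
  have core : ∀ i j : Fin w.length, w.get j = (w.get i).flip → i < j →
      labelSum x ((w.map shadow).take (i + 1)) + labelSum x ((w.map shadow).take j) +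
        (if (w.get i).label ∈ unoriented w S s then x (w.get i).label else 0) = 0 := by
    intro i j hij hlt
    rw [← h.sum_addDiag hij hlt]
    exact hx.2 _ (IsGaussCode.label_mem i)
  have both : ∀ i j : Fin w.length, w.get j = (w.get i).flip →
      ((w.get i).label ∉ unoriented w S s →
        labelSum x ((w.map shadow).take i) = labelSum x ((w.map shadow).take (j + 1))) ∧
      ((w.get i).label ∈ unoriented w S s →
        labelSum x ((w.map shadow).take i) = labelSum x ((w.map shadow).take j) ∧
        labelSum x ((w.map shadow).take (i + 1)) = labelSum x ((w.map shadow).take (j + 1))) := by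
    intro i j hij
    have hl : (w.get j).label = (w.get i).label := by rw [hij]; rfl
    rw [labelSum_take_succ x i, labelSum_take_succ x j, hl]
    have hc : ∀ a b c : ZMod 2, a + c + b = 0 → a = b + c := by decide
    have hc' : ∀ a b c : ZMod 2, a + c + b + c = 0 → a = b ∧ a + c = b + c := by decide
    rcases lt_trichotomy i j with hlt | rfl | hlt
    · have := core i j hij hlt
      rw [labelSum_take_succ] at this
      constructor
      · intro hu
        rw [if_neg hu, add_zero] at this
        exact hc _ _ _ this
      · intro hu
        rw [if_pos hu] at this
        exact hc' _ _ _ this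
    · have : (w.get i).isOver = !(w.get i).isOver := congrArg Letter.isOver hij
      simp at this
    · have := core j i (by rw [hij, Letter.flip_flip]) hlt
      rw [labelSum_take_succ, hl] at this
      constructor
      · intro hu
        rw [if_neg hu, add_zero] at this
        refine hc _ _ _ ?_
        rw [← this]; ring
      · intro hu
        rw [if_pos hu] at this
        refine hc' _ _ _ ?_
        rw [← this]; ring
  cases hab with
  | base =>
    rw [Fin.val_zero, Fin.val_last, List.take_zero, ← List.length_map (f := shadow) (as := w),
      List.take_length, labelSum_eq (V := crossings w) x (l := w.map shadow)]
    · rw [sum_eq_zero]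
      · rfl
      · intro v _
        rw [h.isCurve.parity_eq_zero, zero_mul]
    · intro y hy
      rw [← IsGaussCode.labels_shadow, mem_labels]
      exact ⟨y, hy, rfl⟩
  | oriented i j hij hi =>
    exact (both i j hij).1 fun hm => (mem_unoriented hs i).mp hm hi
  | in_in i j hij hi => exact ((both i j hij).2 ((mem_unoriented hs i).mpr hi)).1
  | out_out i j hij hi => exact ((both i j hij).2 ((mem_unoriented hs i).mpr hi)).2

/-- The number of circles of a state in terms of the interlacement graph. -/
theorem IsGaussCode.numCircles_eq (h : IsGaussCode w) {s : ℕ → ℤ}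
    (hs : ∀ x ∈ w, s x.label = x.sign) (S : Finset ℕ) :
    numCircles w S = nullity (crossings w)
      (addDiag (interlacement (w.map shadow)) (unoriented w S s)) + 1 := by
  have := Fintype.ofFinite (Quot (StateRel w S))
  choose t htl htf using fun u : crossings w => h.exists_isFst u.2
  have ht : ∀ i (hi : (w.get i).IsFst), t ⟨(w.get i).label, IsGaussCode.label_mem i⟩ = i :=
    fun i hi => h.isFst_unique (htf _) hi (htl _)
  -- `J f` records how f changes across each crossing. Its kernel consists of the constants and its
  -- range is the solution space, so the number of circles is the nullity plus one.
  let J : (Quot (StateRel w S) → ZMod 2) →ₗ[ZMod 2] (ℕ → ZMod 2) :=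
    { toFun := fun f u => if hu : u ∈ crossings w then
        f (Quot.mk _ (t ⟨u, hu⟩).succ) + f (Quot.mk _ (t ⟨u, hu⟩).castSucc) else 0
      map_add' := fun f g => by
        ext u
        simp only [Pi.add_apply]
        split_ifs <;> ring
      map_smul' := fun c f => by
        ext u
        simp only [Pi.smul_apply, smul_eq_mul, RingHom.id_apply]
        split_ifs <;> ring }
  have hflip : ∀ i j : Fin w.length, w.get j = (w.get i).flip →
      (((w.get j).label ∈ S ↔ (w.get j).sign = 1) ↔ ((w.get i).label ∈ S ↔ (w.get i).sign = 1)) := by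
    intro i j hij
    rw [hij]; rfl
  have hJ : ∀ f (i : Fin w.length), f (Quot.mk _ i.succ) =
      f (Quot.mk (StateRel w S) i.castSucc) + J f (w.get i).label := by
    have h2 : ∀ a b c : ZMod 2, a + b = c → a = b + c := by decide
    intro f i
    refine h2 _ _ _ ?_
    have hm := IsGaussCode.label_mem i
    rcases h.isFst_or i with hi | ⟨j, hj, hij⟩
    · simp only [J, LinearMap.coe_mk, AddHom.coe_mk]
      rw [dif_pos hm, ht i hi]
    · have hl : (w.get i).label = (w.get j).label := by rw [hij]; rfl
      rw [hl]
      simp only [J, LinearMap.coe_mk, AddHom.coe_mk]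
      rw [dif_pos (IsGaussCode.label_mem j), ht j hj]
      by_cases ho : (w.get j).label ∈ S ↔ (w.get j).sign = 1
      · rw [congrArg f (Quot.sound (StateRel.oriented j i hij ho)),
          congrArg f (Quot.sound (StateRel.oriented i j (by rw [hij, Letter.flip_flip])
            ((hflip j i hij).mpr ho))), add_comm]
      · rw [congrArg f (Quot.sound (StateRel.in_in j i hij ho)),
          congrArg f (Quot.sound (StateRel.out_out j i hij ho))]
  have hf : ∀ f (k : Fin (w.length + 1)), f (Quot.mk (StateRel w S) k) =
      f (Quot.mk _ 0) + labelSum (J f) ((w.map shadow).take k) := by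
    intro f k
    induction k using Fin.induction with
    | zero => simp [labelSum, sum₁]
    | succ k ih =>
      rw [hJ f k, ih, Fin.val_succ, labelSum_take_succ]
      simp only [Fin.val_castSucc]
      ring
  have hker : finrank (ZMod 2) (LinearMap.ker J) = 1 := by
    refine finrank_eq_one ⟨fun _ => 1, ?_⟩ ?_ ?_
    · ext u
      simp only [J, LinearMap.coe_mk, AddHom.coe_mk]
      split_ifs <;> rfl
    · intro h0
      have := congrFun (congrArg Subtype.val h0) (Quot.mk _ 0)
      simp at this
    · rintro ⟨f, hf0⟩
      refine ⟨f (Quot.mk _ 0), Subtype.ext (funext fun a => ?_)⟩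
      obtain ⟨k⟩ := a
      have hf0' : J f = 0 := hf0
      have := hf f k
      rw [hf0'] at this
      simpa [labelSum] using this.symm
  have hrange : LinearMap.range J = solSpace (crossings w)
      (addDiag (interlacement (w.map shadow)) (unoriented w S s)) := by
    ext x
    constructor
    · rintro ⟨f, rfl⟩
      rw [mem_solSpace]
      refine ⟨fun u hu => ?_, fun u hu => ?_⟩
      · simp only [J, LinearMap.coe_mk, AddHom.coe_mk]
        rw [dif_neg hu]
      · obtain ⟨i, j, hlt, hij, rfl⟩ := h.exists_pair hu
        rw [h.sum_addDiag hij hlt]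
        have e1 := hf f i.succ
        have e2 := hf f j.castSucc
        have e3 := hJ f i
        simp only [Fin.val_succ, Fin.val_castSucc] at e1 e2
        have hc : ∀ a b c d e : ZMod 2, a = c + d → b = c + e → a = b → d + e + 0 = 0 := by decide
        have hc' : ∀ a b c d e f g : ZMod 2, a = c + d → b = c + e → a = g + f → g = b →
          d + e + f = 0 := by decide
        by_cases ho : (w.get i).label ∈ S ↔ (w.get i).sign = 1
        · rw [if_neg fun hm => (mem_unoriented hs i).mp hm ho]
          exact hc _ _ _ _ _ e1 e2 (congrArg f (Quot.sound (StateRel.oriented j i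
            (by rw [hij, Letter.flip_flip]) ((hflip i j hij).mpr ho)))).symm
        · rw [if_pos ((mem_unoriented hs i).mpr ho)]
          exact hc' _ _ _ _ _ _ _ e1 e2 e3 (congrArg f (Quot.sound (StateRel.in_in i j hij ho)))
    -- Conversely, the partial sums of x along the knot define a function on the arcs, and the
    -- equations of the system are what makes it constant on circles.
    · intro hx
      let f : Quot (StateRel w S) → ZMod 2 :=
        Quot.lift (fun k => labelSum x ((w.map shadow).take k)) fun a b hab =>
          h.labelSum_eq_of_stateRel hs hx hab
      refine ⟨f, funext fun u => ?_⟩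
      by_cases hu : u ∈ crossings w
      · obtain ⟨i, j, -, -, rfl⟩ := h.exists_pair hu
        have e3 := hJ f i
        have e4 : f (Quot.mk _ i.succ) = f (Quot.mk _ i.castSucc) + x (w.get i).label :=
          labelSum_take_succ x i
        rw [e4] at e3
        exact (add_left_cancel e3).symm
      · simp only [J, LinearMap.coe_mk, AddHom.coe_mk]
        rw [dif_neg hu, (mem_solSpace.mp hx).1 u hu]
  have := J.finrank_range_add_finrank_ker
  rw [hker, hrange, finrank_fintype_fun_eq_card, ← Nat.card_eq_fintype_card] at this
  exact this.symm

end Circles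

end KnotTheory

namespace KnotTheory

open Finset

/-! ### Signed interlacement -/

/-- The sign of the branch of a passage through the crossing `u`. -/
def branchSign (u : ℕ) (x : Pass) : ℤ := if x.label = u then sg x.isFst else 0

/-- The sum of the signs of the branches at `u`. -/
def height (u : ℕ) (l : List Pass) : ℤ := sum₁ (branchSign u) l

/-- The number of passages through `u`. -/
def passCount (u : ℕ) (l : List Pass) : ℤ := sum₁ (fun x => if x.label = u then 1 else 0) l

/-- The number of pairs of passages through `u` and `v`, in this order. -/
def pairCount (u v : ℕ) (l : List Pass) : ℤ :=
  sum₂ (fun x y => (if x.label = u then 1 else 0) * if y.label = v then 1 else 0) l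

/-- The signed interlacement of the crossings of a curve. -/
def signedInterlacement (l : List Pass) (u v : ℕ) : ℤ :=
  if u = v then 0 else sum₂ (fun x y => branchSign u x * branchSign v y) l

lemma height_append (u : ℕ) (A B : List Pass) : height u (A ++ B) = height u A + height u B :=
  sum₁_append _ _ _

lemma passCount_append (u : ℕ) (A B : List Pass) :
    passCount u (A ++ B) = passCount u A + passCount u B := sum₁_append _ _ _

lemma height_cons_of_ne {u : ℕ} {x : Pass} (h : x.label ≠ u) (l : List Pass) :
    height u (x :: l) = height u l := by
  rw [height, sum₁, branchSign, if_neg h, zero_add]; rfl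

lemma height_cons_self (x : Pass) (l : List Pass) :
    height x.label (x :: l) = sg x.isFst + height x.label l := by
  rw [height, sum₁, branchSign, if_pos rfl]; rfl

lemma passCount_cons_self (x : Pass) (l : List Pass) :
    passCount x.label (x :: l) = 1 + passCount x.label l := by
  rw [passCount, sum₁, if_pos rfl]; rfl

lemma height_eq_zero {u : ℕ} {l : List Pass} (h : ∀ x ∈ l, x.label ≠ u) : height u l = 0 :=
  sum₁_eq_zero fun x hx => if_neg (h x hx)

lemma passCount_eq_zero {u : ℕ} {l : List Pass} (h : ∀ x ∈ l, x.label ≠ u) : passCount u l = 0 :=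
  sum₁_eq_zero fun x hx => if_neg (h x hx)

lemma IsCurve.exists_rotation {l : List Pass} (h : IsCurve l) {u : ℕ} (hu : u ∈ labels l) :
    ∃ i i' A B, Match i i' ∧ i.label = u ∧ l ~r i :: (A ++ i' :: B) := by
  obtain ⟨x, hx, rfl⟩ := mem_labels.mp hu
  obtain ⟨P, Q, rfl⟩ := List.append_of_mem hx
  have hr : P ++ x :: Q ~r x :: (Q ++ P) := by
    rw [← List.cons_append]
    exact List.isRotated_append
  obtain ⟨y, hy, hm⟩ := h.exists_match x hx
  have hy' := (hr.perm.mem_iff).mp hy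
  rcases List.mem_cons.mp hy' with rfl | hy'
  · exact absurd rfl hm.2
  obtain ⟨A, B, hAB⟩ := List.append_of_mem hy'
  exact ⟨x, y, A, B, hm, rfl, hAB ▸ hr⟩

lemma sum₁_perm {α R : Type*} [CommRing R] (f : α → R) {l l' : List α} (h : l.Perm l') :
    sum₁ f l = sum₁ f l' := by
  induction h with
  | nil => rfl
  | cons x _ ih => rw [sum₁, sum₁, ih]
  | swap x y l => simp only [sum₁]; ring
  | trans _ _ ih1 ih2 => exact ih1.trans ih2

lemma IsCurve.height_eq_zero {l : List Pass} (h : IsCurve l) (u : ℕ) : height u l = 0 := by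
  by_cases hu : u ∈ labels l
  · obtain ⟨i, i', A, B, hm, rfl, hr⟩ := h.exists_rotation hu
    have h' := h.of_perm (hr.perm.map _)
    have hne := h'.label_ne hm
    rw [height, sum₁_perm _ hr.perm, ← height, height_cons_self, height_append, ← hm.1,
      height_cons_self, KnotTheory.height_eq_zero fun x hx => hm.1 ▸ hne x (by simp [hx]),
      KnotTheory.height_eq_zero fun x hx => hm.1 ▸ hne x (by simp [hx]), hm.sg]
    ring
  · exact KnotTheory.height_eq_zero fun x hx hxu => hu (mem_labels.mpr ⟨x, hx, hxu⟩)

lemma signedInterlacement_self (l : List Pass) (u : ℕ) : signedInterlacement l u u = 0 := if_pos rfl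

lemma signedInterlacement_append {A B : List Pass} {u v : ℕ} (h : u ≠ v) :
    signedInterlacement (A ++ B) u v = signedInterlacement A u v + height u A * height v B +
      signedInterlacement B u v := by
  simp only [signedInterlacement, if_neg h]
  rw [sum₂_append]
  simp only [sum₁_mul_left, sum₁_mul_right]
  rfl

lemma signedInterlacement_cons {x : Pass} {B : List Pass} {u v : ℕ} (h : u ≠ v) :
    signedInterlacement (x :: B) u v = branchSign u x * height v B + signedInterlacement B u v := by
  simp only [signedInterlacement, if_neg h, sum₂, sum₁_mul_left]
  rfl

lemma branchSign_self (x : Pass) : branchSign x.label x = sg x.isFst := if_pos rfl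

lemma branchSign_of_ne {u : ℕ} {x : Pass} (h : x.label ≠ u) : branchSign u x = 0 := if_neg h

lemma IsCurve.signedInterlacement_symm {l : List Pass} (h : IsCurve l) (u v : ℕ) :
    signedInterlacement l v u = -signedInterlacement l u v := by
  by_cases huv : u = v
  · rw [huv, signedInterlacement_self, neg_zero]
  · have := sum₂_symm_mul (branchSign u) (branchSign v) l
    rw [sum₂_add, sum₁_eq_zero (f := fun x => branchSign u x * branchSign v x), ← height, ← height,
      h.height_eq_zero, zero_mul, sub_zero] at this
    · have e : sum₂ (fun x y => branchSign v x * branchSign u y) l =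
          sum₂ (fun x y => branchSign u y * branchSign v x) l :=
        sum₂_congr fun x _ y _ => mul_comm _ _
      simp only [signedInterlacement, if_neg huv, if_neg (Ne.symm huv)]
      linarith
    · intro x _
      by_cases hx : x.label = u
      · rw [branchSign_of_ne (u := v) (hx ▸ huv), mul_zero]
      · rw [branchSign_of_ne hx, zero_mul]

lemma IsCurve.signedInterlacement_rotate {l l' : List Pass} (h : IsCurve l) (hr : l ~r l') :
    signedInterlacement l' = signedInterlacement l := by
  obtain ⟨n, rfl⟩ := hr
  rw [List.rotate_eq_drop_append_take_mod]
  set A := l.take (n % l.length)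
  set B := l.drop (n % l.length)
  have hl : A ++ B = l := List.take_append_drop _ _
  rw [← hl] at h ⊢
  ext u v
  by_cases huv : u = v
  · rw [huv, signedInterlacement_self, signedInterlacement_self]
  · have h1 := h.height_eq_zero u
    have h2 := h.height_eq_zero v
    rw [height_append] at h1 h2
    rw [signedInterlacement_append huv, signedInterlacement_append huv]
    have h3 : height u B = -height u A := by linarith
    have h4 : height v B = -height v A := by linarith
    rw [h3, h4]; ring

lemma signedInterlacement_eq_zero {l : List Pass} {u v : ℕ} (h : ∀ x ∈ l, x.label ≠ u) :
    signedInterlacement l u v = 0 := by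
  rw [signedInterlacement]
  split_ifs
  · rfl
  · exact sum₂_eq_zero fun x hx y _ => by rw [branchSign_of_ne (h x hx), zero_mul]

/-- The branch signs of i and i' are opposite, so passages after i' cancel and only those on the
loop A are counted. -/
lemma IsCurve.signedInterlacement_eq_height {i i' : Pass} {A B : List Pass}
    (h : IsCurve (i :: (A ++ i' :: B))) (hm : Match i i') (v : ℕ) :
    signedInterlacement (i :: (A ++ i' :: B)) i.label v = sg i.isFst * height v A := by
  have hne := h.label_ne hm
  by_cases hv : v = i.label
  · rw [hv, signedInterlacement_self, KnotTheory.height_eq_zero fun x hx => hne x (by simp [hx]),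
      mul_zero]
  · have e : branchSign i.label i' = -sg i.isFst := by rw [← hm.1, branchSign_self, hm.sg]
    rw [signedInterlacement_cons (Ne.symm hv), signedInterlacement_append (Ne.symm hv),
      signedInterlacement_cons (Ne.symm hv), branchSign_self, e, height_append,
      height_cons_of_ne (hm.1 ▸ Ne.symm hv), signedInterlacement_eq_zero fun x hx => hne x (by simp [hx]),
      signedInterlacement_eq_zero fun x hx => hne x (by simp [hx]),
      KnotTheory.height_eq_zero (l := A) fun x hx => hne x (by simp [hx])]
    ring

lemma IsCurve.signedInterlacement_remove {i i' : Pass} {A B : List Pass}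
    (hm : Match i i') {u v : ℕ} (hu : u ≠ i.label) (hv : v ≠ i.label) :
    signedInterlacement (i :: (A ++ i' :: B)) u v = signedInterlacement (A ++ B) u v := by
  by_cases huv : u = v
  · rw [huv, signedInterlacement_self, signedInterlacement_self]
  · rw [signedInterlacement_cons huv, signedInterlacement_append huv, signedInterlacement_cons huv,
      branchSign_of_ne hu.symm, branchSign_of_ne (hm.1 ▸ hu.symm), signedInterlacement_append huv,
      height_cons_of_ne (hm.1 ▸ hv.symm)]
    ring

/-- A crossing of a curve consisting of two pieces either joins the two pieces, or it is a crossing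
of one of the pieces. -/
lemma IsCurve.mixed_or {A B : List Pass} (h : IsCurve (A ++ B)) (hf : ∀ x ∈ A ++ B, x.fwd = true)
    (u : ℕ) :
    (passCount u A = 1 ∧ passCount u B = 1 ∧ height u A * height u A = 1 ∧
      ∀ a ∈ A, ∀ c ∈ B, a.label = u → c.label = u →
        eps a c = height u A ∧ branchSign u a = height u A ∧ branchSign u c = -height u A) ∨
    (height u A = 0 ∧ height u B = 0 ∧ ∀ a ∈ A, ∀ c ∈ B, a.label = u → c.label ≠ u) := by
  by_cases hex : ∃ a ∈ A, ∃ c ∈ B, a.label = u ∧ c.label = u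
  · left
    obtain ⟨a, ha, c, hc, rfl, hca⟩ := hex
    obtain ⟨A₁, A₂, rfl⟩ := List.append_of_mem ha
    obtain ⟨B₁, B₂, rfl⟩ := List.append_of_mem hc
    have hm : Match a c := by
      refine ⟨hca, fun hfst => ?_⟩
      have hnd := h.nodup
      simp only [BranchNodup, List.map_append, List.map_cons] at hnd
      have := List.disjoint_of_nodup_append hnd (a := a.branch) (by simp)
      exact this (by rw [show a.branch = c.branch from Prod.ext hca.symm hfst.symm]; simp)
    have hr : A₁ ++ a :: A₂ ++ (B₁ ++ c :: B₂) ~r a :: ((A₂ ++ B₁) ++ c :: (B₂ ++ A₁)) := by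
      have := List.isRotated_append (l := A₁) (l' := a :: A₂ ++ (B₁ ++ c :: B₂))
      simpa using this
    have hne := (h.of_perm (hr.perm.map _)).label_ne hm
    simp only [List.mem_append] at hne
    have e1 : height a.label (A₁ ++ a :: A₂) = sg a.isFst := by
      rw [height_append, height_cons_self, KnotTheory.height_eq_zero fun x hx => hne x (by tauto),
        KnotTheory.height_eq_zero fun x hx => hne x (by tauto)]
      ring
    have e2 : passCount a.label (A₁ ++ a :: A₂) = 1 := by
      rw [passCount_append, passCount_cons_self, passCount_eq_zero fun x hx => hne x (by tauto),
        passCount_eq_zero fun x hx => hne x (by tauto)]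
      ring
    have e3 : passCount a.label (B₁ ++ c :: B₂) = 1 := by
      rw [← hca, passCount_append, passCount_cons_self,
        passCount_eq_zero fun x hx => hca ▸ hne x (by tauto),
        passCount_eq_zero fun x hx => hca ▸ hne x (by tauto)]
      ring
    refine ⟨e2, e3, by rw [e1, sg_mul_self], ?_⟩
    rw [e1]
    intro a' ha' c' hc' hla hlc
    have ha'' : a' = a := by
      simp only [List.mem_append, List.mem_cons] at ha'
      rcases ha' with ha' | rfl | ha'
      · exact absurd hla (hne _ (by tauto))
      · rfl
      · exact absurd hla (hne _ (by tauto))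
    have hc'' : c' = c := by
      simp only [List.mem_append, List.mem_cons] at hc'
      rcases hc' with hc' | rfl | hc'
      · exact absurd hlc (hne _ (by tauto))
      · rfl
      · exact absurd hlc (hne _ (by tauto))
    subst ha'' hc''
    refine ⟨?_, branchSign_self _, ?_⟩
    · rw [hm.eps_eq, hf a' (by simp), hf c' (by simp)]
      simp [sg]
    · rw [← hca, branchSign_self, hm.sg]
  · right
    push Not at hex
    have h0 := h.height_eq_zero u
    rw [height_append] at h0
    refine (fun h1 => ⟨h1, by omega, hex⟩) ?_
    by_cases hA : ∃ a ∈ A, a.label = u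
    · obtain ⟨a, ha, hau⟩ := hA
      have : height u B = 0 := KnotTheory.height_eq_zero fun c hc => hex a ha c hc hau
      omega
    · push Not at hA
      exact KnotTheory.height_eq_zero hA

lemma sum₁_eq_sum {R : Type*} [CommRing R] {V : Finset ℕ} {l : List Pass} (f : Pass → R)
    (h : ∀ x ∈ l, x.label ∈ V) :
    sum₁ f l = ∑ u ∈ V, sum₁ (fun x => (if x.label = u then 1 else 0) * f x) l := by
  induction l with
  | nil => simp [sum₁]
  | cons x l ih =>
    simp only [sum₁]
    rw [ih fun y hy => h y (by simp [hy]), sum_add_distrib]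
    simp only [ite_mul, one_mul, zero_mul]
    rw [sum_ite_eq, if_pos (h x (by simp))]

lemma sum₂_eq_sum {R : Type*} [CommRing R] {V : Finset ℕ} {l : List Pass} (f : Pass → Pass → R)
    (h : ∀ x ∈ l, x.label ∈ V) :
    sum₂ f l = ∑ u ∈ V, ∑ v ∈ V, sum₂ (fun x y => (if x.label = u then 1 else 0) *
      (if y.label = v then 1 else 0) * f x y) l := by
  induction l with
  | nil => simp [sum₂]
  | cons x l ih =>
    simp only [sum₂]
    rw [ih fun y hy => h y (by simp [hy])]
    simp only [sum_add_distrib, mul_assoc]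
    congr 1
    simp only [sum₁_mul_left, ← mul_sum]
    simp only [ite_mul, one_mul, zero_mul]
    rw [sum_ite_eq, if_pos (h x (by simp)), sum₁_eq_sum _ fun y hy => h y (by simp [hy])]
    simp only [ite_mul, one_mul, zero_mul]

/-! ### Sums over the crossings that join two arcs of a closed curve. -/

section Split

variable {A B : List Pass} {V : Finset ℕ}

lemma IsCurve.ite_mul_eps (h : IsCurve (A ++ B)) (hf : ∀ x ∈ A ++ B, x.fwd = true) (u : ℕ)
    {a c : Pass} (ha : a ∈ A) (hc : c ∈ B) : (if a.label = u then 1 else 0) * eps a c =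
      height u A * ((if a.label = u then 1 else 0) * if c.label = u then 1 else 0) := by
  by_cases hau : a.label = u
  · rw [if_pos hau, one_mul, one_mul]
    by_cases hcu : c.label = u
    · rw [if_pos hcu, mul_one]
      rcases h.mixed_or hf u with ⟨-, -, -, hm⟩ | ⟨-, -, hm⟩
      · exact (hm a ha c hc hau hcu).1
      · exact absurd hcu (hm a ha c hc hau)
    · rw [if_neg hcu, mul_zero]
      exact eps_of_label_ne (hau ▸ Ne.symm hcu)
  · rw [if_neg hau]; ring

lemma IsCurve.ite_mul_sum_eps (h : IsCurve (A ++ B)) (hf : ∀ x ∈ A ++ B, x.fwd = true) (u : ℕ)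
    {a : Pass} (ha : a ∈ A) : (if a.label = u then 1 else 0) * sum₁ (eps a) B =
      (if a.label = u then 1 else 0) * (height u A * passCount u B) := by
  rw [← sum₁_mul_left, sum₁_congr fun c hc => h.ite_mul_eps hf u ha hc]
  simp only [sum₁_mul_left]
  rw [passCount]; ring

lemma IsCurve.height_mul_passCount (h : IsCurve (A ++ B)) (hf : ∀ x ∈ A ++ B, x.fwd = true) (u : ℕ) :
    height u A * passCount u A = height u A ∧ height u A * passCount u B = height u A := by
  rcases h.mixed_or hf u with ⟨h1, h2, -⟩ | ⟨h1, -⟩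
  · rw [h1, h2]; simp
  · rw [h1]; simp

lemma IsCurve.cross_eq_sum (h : IsCurve (A ++ B)) (hf : ∀ x ∈ A ++ B, x.fwd = true)
    (hV : ∀ x ∈ A ++ B, x.label ∈ V) : cross A B = ∑ u ∈ V, height u A := by
  rw [cross, sum₁_eq_sum _ fun x hx => hV x (by simp [hx])]
  refine sum_congr rfl fun u _ => ?_
  obtain ⟨h1, h2⟩ := h.height_mul_passCount hf u
  rw [sum₁_congr fun a ha => h.ite_mul_sum_eps hf u ha, sum₁_mul_right, ← passCount, h2, mul_comm, h1]

lemma IsCurve.crossNum_eq_sum (h : IsCurve (A ++ B)) (hf : ∀ x ∈ A ++ B, x.fwd = true)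
    (hV : ∀ x ∈ A ++ B, x.label ∈ V) : crossNum A B = ∑ u ∈ V, height u A ^ 2 := by
  rw [crossNum, sum₁_eq_sum _ fun x hx => hV x (by simp [hx])]
  refine sum_congr rfl fun u _ => ?_
  obtain ⟨h1, h2⟩ := h.height_mul_passCount hf u
  have e : ∀ a ∈ A, (if a.label = u then 1 else 0) * (sum₁ (eps a) B * sum₁ (eps a) B) =
      (if a.label = u then 1 else 0) * (height u A * height u A) := by
    intro a ha
    have := h.ite_mul_sum_eps hf u ha
    rw [h2] at this
    split_ifs at this ⊢
    · rw [one_mul, one_mul] at this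
      rw [this]
    · ring
  rw [sum₁_congr e, sum₁_mul_right, ← passCount]
  linear_combination height u A * h1

lemma pairCount_nonneg (u v : ℕ) (l : List Pass) : 0 ≤ pairCount u v l := by
  have h1 : ∀ (f : Pass → ℤ) (l : List Pass), (∀ x, 0 ≤ f x) → 0 ≤ sum₁ f l := by
    intro f l hf
    induction l with
    | nil => exact le_rfl
    | cons x l ih => exact add_nonneg (hf x) ih
  induction l with
  | nil => exact le_rfl
  | cons x l ih =>
    refine add_nonneg (h1 _ _ fun y => ?_) ih
    dsimp only
    split_ifs <;> simp

lemma pairCount_add_swap {u v : ℕ} (l : List Pass) : pairCount u v l + pairCount v u l =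
    passCount u l * passCount v l - if u = v then passCount u l else 0 := by
  have := sum₂_symm_mul (R := ℤ) (fun x : Pass => if x.label = u then 1 else 0)
    (fun x => if x.label = v then 1 else 0) l
  have e : pairCount v u l = sum₂ (R := ℤ) (fun x y : Pass =>
      (if y.label = u then 1 else 0) * (if x.label = v then 1 else 0)) l :=
    sum₂_congr fun x _ y _ => mul_comm _ _
  rw [sum₂_add, ← e] at this
  rw [pairCount, this, passCount, passCount]
  congr 1
  by_cases huv : u = v
  · rw [if_pos huv, ← huv]
    exact sum₁_congr fun x _ => by split_ifs <;> rfl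
  · rw [if_neg huv]
    refine sum₁_eq_zero fun x _ => ?_
    by_cases hx : x.label = u
    · rw [if_neg (fun h => huv (hx.symm.trans h)), mul_zero]
    · rw [if_neg hx, zero_mul]

/-- Two crossings that join A to B interlace exactly when their passages have the same order in A
and in B. For a crossing that does not join A to B the height is zero. -/
lemma IsCurve.height_mul_height_mul (h : IsCurve (A ++ B)) (hf : ∀ x ∈ A ++ B, x.fwd = true)
    (u v : ℕ) : height u A * height v A * (pairCount u v A * pairCount u v B +
      pairCount v u A * pairCount v u B) =
      height u A * height v A * signedInterlacement (A ++ B) u v ^ 2 := by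
  rcases h.mixed_or hf u with ⟨hu1, hu2, hu3, hu4⟩ | ⟨hu, -⟩
  swap
  · rw [hu]; ring
  rcases h.mixed_or hf v with ⟨hv1, hv2, hv3, hv4⟩ | ⟨hv, -⟩
  swap
  · rw [hv]; ring
  have hA := pairCount_add_swap (u := u) (v := v) A
  have hB := pairCount_add_swap (u := u) (v := v) B
  rw [hu1, hv1] at hA
  rw [hu2, hv2] at hB
  by_cases huv : u = v
  · rw [if_pos huv] at hA hB
    subst huv
    have e : pairCount u u A = 0 := by omega
    rw [signedInterlacement_self, e]; ring
  · rw [if_neg huv] at hA hB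
    have hex : ∀ (w : ℕ) (l : List Pass), passCount w l = 1 → ∃ x ∈ l, x.label = w := by
      intro w l hw
      by_contra hne
      push Not at hne
      rw [passCount_eq_zero hne] at hw
      omega
    obtain ⟨a, ha, hau⟩ := hex u A hu1
    obtain ⟨c, hc, hcu⟩ := hex u B hu2
    obtain ⟨b, hb, hbv⟩ := hex v A hv1
    obtain ⟨d, hd, hdv⟩ := hex v B hv2
    have eA : ∀ x ∈ A, ∀ y ∈ A, branchSign u x * branchSign v y = height u A * height v A *
        ((if x.label = u then 1 else 0) * if y.label = v then 1 else 0) := by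
      intro x hx y hy
      by_cases hxu : x.label = u
      · by_cases hyv : y.label = v
        · rw [if_pos hxu, if_pos hyv, (hu4 x hx c hc hxu hcu).2.1, (hv4 y hy d hd hyv hdv).2.1]; ring
        · rw [if_neg hyv, branchSign_of_ne hyv]; ring
      · rw [if_neg hxu, branchSign_of_ne hxu]; ring
    have eB : ∀ x ∈ B, ∀ y ∈ B, branchSign u x * branchSign v y = height u A * height v A *
        ((if x.label = u then 1 else 0) * if y.label = v then 1 else 0) := by
      intro x hx y hy
      by_cases hxu : x.label = u
      · by_cases hyv : y.label = v
        · rw [if_pos hxu, if_pos hyv, (hu4 a ha x hx hau hxu).2.2, (hv4 b hb y hy hbv hyv).2.2]; ring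
        · rw [if_neg hyv, branchSign_of_ne hyv]; ring
      · rw [if_neg hxu, branchSign_of_ne hxu]; ring
    have hT : signedInterlacement (A ++ B) u v =
        height u A * height v A * (pairCount u v A + pairCount u v B - 1) := by
      have h0 := h.height_eq_zero v
      rw [height_append] at h0
      rw [signedInterlacement_append huv, show height v B = -height v A by omega,
        signedInterlacement, if_neg huv, signedInterlacement, if_neg huv, sum₂_congr eA,
        sum₂_congr eB, sum₂_mul_left, sum₂_mul_left, pairCount, pairCount]
      ring
    have n1 := pairCount_nonneg u v A
    have n2 := pairCount_nonneg v u A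
    have n3 := pairCount_nonneg u v B
    have n4 := pairCount_nonneg v u B
    have s1 : (height u A * height v A) ^ 2 = 1 := by
      linear_combination height v A ^ 2 * hu3 + hv3
    rw [hT, mul_pow, s1, one_mul]
    congr 1
    have c1 : pairCount u v A = 0 ∨ pairCount u v A = 1 := by omega
    have c3 : pairCount u v B = 0 ∨ pairCount u v B = 1 := by omega
    have c2 : pairCount v u A = 1 - pairCount u v A := by omega
    have c4 : pairCount v u B = 1 - pairCount u v B := by omega
    rw [c2, c4]
    rcases c1 with c1 | c1 <;> rcases c3 with c3 | c3 <;> rw [c1, c3] <;> norm_num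

/-- Grouping the passages by crossing gives a sum over ordered pairs of crossings, in one of the two
possible orders; symmetrizing produces the factor 2 and the square of the interlacement. -/
lemma IsCurve.sum₂_sum₂_eq_sum (h : IsCurve (A ++ B)) (hf : ∀ x ∈ A ++ B, x.fwd = true)
    (hV : ∀ x ∈ A ++ B, x.label ∈ V) :
    2 * sum₂ (fun a b => sum₂ (fun c d => eps a c * eps b d) B) A =
      ∑ u ∈ V, ∑ v ∈ V, height u A * height v A * signedInterlacement (A ++ B) u v ^ 2 := by
  have e : sum₂ (fun a b => sum₂ (fun c d => eps a c * eps b d) B) A =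
      ∑ u ∈ V, ∑ v ∈ V, height u A * height v A * (pairCount u v A * pairCount u v B) := by
    rw [sum₂_eq_sum _ fun x hx => hV x (by simp [hx])]
    refine sum_congr rfl fun u _ => sum_congr rfl fun v _ => ?_
    have e1 : ∀ a ∈ A, ∀ b ∈ A, ((if a.label = u then 1 else 0) * if b.label = v then 1 else 0) *
        sum₂ (fun c d => eps a c * eps b d) B =
        height u A * height v A * pairCount u v B *
          ((if a.label = u then 1 else 0) * if b.label = v then 1 else 0) := by
      intro a ha b hb
      rw [← sum₂_mul_left, mul_comm _ (_ * _), pairCount, ← mul_assoc, ← sum₂_mul_left]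
      refine sum₂_congr fun c hc d hd => ?_
      linear_combination ((if b.label = v then 1 else 0) * eps b d) * h.ite_mul_eps hf u ha hc +
        height u A * ((if a.label = u then 1 else 0) * if c.label = u then 1 else 0) *
          h.ite_mul_eps hf v hb hd
    rw [sum₂_congr e1, sum₂_mul_left, ← pairCount]
    ring
  rw [two_mul]
  nth_rw 2 [e]
  rw [sum_comm, e, ← sum_add_distrib]
  refine sum_congr rfl fun u _ => ?_
  rw [← sum_add_distrib]
  refine sum_congr rfl fun v _ => ?_
  rw [← h.height_mul_height_mul hf]
  ring

end Split

end KnotTheory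

namespace KnotTheory

open Finset

/-! ### The change of `Phi` under a smoothing -/

lemma sum₃_add {α R : Type*} [CommRing R] (f g : α → α → α → R) (l : List α) :
    sum₃ (fun x y z => f x y z + g x y z) l = sum₃ f l + sum₃ g l := by
  induction l with
  | nil => simp [sum₃]
  | cons x l ih => simp only [sum₃, ih, sum₂_add]; ring

lemma sum₃_sum₁_comm {α β R : Type*} [CommRing R] (g : α → α → α → β → R) (A : List α) (B : List β) :
    sum₁ (fun t => sum₃ (fun x y z => g x y z t) A) B = sum₃ (fun x y z => sum₁ (g x y z) B) A := by
  induction B with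
  | nil => simp [sum₁]
  | cons t B ih => simp only [sum₁, ih, sum₃_add]

lemma PhiMix_swap (A B : List Pass) :
    PhiMix B A = -sum₃ (fun a b c => eps a c * sum₁ (eps b) B) A := by
  rw [PhiMix, sum₃_sum₁_comm, ← sum₃_neg]
  refine sum₃_congr fun a _ b _ c _ => ?_
  rw [sum₁_mul_right, mul_comm, ← mul_neg, ← sum₁_neg]
  congr 1
  exact sum₁_congr fun x _ => eps_swap b x

lemma sum₂_sum₂_comm {α β R : Type*} [CommRing R] (g : α → α → β → β → R) (A : List α) (B : List β) :
    sum₂ (fun x y => sum₂ (g x y) B) A = sum₂ (fun z t => sum₂ (fun x y => g x y z t) A) B := by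
  induction A with
  | nil => simp [sum₂]
  | cons x A ih =>
    simp only [sum₂, ih, sum₂_add, sum₂_sum₁_comm]

lemma Phi_append_sub_swap (A B : List Pass) :
    Phi (A ++ B) - Phi (B ++ A) = 2 * PhiMix A B - 2 * PhiMix B A := by
  rw [Phi_append, Phi_append, PhiMix_swap A B]
  have h1 := PhiMix_swap B A
  have h2 : sum₂ (fun a b => sum₂ (fun c d => eps a c * eps b d) A) B =
      sum₂ (fun a b => sum₂ (fun c d => eps a c * eps b d) B) A := by
    rw [sum₂_sum₂_comm]
    refine sum₂_congr fun a _ b _ => sum₂_congr fun c _ d _ => ?_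
    rw [eps_swap a c, eps_swap b d]; ring
  linear_combination -h2 - h1

lemma PhiMix_revPath_right (A B : List Pass) : PhiMix A (revPath B) = PhiMix A B := by
  refine sum₁_congr fun x _ => ?_
  rw [revPath, sum₃_reverse, sum₃_map]
  congr 1; ext a b c
  rw [eps_rev_right, eps_rev_left, eps_rev_right, eps_swap a c]; ring

lemma PhiMix_revPath_left (A B : List Pass) : PhiMix (revPath B) A = -PhiMix B A := by
  rw [PhiMix, revPath, sum₁_reverse, sum₁_map, PhiMix, ← sum₁_neg]
  refine sum₁_congr fun x _ => ?_
  rw [← sum₃_neg]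
  refine sum₃_congr fun a _ b _ c _ => ?_
  rw [eps_rev_left]; ring

/-! ### Smoothing one crossing of a planar curve. -/

section Smooth

variable {i i' : Pass} {A B : List Pass}

lemma IsCurve.Phi_smooth (h : IsCurve (i :: (A ++ i' :: B))) (hc : IsColourable (i :: (A ++ i' :: B)))
    (hm : Match i i') : Phi (i :: (A ++ i' :: B)) = Phi (A ++ B) := by
  have hne := h.label_ne hm
  rw [Phi_cons_append_cons (fun y hy => hne y (by simp [hy])) (fun y hy => hne y (by simp [hy])) hm.1,
    (hc.isBounding h).cross_eq_zero h.nodup hm, mul_zero, zero_add]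

/-- Two instances of base point independence. For the given curve, starting at i or at i' gives
PhiMix A B = PhiMix B A. For the curve smoothed against the orientation the second term has the
opposite sign, so both vanish. -/
lemma IsCurve.PhiMix_eq_zero (h : IsCurve (i :: (A ++ i' :: B)))
    (hc : IsColourable (i :: (A ++ i' :: B))) (hm : Match i i') : PhiMix B A = 0 := by
  have h1 := h.Phi_smooth hc hm
  have hr : i :: (A ++ i' :: B) ~r i' :: (B ++ i :: A) := by
    have := List.isRotated_append (l := i :: A) (l' := i' :: B)
    simpa using this
  obtain ⟨h2, h3, -, -, h4, -⟩ := h.rotation_eq hc hr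
  rw [h2.Phi_smooth h3 hm.symm, h1] at h4
  have h5 := Phi_append_sub_swap A B
  have h6 : IsCurve (A ++ revPath B) := (h.smooth hm).of_perm (map_branch_append_revPath A B).symm
  have h7 := Phi_rotate ((hc.smooth hm (h.label_ne hm)).isBounding h6) h6.nodup
  have h8 := Phi_append_sub_swap A (revPath B)
  rw [PhiMix_revPath_left, PhiMix_revPath_right] at h8
  omega

/-- The change of `Phi` when a crossing is smoothed against the orientation. -/
lemma IsCurve.Phi_append_revPath_sub (h : IsCurve (i :: (A ++ i' :: B)))
    (hc : IsColourable (i :: (A ++ i' :: B))) (hf : ∀ x ∈ i :: (A ++ i' :: B), x.fwd = true)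
    (hm : Match i i') : 2 * (Phi (A ++ revPath B) - Phi (i :: (A ++ i' :: B))) =
      -∑ v ∈ labels (i :: (A ++ i' :: B)), signedInterlacement (i :: (A ++ i' :: B)) i.label v ^ 2 -
      2 * ∑ u ∈ labels (i :: (A ++ i' :: B)), ∑ v ∈ labels (i :: (A ++ i' :: B)),
        signedInterlacement (i :: (A ++ i' :: B)) i.label u *
        signedInterlacement (i :: (A ++ i' :: B)) i.label v *
        signedInterlacement (i :: (A ++ i' :: B)) u v ^ 2 := by
  set l := i :: (A ++ i' :: B) with hl
  have hAB := h.smooth hm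
  have hmem : ∀ x ∈ A ++ B, x ∈ l := by
    intro x hx
    simp only [hl, List.mem_append, List.mem_cons] at hx ⊢
    tauto
  have hfAB : ∀ x ∈ A ++ B, x.fwd = true := fun x hx => hf x (hmem x hx)
  have hV : ∀ x ∈ A ++ B, x.label ∈ labels l := fun x hx => mem_labels.mpr ⟨x, hmem x hx, rfl⟩
  have hc0 : cross A B = 0 := (hc.isBounding h).cross_eq_zero h.nodup hm
  have hA : BranchNodup A := by
    have := hAB.nodup
    rw [BranchNodup, List.map_append] at this
    exact this.of_append_left
  have h0 := h.PhiMix_eq_zero hc hm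
  -- In this form the vanishing concerns the term with three entries in A, the one negated when B is
  -- reversed.
  rw [PhiMix_swap, neg_eq_zero] at h0
  have hX := hAB.sum₂_sum₂_eq_sum hfAB hV
  have hN := hAB.crossNum_eq_sum hfAB hV
  have hXY := sum₂_sum₂_eps (B := B) hA
  rw [hc0] at hXY
  have e1 : ∑ v ∈ labels l, signedInterlacement l i.label v ^ 2 = ∑ v ∈ labels l, height v A ^ 2 := by
    refine sum_congr rfl fun v _ => ?_
    rw [hl, h.signedInterlacement_eq_height hm, mul_pow, sq (sg _), sg_mul_self, one_mul]
  have e2 : ∑ u ∈ labels l, ∑ v ∈ labels l, signedInterlacement l i.label u *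
        signedInterlacement l i.label v * signedInterlacement l u v ^ 2 =
      ∑ u ∈ labels l, ∑ v ∈ labels l,
        height u A * height v A * signedInterlacement (A ++ B) u v ^ 2 := by
    refine sum_congr rfl fun u _ => sum_congr rfl fun v _ => ?_
    have hA0 : height i.label A = 0 :=
      KnotTheory.height_eq_zero fun x hx => h.label_ne hm x (by simp [hx])
    rw [hl, h.signedInterlacement_eq_height hm, h.signedInterlacement_eq_height hm]
    by_cases hu : u = i.label
    · rw [hu, hA0]; ring
    by_cases hv : v = i.label
    · rw [hv, hA0]; ring
    rw [IsCurve.signedInterlacement_remove hm hu hv]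
    linear_combination height u A * height v A * signedInterlacement (A ++ B) u v ^ 2 *
      sg_mul_self i.isFst
  rw [e1, e2, ← hX, ← hN, h.Phi_smooth hc hm, Phi_append_revPath, Phi_append]
  linear_combination hXY - 4 * h0

lemma IsCurve.sum_signedInterlacement (h : IsCurve (i :: (A ++ i' :: B)))
    (hc : IsColourable (i :: (A ++ i' :: B))) (hf : ∀ x ∈ i :: (A ++ i' :: B), x.fwd = true)
    (hm : Match i i') :
    ∑ v ∈ labels (i :: (A ++ i' :: B)), signedInterlacement (i :: (A ++ i' :: B)) i.label v = 0 := by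
  have hmem : ∀ x ∈ A ++ B, x ∈ i :: (A ++ i' :: B) := by
    intro x hx
    simp only [List.mem_append, List.mem_cons] at hx ⊢
    tauto
  have hc0 : cross A B = 0 := (hc.isBounding h).cross_eq_zero h.nodup hm
  rw [(h.smooth hm).cross_eq_sum (fun x hx => hf x (hmem x hx))
    fun x hx => mem_labels.mpr ⟨x, hmem x hx, rfl⟩] at hc0
  rw [sum_congr rfl fun v _ => h.signedInterlacement_eq_height hm v, ← mul_sum, hc0, mul_zero]

end Smooth

/-! ### Reduction modulo two, row sums, and the change of the mean nullity. -/

lemma IsCurve.signedInterlacement_cases {l : List Pass} (h : IsCurve l)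
    (hf : ∀ x ∈ l, x.fwd = true) (u v : ℕ) : signedInterlacement l u v = -1 ∨
      signedInterlacement l u v = 0 ∨ signedInterlacement l u v = 1 := by
  by_cases hu : u ∈ labels l
  · obtain ⟨i, i', A, B, hm, rfl, hr⟩ := h.exists_rotation hu
    have h' := h.of_perm (hr.perm.map _)
    rw [← h.signedInterlacement_rotate hr, h'.signedInterlacement_eq_height hm]
    have hf' : ∀ x ∈ A ++ B, x.fwd = true := by
      intro x hx
      refine hf x (hr.perm.mem_iff.mpr ?_)
      simp only [List.mem_append, List.mem_cons] at hx ⊢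
      tauto
    rcases (h'.smooth hm).mixed_or hf' v with ⟨-, -, h1, -⟩ | ⟨h1, -⟩
    · have h2 : (sg i.isFst * height v A) * (sg i.isFst * height v A) = 1 := by
        linear_combination height v A * height v A * sg_mul_self i.isFst + h1
      rcases mul_self_eq_one_iff.mp h2 with h3 | h3
      · exact Or.inr (Or.inr h3)
      · exact Or.inl h3
    · exact Or.inr (Or.inl (by rw [h1, mul_zero]))
  · exact Or.inr (Or.inl (signedInterlacement_eq_zero fun x hx hxu =>
      hu (mem_labels.mpr ⟨x, hx, hxu⟩)))

lemma sum₁_cast {α : Type*} (f : α → ℤ) (l : List α) :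
    ((sum₁ f l : ℤ) : ZMod 2) = sum₁ (fun x => (f x : ZMod 2)) l := by
  induction l with
  | nil => simp [sum₁]
  | cons x l ih => simp [sum₁, ih]

lemma sum₂_cast {α : Type*} (f : α → α → ℤ) (l : List α) :
    ((sum₂ f l : ℤ) : ZMod 2) = sum₂ (fun x y => (f x y : ZMod 2)) l := by
  induction l with
  | nil => simp [sum₂]
  | cons x l ih => simp [sum₂, ih, sum₁_cast]

lemma cast_branchSign (u : ℕ) (x : Pass) :
    ((branchSign u x : ℤ) : ZMod 2) = if x.label = u then 1 else 0 := by
  rw [branchSign]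
  split_ifs
  · cases x.isFst <;> decide
  · rfl

lemma cast_signedInterlacement (l : List Pass) (u v : ℕ) :
    ((signedInterlacement l u v : ℤ) : ZMod 2) = interlacement l u v := by
  rw [signedInterlacement, interlacement]
  split_ifs
  · rfl
  · rw [sum₂_cast, pairParity]
    simp only [Int.cast_mul, cast_branchSign]

lemma IsCurve.lift01_interlacement {l : List Pass} (h : IsCurve l)
    (hf : ∀ x ∈ l, x.fwd = true) (u v : ℕ) :
    lift01 (interlacement l u v) = signedInterlacement l u v ^ 2 := by
  rw [← cast_signedInterlacement]
  rcases h.signedInterlacement_cases hf u v with h1 | h1 | h1 <;> rw [h1] <;> decide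

/-- Up to sign a row sum is the intersection number of the two loops at u. This is the consequence
of planarity that makes the linear part of the final inequality disappear. -/
lemma IsCurve.sum_row {l : List Pass} (h : IsCurve l) (hc : IsColourable l)
    (hf : ∀ x ∈ l, x.fwd = true) {u : ℕ} (hu : u ∈ labels l) :
    ∑ v ∈ labels l, signedInterlacement l u v = 0 := by
  obtain ⟨i, i', A, B, hm, rfl, hr⟩ := h.exists_rotation hu
  obtain ⟨h1, h2, h3, -⟩ := h.rotation_eq hc hr
  rw [← h.signedInterlacement_rotate hr, ← h3]
  exact h1.sum_signedInterlacement h2 (fun x hx => hf x (hr.perm.mem_iff.mpr hx)) hm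

/-- The average number of circles when a crossing is smoothed against the orientation. -/
lemma IsCurve.kappa_schur_sub {l : List Pass} (h : IsCurve l) (hc : IsColourable l)
    (hf : ∀ x ∈ l, x.fwd = true) {u : ℕ} (hu : u ∈ labels l) :
    kappa ((labels l).erase u) (schur (interlacement l) u) - kappa (labels l) (interlacement l) =
      -2 - 3 * ∑ v ∈ labels l, signedInterlacement l u v ^ 2 -
      6 * ∑ v ∈ labels l, ∑ t ∈ labels l, signedInterlacement l u v * signedInterlacement l u t *
        signedInterlacement l v t ^ 2 := by
  obtain ⟨i, i', A, B, hm, rfl, hr⟩ := h.exists_rotation hu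
  obtain ⟨h1, h2, h3, h4, -, -⟩ := h.rotation_eq hc hr
  rw [← h.signedInterlacement_rotate hr, ← h3, ← h4]
  have hf' : ∀ x ∈ i :: (A ++ i' :: B), x.fwd = true := fun x hx => hf x (hr.perm.mem_iff.mpr hx)
  have e1 := h1.Phi_append_revPath_sub h2 hf' hm
  have e2 := kappa_eq_Phi h1 h2
  have hcur : IsCurve (A ++ revPath B) := (h1.smooth hm).of_perm (map_branch_append_revPath A B).symm
  have e3 := kappa_eq_Phi hcur (h2.smooth hm (h1.label_ne hm))
  have hV : (labels (i :: (A ++ i' :: B))).erase i.label = labels (A ++ revPath B) := by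
    rw [labels_eq_of_perm (map_branch_append_revPath A B)]
    ext v
    have hne := h1.label_ne hm
    simp only [mem_erase, mem_labels, List.mem_cons, List.mem_append]
    constructor
    · rintro ⟨hv, x, hx, rfl⟩
      refine ⟨x, ?_, rfl⟩
      rcases hx with rfl | hx | rfl | hx
      · exact absurd rfl hv
      · exact Or.inl hx
      · exact absurd hm.1 hv
      · exact Or.inr hx
    · rintro ⟨x, hx, rfl⟩
      exact ⟨hne x (by simpa using hx), x, by tauto, rfl⟩
  have hk : kappa ((labels (i :: (A ++ i' :: B))).erase i.label)
      (schur (interlacement (i :: (A ++ i' :: B))) i.label) =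
      kappa (labels (A ++ revPath B)) (interlacement (A ++ revPath B)) := by
    rw [← hV]
    exact kappa_congr fun v hv t ht hvt =>
      h1.schur_interlacement hm (ne_of_mem_erase hv) (ne_of_mem_erase ht) hvt
  have hlen : ((i :: (A ++ i' :: B)).length : ℤ) = (A ++ revPath B).length + 2 := by
    simp [revPath]; ring
  rw [hk, e2, e3, hlen]
  linear_combination 3 * e1

end KnotTheory

namespace KnotTheory

open Finset

/-! ### The formula for the degree three invariant -/

/-- The weight of a triple of crossings with signed interlacements `a`, `b`, `c` around the triple:
it is `8` for a cyclic triangle, `2` for a directed path and zero otherwise. -/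
def weight (a b c : ℤ) : ℤ :=
  a ^ 2 * b ^ 2 + b ^ 2 * c ^ 2 + c ^ 2 * a ^ 2 - a ^ 2 * b ^ 2 * c ^ 2 +
    (a * b * c ^ 2 + b * c * a ^ 2 + c * a * b ^ 2) + (a * b + b * c + c * a)

/-- The sum of the weights of the triples of vertices of a signed graph. -/
def weightSum (V : Finset ℕ) (s : ℕ → ℤ) (T : ℕ → ℕ → ℤ) : ℤ :=
  ∑ i ∈ V, ∑ j ∈ V, ∑ k ∈ V, s i * s j * s k * weight (T i j) (T j k) (T k i)

lemma sum_cyclic (V : Finset ℕ) (f : ℕ → ℕ → ℕ → ℤ) :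
    ∑ i ∈ V, ∑ j ∈ V, ∑ k ∈ V, f i j k = ∑ i ∈ V, ∑ j ∈ V, ∑ k ∈ V, f k i j := by
  symm
  rw [sum_congr rfl fun i _ => sum_comm, sum_comm]

section Mean

variable {V : Finset ℕ} {M : ℕ → ℕ → ZMod 2} {s : ℕ → ℤ}

lemma mean_spinSum (hM : ∀ u v, M u v = M v u) (h0 : ∀ u, M u u = 0) :
    mean V M (spinSum V s) = 0 := by
  have : spinSum V s = fun D => ∑ i ∈ V, s i * cspin i D := rfl
  rw [this, mean_sum]
  refine sum_eq_zero fun i hi => ?_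
  rw [mean_const_mul, mean_cspin hM h0 hi, mul_zero]

/-- The cube is expanded and the third moments inserted. Because s² = 1, coincident indices leave
only the single and double sums, which will cancel against the nullity term. -/
lemma mean_spinSum_cube (hM : ∀ u v, M u v = M v u) (h0 : ∀ u, M u u = 0)
    (hs : ∀ i ∈ V, s i ^ 2 = 1) :
    mean V M (fun D => spinSum V s D ^ 3) =
      48 * ∑ i ∈ V, ∑ j ∈ V, ∑ k ∈ V, s i * s j * s k *
        (lift01 (M i j) * lift01 (M j k) + lift01 (M j k) * lift01 (M i k) +
          lift01 (M i k) * lift01 (M i j) - lift01 (M i j) * lift01 (M j k) * lift01 (M i k)) +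
      72 * ∑ i ∈ V, ∑ j ∈ V, s i * lift01 (M i j) + 48 * ∑ i ∈ V, s i := by
  have h1 : (fun D => spinSum V s D ^ 3) = fun D => ∑ i ∈ V, ∑ j ∈ V, ∑ k ∈ V,
      (s i * s j * s k) * (cspin i D * (cspin j D * cspin k D)) := by
    ext D
    rw [pow_three, spinSum, sum_mul_sum, sum_mul_sum]
    refine sum_congr rfl fun i _ => ?_
    simp only [mul_sum]
    refine sum_congr rfl fun j _ => sum_congr rfl fun k _ => ?_
    ring
  have h2 : ∀ i ∈ V, ∀ j ∈ V, ∀ k ∈ V, mean V M (fun D =>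
      (s i * s j * s k) * (cspin i D * (cspin j D * cspin k D))) =
      48 * (s i * s j * s k * (lift01 (M i j) * lift01 (M j k) + lift01 (M j k) * lift01 (M i k) +
          lift01 (M i k) * lift01 (M i j) - lift01 (M i j) * lift01 (M j k) * lift01 (M i k))) +
      24 * ((if i = j then s k * lift01 (M k i) else 0) + (if j = k then s i * lift01 (M i j) else 0) +
        (if i = k then s j * lift01 (M j i) else 0)) + 48 * (if i = j then if j = k then s i else 0 else 0) := by
    intro i hi j hj k hk
    rw [mean_const_mul, mean_cspin₃ hM h0 hi hj hk]
    have hsi := hs i hi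
    have hsj := hs j hj
    by_cases hij : i = j
    · subst hij
      by_cases hik : i = k
      · subst hik
        simp only [if_true, and_self]
        linear_combination (72 * s i * lift01 (M i i) + 48 * s i) * hsi
      · simp only [if_true, hik, and_false, if_false, hM k i]
        linear_combination (24 * s k * lift01 (M i k)) * hsi
    · by_cases hjk : j = k
      · subst hjk
        simp only [hij, if_true, if_false, and_true, hM i j]
        linear_combination (24 * s i * lift01 (M j i)) * hsj
      · by_cases hik : i = k
        · subst hik
          simp only [hij, hjk, if_true, if_false, and_false, hM j i]
          linear_combination (24 * s j * lift01 (M i j)) * hsi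
        · simp only [hij, hjk, hik, if_false, and_false]
          ring
  rw [h1, mean_sum]
  simp only [mean_sum]
  rw [sum_congr rfl fun i hi => sum_congr rfl fun j hj => sum_congr rfl fun k hk => h2 i hi j hj k hk]
  simp only [sum_add_distrib, ← mul_sum]
  have e1 : ∑ i ∈ V, ∑ j ∈ V, ∑ k ∈ V, (if i = j then s k * lift01 (M k i) else 0) =
      ∑ i ∈ V, ∑ j ∈ V, s i * lift01 (M i j) := by
    rw [sum_comm (f := fun i j => s i * lift01 (M i j))]
    refine sum_congr rfl fun i hi => ?_
    rw [sum_comm]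
    refine sum_congr rfl fun k _ => ?_
    rw [sum_ite_eq, if_pos hi]
  have e2 : ∑ i ∈ V, ∑ j ∈ V, ∑ k ∈ V, (if j = k then s i * lift01 (M i j) else 0) =
      ∑ i ∈ V, ∑ j ∈ V, s i * lift01 (M i j) := by
    refine sum_congr rfl fun i _ => sum_congr rfl fun j hj => ?_
    rw [sum_ite_eq, if_pos hj]
  have e3 : ∑ i ∈ V, ∑ j ∈ V, ∑ k ∈ V, (if i = k then s j * lift01 (M j i) else 0) =
      ∑ i ∈ V, ∑ j ∈ V, s i * lift01 (M i j) := by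
    rw [sum_comm]
    refine sum_congr rfl fun j _ => sum_congr rfl fun i hi => ?_
    rw [sum_ite_eq, if_pos hi]
  have e4 : ∑ i ∈ V, ∑ j ∈ V, ∑ k ∈ V, (if i = j then if j = k then s i else 0 else 0) =
      ∑ i ∈ V, s i := by
    refine sum_congr rfl fun i hi => ?_
    have : ∀ j ∈ V, ∑ k ∈ V, (if i = j then if j = k then s i else 0 else 0) =
        if i = j then s i else 0 := by
      intro j hj
      split_ifs
      · rw [sum_ite_eq, if_pos hj]
      · exact sum_const_zero
    rw [sum_congr rfl this, sum_ite_eq, if_pos hi]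
  rw [e1, e2, e3, e4]
  simp only [← mul_sum]
  ring

/-- The -3 of the centred spin turns κ + 2κ' into 2(κ' - κ), where κ' is the mean nullity after the
Schur complement at i. This is the effect of smoothing i against the orientation. -/
lemma mean_nullity_mul_spinSum (h0 : ∀ u, M u u = 0) :
    mean V M (fun D => (nullity V (addDiag M D) : ℤ) * spinSum V s D) =
      ∑ i ∈ V, s i * (2 * (kappa (V.erase i) (schur M i) - kappa V M)) := by
  have h1 : (fun D => (nullity V (addDiag M D) : ℤ) * spinSum V s D) = fun D =>
      ∑ i ∈ V, s i * ((nullity V (addDiag M D) : ℤ) * spin i D +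
        (-3) * (nullity V (addDiag M D) : ℤ)) := by
    ext D
    rw [spinSum, mul_sum]
    refine sum_congr rfl fun i _ => ?_
    rw [cspin]; ring
  rw [h1, mean_sum]
  refine sum_congr rfl fun i hi => ?_
  rw [mean_const_mul, mean_add, mean_const_mul, ← kappa]
  have h2 := mean_nullity_mul_spin (V := V.erase i) (M := M) (notMem_erase i V) (h0 i)
  rw [insert_erase hi] at h2
  rw [h2]
  ring

/-- The even part of `weight` matches the third moments, and the three terms of type abc² are equal
after a cyclic change of indices. The terms of type ab sum to zero by `hrow`; they are in the
definition so that `weight` vanishes on triples with a repeated index and has the values 8, 2, 0. -/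
lemma sum_weight {θ : ℕ → ℕ → ℤ} (hs : ∀ i ∈ V, s i ^ 2 = 1) (hskew : ∀ i j, θ j i = -θ i j)
    (hrow : ∀ i ∈ V, ∑ j ∈ V, θ i j = 0) :
    weightSum V s (fun i j => s i * s j * θ i j) =
      ∑ i ∈ V, ∑ j ∈ V, ∑ k ∈ V, s i * s j * s k *
        (θ i j ^ 2 * θ j k ^ 2 + θ j k ^ 2 * θ i k ^ 2 + θ i k ^ 2 * θ i j ^ 2 -
          θ i j ^ 2 * θ j k ^ 2 * θ i k ^ 2) -
      3 * ∑ i ∈ V, s i * ∑ j ∈ V, ∑ k ∈ V, θ i j * θ i k * θ j k ^ 2 := by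
  have h1 : ∀ i ∈ V, ∀ j ∈ V, ∀ k ∈ V, s i * s j * s k *
      weight (s i * s j * θ i j) (s j * s k * θ j k) (s k * s i * θ k i) =
      s i * s j * s k *
        (θ i j ^ 2 * θ j k ^ 2 + θ j k ^ 2 * θ i k ^ 2 + θ i k ^ 2 * θ i j ^ 2 -
          θ i j ^ 2 * θ j k ^ 2 * θ i k ^ 2) - (s i * (θ i j * θ i k * θ j k ^ 2) +
          s j * (θ j k * θ j i * θ k i ^ 2) + s k * (θ k i * θ k j * θ i j ^ 2)) +
        (s j * (θ i j * θ j k) + s k * (θ j k * θ k i) + s i * (θ k i * θ i j)) := by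
    intro i hi j hj k hk
    rw [hskew i j, hskew i k, hskew j k, weight]
    have hi := hs i hi
    have hj := hs j hj
    have hk := hs k hk
    rcases sq_eq_one_iff.mp hi with h | h <;>
    rcases sq_eq_one_iff.mp hj with h' | h' <;>
    rcases sq_eq_one_iff.mp hk with h'' | h'' <;> rw [h, h', h''] <;> ring
  have h2 : ∑ i ∈ V, ∑ j ∈ V, ∑ k ∈ V, s j * (θ i j * θ j k) = 0 := by
    refine sum_eq_zero fun i _ => sum_eq_zero fun j hj => ?_
    rw [← mul_sum, ← mul_sum, hrow j hj, mul_zero, mul_zero]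
  have c1 := sum_cyclic V fun i j k => s i * (θ i j * θ i k * θ j k ^ 2)
  have c2 := sum_cyclic V fun i j k => s k * (θ k i * θ k j * θ i j ^ 2)
  have c3 := sum_cyclic V fun i j k => s j * (θ i j * θ j k)
  have c4 := sum_cyclic V fun i j k => s i * (θ k i * θ i j)
  rw [weightSum, sum_congr rfl fun i hi => sum_congr rfl fun j hj => sum_congr rfl fun k hk =>
    h1 i hi j hj k hk]
  simp only [sum_add_distrib, sum_sub_distrib] at *
  rw [h2] at c3
  have e0 : ∑ i ∈ V, s i * ∑ j ∈ V, ∑ k ∈ V, θ i j * θ i k * θ j k ^ 2 =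
      ∑ i ∈ V, ∑ j ∈ V, ∑ k ∈ V, s i * (θ i j * θ i k * θ j k ^ 2) := by
    simp only [mul_sum]
  rw [e0]
  linarith

end Mean

/-! ### The signed graph of a code -/

/-- The sign of a passage over or under. -/
def Letter.overSign (x : Letter) : ℤ := if x.isOver then 1 else -1

/-- The sign of the crossing `u` of a code. -/
def codeSign (w : List Letter) (u : ℕ) : ℤ :=
  sum₁ (fun x => if x.label = u ∧ x.isOver = true then (x.sign : ℤ) else 0) w

/-- The interlacement of the crossings `u` and `v`, signed by the passages over and under. -/
def overInterlacement (w : List Letter) (u v : ℕ) : ℤ :=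
  if u = v then 0 else sum₂ (fun x y => (if x.label = u then x.overSign else 0) *
    if y.label = v then y.overSign else 0) w

/-- The sum of the weights of the triples of crossings of a code. -/
def codeWeight (w : List Letter) : ℤ := weightSum (crossings w) (codeSign w) (overInterlacement w)

namespace IsGaussCode

variable {w : List Letter}

lemma codeSign_eq (h : IsGaussCode w) {x : Letter} (hx : x ∈ w) : codeSign w x.label = x.sign := by
  have key : ∀ l : List Letter, l.Nodup → ∀ y ∈ l, (∀ z ∈ l, z.label = y.label → z.isOver = true →
      z = y) → y.isOver = true →
      sum₁ (fun z : Letter => if z.label = y.label ∧ z.isOver = true then (z.sign : ℤ) else 0) l =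
        y.sign := by
    intro l hl y hy huniq hyo
    induction l with
    | nil => simp at hy
    | cons z l ih =>
      rw [List.nodup_cons] at hl
      rw [sum₁]
      rcases List.mem_cons.mp hy with rfl | hy'
      · rw [if_pos ⟨rfl, hyo⟩, sum₁_eq_zero, add_zero]
        intro t ht
        refine if_neg fun h' => ?_
        exact hl.1 (huniq t (by simp [ht]) h'.1 h'.2 ▸ ht)
      · rw [ih hl.2 hy' fun t ht => huniq t (by simp [ht]), if_neg, zero_add]
        intro h'
        exact hl.1 (huniq z (by simp) h'.1 h'.2 ▸ hy')
  have huniq : ∀ y ∈ w, y.isOver = true → ∀ z ∈ w, z.label = y.label → z.isOver = true → z = y := by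
    intro y hy hyo z hz hl ho
    exact Letter.ext hl (ho.trans hyo.symm) (h.sign_eq z hz y hy hl)
  by_cases ho : x.isOver = true
  · exact key w h.nodup x hx (huniq x hx ho) ho
  · have hf := h.flip_mem x hx
    have hfo : x.flip.isOver = true := by simpa [Letter.flip] using ho
    exact key w h.nodup x.flip hf (huniq _ hf hfo) hfo

lemma codeSign_sq (h : IsGaussCode w) {u : ℕ} (hu : u ∈ crossings w) : codeSign w u ^ 2 = 1 := by
  obtain ⟨x, hx, rfl⟩ := mem_crossings.mp hu
  rw [h.codeSign_eq hx]
  rcases Int.units_eq_one_or x.sign with h1 | h1 <;> rw [h1] <;> rfl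

lemma writhe_eq (w : List Letter) : writhe w = ∑ u ∈ crossings w, codeSign w u := by
  have h1 : ∀ (V : Finset ℕ) (l : List Letter), (∀ x ∈ l, x.label ∈ V) →
      writhe l = ∑ u ∈ V, codeSign l u := by
    intro V l hl
    induction l with
    | nil => simp [writhe, codeSign, sum₁]
    | cons x l ih =>
      simp only [codeSign, sum₁, sum_add_distrib] at ih ⊢
      rw [← ih fun y hy => hl y (by simp [hy])]
      by_cases ho : x.isOver = true
      · simp only [ho, and_true]
        rw [sum_ite_eq, if_pos (hl x (by simp))]
        simp [writhe, ho]
      · simp [writhe, ho]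
  exact h1 _ w fun x hx => mem_crossings.mpr ⟨x, hx, rfl⟩

lemma overSign_eq (h : IsGaussCode w) {x : Letter} (hx : x ∈ w) (t : ℕ) :
    (if x.label = t then x.overSign else 0) = codeSign w t * branchSign t (shadow x) := by
  rw [branchSign]
  by_cases ht : x.label = t
  · rw [if_pos ht, if_pos (show (shadow x).label = t from ht), ← ht, h.codeSign_eq hx]
    obtain ⟨l, b, s⟩ := x
    rcases Int.units_eq_one_or s with rfl | rfl <;> cases b <;>
      simp [shadow, Letter.IsFst, Letter.overSign, sg]
  · rw [if_neg ht, if_neg (show ¬ (shadow x).label = t from ht), mul_zero]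

lemma overInterlacement_eq (h : IsGaussCode w) (u v : ℕ) : overInterlacement w u v =
    codeSign w u * codeSign w v * signedInterlacement (w.map shadow) u v := by
  rw [overInterlacement, signedInterlacement]
  by_cases huv : u = v
  · rw [if_pos huv, if_pos huv, mul_zero]
  · rw [if_neg huv, if_neg huv, sum₂_map, ← sum₂_mul_left]
    refine sum₂_congr fun x hx y hy => ?_
    rw [h.overSign_eq hx, h.overSign_eq hy]
    ring

end IsGaussCode

lemma shadow_fwd (w : List Letter) : ∀ x ∈ w.map shadow, x.fwd = true := by
  simp only [List.mem_map]
  rintro _ ⟨x, -, rfl⟩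
  rfl

/-- The degree three invariant is a sum over the triples of crossings. -/
theorem Diagram.v3_eq_codeWeight (K : Diagram) : 48 * (4 * K.v3) = (codeWeight K.code : ℝ) := by
  set w := K.code with hw
  have h : IsGaussCode w := K.isGaussCode
  have hcur := h.isCurve
  have hcol := h.isColourable K.isPlanar
  have hfwd := shadow_fwd w
  set l := w.map shadow with hl
  have hV : labels l = crossings w := IsGaussCode.labels_shadow w
  have hsq : ∀ i ∈ crossings w, codeSign w i ^ 2 = 1 := fun i hi => h.codeSign_sq hi
  have h0 := interlacement_self l
  have hsymm := hcur.interlacement_symm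
  have hskew : ∀ i j, signedInterlacement l j i = -signedInterlacement l i j := fun i j =>
    hcur.signedInterlacement_symm i j
  have hrow : ∀ i ∈ crossings w, ∑ j ∈ crossings w, signedInterlacement l i j = 0 := by
    intro i hi
    rw [← hV] at hi ⊢
    exact hcur.sum_row hcol hfwd hi
  have hI := hcur.lift01_interlacement hfwd
  have key := v3_eq_mean K (M := interlacement l) (s := codeSign w)
    (fun i hi => sq_eq_one_iff.mp (hsq i hi)) (IsGaussCode.writhe_eq w) fun S _ => by
      rw [← hw, h.numCircles_eq (fun x hx => h.codeSign_eq hx) S]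
      rfl
  rw [← hw, mean_spinSum hsymm h0, Int.cast_zero, mul_zero, sub_zero, mean_add] at key
  have e1 := mean_spinSum_cube hsymm h0 hsq
  have e2 := mean_nullity_mul_spinSum (V := crossings w) (s := codeSign w) h0
  have e3 : mean (crossings w) (interlacement l) (fun D =>
      12 * nullity (crossings w) (addDiag (interlacement l) D) * spinSum (crossings w) (codeSign w) D) =
      12 * mean (crossings w) (interlacement l) (fun D =>
        (nullity (crossings w) (addDiag (interlacement l) D) : ℤ) *
          spinSum (crossings w) (codeSign w) D) := by
    rw [← mean_const_mul]
    simp only [mul_assoc]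
  have e4 : ∀ i ∈ crossings w, codeSign w i * (2 * (kappa ((crossings w).erase i)
      (schur (interlacement l) i) - kappa (crossings w) (interlacement l))) =
      -4 * codeSign w i - 6 * ∑ v ∈ crossings w, codeSign w i * lift01 (interlacement l i v) -
      12 * (codeSign w i * ∑ v ∈ crossings w, ∑ t ∈ crossings w,
        signedInterlacement l i v * signedInterlacement l i t * signedInterlacement l v t ^ 2) := by
    intro i hi
    rw [← hV] at hi ⊢
    rw [hcur.kappa_schur_sub hcol hfwd hi, ← mul_sum]
    simp only [hI]
    ring
  rw [sum_congr rfl e4] at e2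
  have e5 := sum_weight hsq hskew hrow
  have e6 : codeWeight w = weightSum (crossings w) (codeSign w)
      (fun i j => codeSign w i * codeSign w j * signedInterlacement l i j) := by
    rw [codeWeight]
    congr 1
    ext i j
    exact h.overInterlacement_eq i j
  simp only [sum_sub_distrib, ← mul_sum] at e2
  simp only [← mul_sum] at e1
  simp only [hI] at e1 e2
  -- The coefficients 48 and 72 of the single and double sums cancel against 12 · (-4) and 12 ·
  -- (-6); only sums over triples remain.
  rw [e3, e1, e2] at key
  rw [e6, e5]
  have : (2304 : ℝ) * (4 * K.v3) = 48 * (48 * (4 * K.v3)) := by ring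
  rw [this] at key
  have h48 : (48 : ℝ) ≠ 0 := by norm_num
  refine mul_left_cancel₀ h48 (key.trans ?_)
  rw [show (48 : ℝ) = ((48 : ℤ) : ℝ) by norm_num, ← Int.cast_mul]
  congr 1
  ring

end KnotTheory

namespace KnotTheory

open Finset

/-! ### Invariance under the moves -/

/-- The sign over or under of a passage through `u`. -/
def overBranch (u : ℕ) (x : Letter) : ℤ := if x.label = u then x.overSign else 0

/-- The sum of the signs over or under of the passages through `u`. -/
def overHeight (u : ℕ) (l : List Letter) : ℤ := sum₁ (overBranch u) l

lemma overBranch_self (x : Letter) : overBranch x.label x = x.overSign := if_pos rfl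

lemma overBranch_of_ne {u : ℕ} {x : Letter} (h : x.label ≠ u) : overBranch u x = 0 := if_neg h

lemma overHeight_append (u : ℕ) (A B : List Letter) :
    overHeight u (A ++ B) = overHeight u A + overHeight u B := sum₁_append _ _ _

lemma overHeight_eq_zero {u : ℕ} {l : List Letter} (h : ∀ x ∈ l, x.label ≠ u) :
    overHeight u l = 0 := sum₁_eq_zero fun x hx => if_neg (h x hx)

lemma overHeight_pair (u : ℕ) (x y : Letter) :
    overHeight u [x, y] = overBranch u x + overBranch u y := by simp [overHeight, sum₁]

lemma overInterlacement_of_ne {u v : ℕ} (h : u ≠ v) (l : List Letter) :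
    overInterlacement l u v = sum₂ (fun x y => overBranch u x * overBranch v y) l := if_neg h

lemma overInterlacement_self (l : List Letter) (u : ℕ) : overInterlacement l u u = 0 := if_pos rfl

lemma overInterlacement_append {u v : ℕ} (h : u ≠ v) (A B : List Letter) :
    overInterlacement (A ++ B) u v = overInterlacement A u v + overHeight u A * overHeight v B +
      overInterlacement B u v := by
  simp only [overInterlacement_of_ne h]
  rw [sum₂_append]
  simp only [sum₁_mul_left, sum₁_mul_right]
  rfl

lemma overInterlacement_pair {u v : ℕ} (h : u ≠ v) (x y : Letter) :
    overInterlacement [x, y] u v = overBranch u x * overBranch v y := by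
  simp [overInterlacement_of_ne h, sum₂, sum₁]

lemma overInterlacement_left {u v : ℕ} {l : List Letter} (h : ∀ x ∈ l, x.label ≠ u) :
    overInterlacement l u v = 0 := by
  by_cases huv : u = v
  · rw [huv, overInterlacement_self]
  · rw [overInterlacement_of_ne huv]
    exact sum₂_eq_zero fun x hx y _ => by rw [overBranch_of_ne (h x hx), zero_mul]

lemma overInterlacement_right {u v : ℕ} {l : List Letter} (h : ∀ x ∈ l, x.label ≠ v) :
    overInterlacement l u v = 0 := by
  by_cases huv : u = v
  · rw [huv, overInterlacement_self]
  · rw [overInterlacement_of_ne huv]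
    exact sum₂_eq_zero fun x _ y hy => by rw [overBranch_of_ne (h y hy), mul_zero]

lemma overSign_flip (x : Letter) : x.flip.overSign = -x.overSign := by
  obtain ⟨u, b, s⟩ := x
  cases b <;> rfl

lemma overBranch_flip (u : ℕ) (x : Letter) : overBranch u x.flip = -overBranch u x := by
  by_cases h : x.label = u
  · rw [← h, overBranch_self, ← overSign_flip]
    exact overBranch_self x.flip
  · rw [overBranch_of_ne h, neg_zero]
    exact overBranch_of_ne (x := x.flip) h

lemma codeSign_perm {w w' : List Letter} (h : w.Perm w') : codeSign w = codeSign w' :=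
  funext fun _ => sum₁_perm _ h

lemma crossings_perm {w w' : List Letter} (h : w.Perm w') : crossings w = crossings w' :=
  List.toFinset_eq_of_perm _ _ (h.map _)

namespace IsGaussCode

variable {w : List Letter}

lemma perm {w' : List Letter} (h : IsGaussCode w) (hp : w.Perm w') : IsGaussCode w' :=
  ⟨hp.nodup_iff.mp h.nodup, fun x hx => hp.mem_iff.mp (h.flip_mem x (hp.mem_iff.mpr hx)),
    fun x hx y hy => h.sign_eq x (hp.mem_iff.mpr hx) y (hp.mem_iff.mpr hy)⟩

lemma overInterlacement_skew (h : IsGaussCode w) (u v : ℕ) :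
    overInterlacement w v u = -overInterlacement w u v := by
  rw [h.overInterlacement_eq, h.overInterlacement_eq, h.isCurve.signedInterlacement_symm u v]
  ring

lemma overInterlacement_cases (h : IsGaussCode w) (u v : ℕ) : overInterlacement w u v = -1 ∨
    overInterlacement w u v = 0 ∨ overInterlacement w u v = 1 := by
  by_cases hu : u ∈ crossings w
  swap
  · exact Or.inr (Or.inl (overInterlacement_left fun x hx hxu => hu (mem_crossings.mpr ⟨x, hx, hxu⟩)))
  by_cases hv : v ∈ crossings w
  swap
  · exact Or.inr (Or.inl (overInterlacement_right fun x hx hxu => hv (mem_crossings.mpr ⟨x, hx, hxu⟩)))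
  rw [h.overInterlacement_eq]
  rcases sq_eq_one_iff.mp (h.codeSign_sq hu) with h1 | h1 <;>
  rcases sq_eq_one_iff.mp (h.codeSign_sq hv) with h2 | h2 <;>
  rcases h.isCurve.signedInterlacement_cases (shadow_fwd w) u v with h3 | h3 | h3 <;>
  rw [h1, h2, h3] <;> norm_num

lemma eq_or_eq_flip (h : IsGaussCode w) {x y : Letter} (hx : x ∈ w) (hy : y ∈ w)
    (hl : y.label = x.label) : y = x ∨ y = x.flip := by
  have hs := h.sign_eq y hy x hx hl
  by_cases ho : y.isOver = x.isOver
  · exact Or.inl (Letter.ext hl ho hs)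
  · refine Or.inr (Letter.ext hl ?_ hs)
    revert ho
    cases hyo : y.isOver <;> cases hxo : x.isOver <;> simp [Letter.flip, hxo]

lemma label_ne_of_perm (h : IsGaussCode w) {x : Letter} {r : List Letter}
    (hp : w.Perm (x :: x.flip :: r)) : ∀ y ∈ r, y.label ≠ x.label := by
  intro y hy hl
  have h' := h.perm hp
  have hnd := h'.nodup
  simp only [List.nodup_cons, List.mem_cons, not_or] at hnd
  rcases h'.eq_or_eq_flip (x := x) (by simp) (show y ∈ _ by simp [hy]) hl with rfl | rfl
  · exact hnd.1.2 hy
  · exact hnd.2.1 hy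

lemma codeSign_eq_of_perm {r : List Letter} {D : List Letter}
    (hp : w.Perm (D ++ r)) {u : ℕ} (hu : ∀ x ∈ D, x.label ≠ u) : codeSign w u = codeSign r u := by
  rw [codeSign_perm hp, codeSign, sum₁_append, sum₁_eq_zero, zero_add]
  · rfl
  · intro x hx
    exact if_neg fun h' => hu x hx h'.1

end IsGaussCode

/-- Entries b and -b make their common vertex a source, a sink or isolated in the triple, which
excludes cyclic triangles and directed paths. Triples with a repeated index are the case a = 0. -/
lemma weight_eq_zero {a b : ℤ} (ha : a = -1 ∨ a = 0 ∨ a = 1) (hb : b = -1 ∨ b = 0 ∨ b = 1) :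
    weight a b (-b) = 0 ∧ weight b (-b) a = 0 ∧ weight b a (-b) = 0 := by
  rcases ha with rfl | rfl | rfl <;> rcases hb with rfl | rfl | rfl <;> decide

lemma weightSum_congr {V : Finset ℕ} {s s' : ℕ → ℤ} {T T' : ℕ → ℕ → ℤ}
    (hs : ∀ i ∈ V, s i = s' i) (hT : ∀ i ∈ V, ∀ j ∈ V, T i j = T' i j) :
    weightSum V s T = weightSum V s' T' :=
  sum_congr rfl fun i hi => sum_congr rfl fun j hj => sum_congr rfl fun k hk => by
    rw [hs i hi, hs j hj, hs k hk, hT i hi j hj, hT j hj k hk, hT k hk i hi]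

lemma weightSum_insert {V : Finset ℕ} {s : ℕ → ℤ} {T : ℕ → ℕ → ℤ} {x : ℕ} (hx : x ∉ V)
    (hskew : ∀ i j, T j i = -T i j) (h0 : ∀ k, T x k = 0) :
    weightSum (insert x V) s T = weightSum V s T := by
  have h0' : ∀ k, T k x = 0 := fun k => by rw [hskew x k, h0, neg_zero]
  have hw : ∀ a, weight 0 a 0 = 0 ∧ weight a 0 0 = 0 ∧ weight 0 0 a = 0 := fun a => by
    simp [weight]
  simp only [weightSum, sum_insert hx, h0, h0', hw, mul_zero, sum_const_zero, zero_add]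

/-- The vertices x and y are twins of opposite sign. By `key` every triple through x weighs as much
as the corresponding one through y, even if x or y occurs again in it, so they cancel. -/
lemma weightSum_insert_pair {V : Finset ℕ} {s : ℕ → ℤ} {T : ℕ → ℕ → ℤ} {x y : ℕ} (hx : x ∉ V)
    (hy : y ∉ V) (hxy : x ≠ y) (hskew : ∀ i j, T j i = -T i j)
    (hc : ∀ i j, T i j = -1 ∨ T i j = 0 ∨ T i j = 1) (h : ∀ k ∈ V, T x k = T y k)
    (hs : s y = -s x) : weightSum (insert x (insert y V)) s T = weightSum V s T := by
  have h0 : ∀ i, T i i = 0 := fun i => by have := hskew i i; omega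
  set V' := insert x (insert y V) with hV'
  have hxV : x ∉ insert y V := by simp [hxy, hx]
  have key : ∀ j ∈ V', ∀ k ∈ V', weight (T x j) (T j k) (T k x) = weight (T y j) (T j k) (T k y) := by
    have hcase : ∀ j ∈ V', j = x ∨ j = y ∨ j ∈ V := fun j hj => by simpa [hV'] using hj
    intro j hj k hk
    have e0 := hskew x y
    rcases hcase j hj with rfl | rfl | hjV <;> rcases hcase k hk with rfl | rfl | hkV
    · rw [h0, e0]
      rcases hc k y with e | e | e <;> simp [e, weight]
    · rw [h0, h0, e0]
      rcases hc j k with e | e | e <;> simp [e, weight]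
    · rw [h0, e0, hskew j k, hskew y k, ← h k hkV]
      rcases hc j y with e | e | e <;> rcases hc j k with e' | e' | e' <;> simp [e, e', weight]
    · rw [h0, h0, e0]
      rcases hc k j with e | e | e <;> simp [e, weight]
    · rw [h0, e0]
      rcases hc x k with e | e | e <;> simp [e, weight]
    · rw [h0, hskew x k, hskew j k, ← h k hkV]
      rcases hc x j with e | e | e <;> rcases hc x k with e' | e' | e' <;> simp [e, e', weight]
    · rw [h0, hskew k j, ← h j hjV]
      rcases hc k y with e | e | e <;> rcases hc k j with e' | e' | e' <;> simp [e, e', weight]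
    · rw [h0, hskew k j, ← h j hjV, hskew x k]
      rcases hc x k with e | e | e <;> rcases hc x j with e' | e' | e' <;> simp [e, e', weight]
    · rw [h j hjV, hskew x k, hskew y k, h k hkV]
  have hcyc : ∀ a b c, weight a b c = weight b c a := fun a b c => by simp only [weight]; ring
  have hsum : ∀ f : ℕ → ℤ, f y = -f x → ∑ i ∈ V', f i = ∑ i ∈ V, f i := by
    intro f hf
    rw [hV', sum_insert hxV, sum_insert hy, hf]
    ring
  -- The cancellation removes x and y from the first index, then from the second and the third;
  -- cyclic symmetry of the weight brings each index to the first place.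
  rw [weightSum, hsum]
  · refine sum_congr rfl fun i hi => ?_
    have hi' : i ∈ V' := by simp [hV', hi]
    rw [hsum]
    · refine sum_congr rfl fun j hj => ?_
      have hj' : j ∈ V' := by simp [hV', hj]
      rw [hsum]
      rw [← hcyc (T y i), ← key i hi' j hj', hs, hcyc (T x i)]
      ring
    · rw [← sum_neg_distrib]
      refine sum_congr rfl fun k hk => ?_
      rw [hcyc, ← key k hk i hi', hs, hcyc (T i x)]
      ring
  · rw [← sum_neg_distrib]
    refine sum_congr rfl fun j hj => ?_
    rw [← sum_neg_distrib]
    refine sum_congr rfl fun k hk => ?_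
    rw [← key j hj k hk, hs]
    ring

/-! #### Base point, names, and the first two moves -/

lemma IsGaussCode.codeWeight_rotate {A B : List Letter} (h : IsGaussCode (A ++ B)) :
    codeWeight (B ++ A) = codeWeight (A ++ B) := by
  have hp : (A ++ B).Perm (B ++ A) := List.perm_append_comm
  have h' := h.perm hp
  rw [codeWeight, codeWeight, crossings_perm hp, codeSign_perm hp]
  congr 1
  ext u v
  rw [h.overInterlacement_eq, h'.overInterlacement_eq, codeSign_perm hp]
  congr 1
  have hr : (A ++ B).map shadow ~r (B ++ A).map shadow := List.isRotated_append.map _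
  rw [h.isCurve.signedInterlacement_rotate hr]

lemma codeWeight_relabel (f : Equiv.Perm ℕ) (A : List Letter) :
    codeWeight (A.map (Letter.relabel f)) = codeWeight A := by
  have hV : crossings (A.map (Letter.relabel f)) = (crossings A).map f.toEmbedding := by
    ext u
    simp [crossings, Letter.relabel, Equiv.eq_symm_apply]
  have hs : ∀ u, codeSign (A.map (Letter.relabel f)) (f u) = codeSign A u := by
    intro u
    rw [codeSign, sum₁_map]
    refine sum₁_congr fun x _ => ?_
    simp [Letter.relabel]
  have hb : ∀ u x, overBranch (f u) (Letter.relabel f x) = overBranch u x := by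
    intro u x
    simp only [overBranch, Letter.relabel, Letter.overSign, f.injective.eq_iff]
    by_cases h : x.label = u
    · simp only [h, if_true]; rfl
    · simp only [h, if_false]
  have hT : ∀ u v, overInterlacement (A.map (Letter.relabel f)) (f u) (f v) =
      overInterlacement A u v := by
    intro u v
    by_cases huv : u = v
    · rw [huv, overInterlacement_self, overInterlacement_self]
    · rw [overInterlacement_of_ne huv, overInterlacement_of_ne (fun h => huv (f.injective h)), sum₂_map]
      simp only [hb]
  rw [codeWeight, codeWeight, weightSum, hV]
  simp only [sum_map, Equiv.coe_toEmbedding, hs, hT]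
  rfl

/-- The two passages of the new crossing are adjacent, so it interlaces with nothing: an isolated
vertex of the graph. -/
lemma codeWeight_r1 {A B : List Letter} {x : Letter} (h : IsGaussCode (A ++ [x, x.flip] ++ B)) :
    codeWeight (A ++ [x, x.flip] ++ B) = codeWeight (A ++ B) := by
  classical
  have hp : (A ++ [x, x.flip] ++ B).Perm (x :: x.flip :: (A ++ B)) := by
    rw [List.perm_iff_count]
    intro z
    simp only [List.count_append, List.count_cons, List.count_nil]
    omega
  have hne := h.label_ne_of_perm hp
  have hA : ∀ y ∈ A, y.label ≠ x.label := fun y hy => hne y (by simp [hy])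
  have hB : ∀ y ∈ B, y.label ≠ x.label := fun y hy => hne y (by simp [hy])
  have hxV : x.label ∉ crossings (A ++ B) := by
    rw [IsGaussCode.mem_crossings]
    rintro ⟨y, hy, hyx⟩
    exact hne y hy hyx
  have hV : crossings (A ++ [x, x.flip] ++ B) = insert x.label (crossings (A ++ B)) := by
    rw [crossings_perm hp]
    simp [crossings, Letter.flip]
  have hT : ∀ k, overInterlacement (A ++ [x, x.flip] ++ B) x.label k = 0 := by
    intro k
    by_cases hk : x.label = k
    · rw [← hk, overInterlacement_self]
    · rw [overInterlacement_append hk, overInterlacement_append hk, overInterlacement_left hA,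
        overInterlacement_left hB, overInterlacement_pair hk, overBranch_flip,
        overBranch_of_ne (u := k) hk]
      simp only [overHeight_append, overHeight_eq_zero hA, overHeight_pair, overBranch_flip]
      ring
  rw [codeWeight, hV, weightSum_insert hxV h.overInterlacement_skew hT, codeWeight]
  have hne' : ∀ i ∈ crossings (A ++ B), x.label ≠ i := fun i hi => (ne_of_mem_of_not_mem hi hxV).symm
  refine weightSum_congr (fun i hi => ?_) fun i hi j hj => ?_
  · exact IsGaussCode.codeSign_eq_of_perm (D := [x, x.flip]) hp (by
      simp [Letter.flip, hne' i hi])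
  · by_cases hij : i = j
    · rw [hij, overInterlacement_self, overInterlacement_self]
    · simp only [overInterlacement_append hij, overHeight_append, overHeight_pair,
        overInterlacement_pair hij, overBranch_flip, overBranch_of_ne (hne' i hi),
        overBranch_of_ne (hne' j hj)]
      ring

/-- Two crossings of opposite sign that are passed in succession twice. -/
lemma codeWeight_r2 {A B C X Y : List Letter} {x y : Letter} (h : IsGaussCode (A ++ X ++ B ++ Y ++ C))
    (hX : X = [x, y]) (hY : Y = [x.flip, y.flip] ∨ Y = [y.flip, x.flip])
    (hover : x.isOver = y.isOver) (hsign : y.sign = -x.sign) :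
    codeWeight (A ++ X ++ B ++ Y ++ C) = codeWeight (A ++ B ++ C) := by
  classical
  have hYp : Y.Perm [x.flip, y.flip] := by
    rcases hY with rfl | rfl
    exacts [List.Perm.refl _, List.Perm.swap _ _ _]
  have hp : (A ++ X ++ B ++ Y ++ C).Perm (x :: x.flip :: y :: y.flip :: (A ++ B ++ C)) := by
    rw [List.perm_iff_count]
    intro z
    have := hYp.count_eq z
    simp only [List.count_append, List.count_cons, List.count_nil, this, hX]
    omega
  have hp' : (A ++ X ++ B ++ Y ++ C).Perm (y :: y.flip :: x :: x.flip :: (A ++ B ++ C)) := by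
    refine hp.trans ?_
    rw [List.perm_iff_count]
    intro z
    simp only [List.count_cons]
    omega
  have hxy : x.label ≠ y.label := fun h' => by
    have := h.sign_eq x (hp.mem_iff.mpr (by simp)) y (hp.mem_iff.mpr (by simp)) h'
    rw [hsign] at this
    rcases Int.units_eq_one_or x.sign with e | e <;> rw [e] at this <;> revert this <;> decide
  have hnx : ∀ z ∈ A ++ B ++ C, z.label ≠ x.label := fun z hz =>
    h.label_ne_of_perm hp z (List.mem_cons_of_mem _ (List.mem_cons_of_mem _ hz))
  have hny : ∀ z ∈ A ++ B ++ C, z.label ≠ y.label := fun z hz =>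
    h.label_ne_of_perm hp' z (List.mem_cons_of_mem _ (List.mem_cons_of_mem _ hz))
  simp only [List.mem_append] at hnx hny
  have hmem : ∀ {k}, k ∈ crossings (A ++ B ++ C) ↔ ∃ z, ((z ∈ A ∨ z ∈ B) ∨ z ∈ C) ∧ z.label = k := by
    intro k
    rw [IsGaussCode.mem_crossings]
    simp only [List.mem_append]
  have hxV : x.label ∉ crossings (A ++ B ++ C) := by
    rw [hmem]; rintro ⟨z, hz, hzx⟩; exact hnx z hz hzx
  have hyV : y.label ∉ crossings (A ++ B ++ C) := by
    rw [hmem]; rintro ⟨z, hz, hzx⟩; exact hny z hz hzx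
  have hV : crossings (A ++ X ++ B ++ Y ++ C) = insert x.label (insert y.label (crossings (A ++ B ++ C))) := by
    rw [crossings_perm hp]
    simp [crossings, Letter.flip]
  have hYb : ∀ u, overHeight u Y = -overBranch u x - overBranch u y := by
    intro u
    rcases hY with rfl | rfl <;> rw [overHeight_pair, overBranch_flip, overBranch_flip] <;> ring
  have hXb : ∀ u, overHeight u X = overBranch u x + overBranch u y := by
    intro u
    rw [hX, overHeight_pair]
  have hXT : ∀ u v, u ≠ v → overInterlacement X u v = overBranch u x * overBranch v y := by
    intro u v huv
    rw [hX, overInterlacement_pair huv]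
  have hYT : ∀ u v, u ≠ v → overInterlacement Y u v = overBranch u x * overBranch v y ∨
      overInterlacement Y u v = overBranch u y * overBranch v x := by
    intro u v huv
    rcases hY with rfl | rfl
    · left; rw [overInterlacement_pair huv, overBranch_flip, overBranch_flip]; ring
    · right; rw [overInterlacement_pair huv, overBranch_flip, overBranch_flip]; ring
  have hov : x.overSign = y.overSign := by rw [Letter.overSign, Letter.overSign, hover]
  have hrow : ∀ k ∈ crossings (A ++ B ++ C),
      overInterlacement (A ++ X ++ B ++ Y ++ C) x.label k =
        overInterlacement (A ++ X ++ B ++ Y ++ C) y.label k := by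
    intro k hk
    have hkx : x.label ≠ k := (ne_of_mem_of_not_mem hk hxV).symm
    have hky : y.label ≠ k := (ne_of_mem_of_not_mem hk hyV).symm
    have e1 : overInterlacement Y x.label k = 0 := by
      rcases hYT _ _ hkx with e | e
      · rw [e, overBranch_of_ne hky, mul_zero]
      · rw [e, overBranch_of_ne hkx, mul_zero]
    have e2 : overInterlacement Y y.label k = 0 := by
      rcases hYT _ _ hky with e | e
      · rw [e, overBranch_of_ne hky, mul_zero]
      · rw [e, overBranch_of_ne hkx, mul_zero]
    simp only [overInterlacement_append hkx, overInterlacement_append hky, overHeight_append, hXT _ _ hkx,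
      hXT _ _ hky, e1, e2, hXb, hYb, overBranch_self, overBranch_of_ne hxy, overBranch_of_ne hxy.symm,
      overBranch_of_ne hkx, overBranch_of_ne hky,
      overInterlacement_left (u := x.label) (l := A) (fun z hz => hnx z (by tauto)),
      overInterlacement_left (u := x.label) (l := B) (fun z hz => hnx z (by tauto)),
      overInterlacement_left (u := x.label) (l := C) (fun z hz => hnx z (by tauto)),
      overInterlacement_left (u := y.label) (l := A) (fun z hz => hny z (by tauto)),
      overInterlacement_left (u := y.label) (l := B) (fun z hz => hny z (by tauto)),
      overInterlacement_left (u := y.label) (l := C) (fun z hz => hny z (by tauto)),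
      overHeight_eq_zero (u := x.label) (l := A) (fun z hz => hnx z (by tauto)),
      overHeight_eq_zero (u := x.label) (l := B) (fun z hz => hnx z (by tauto)),
      overHeight_eq_zero (u := y.label) (l := A) (fun z hz => hny z (by tauto)),
      overHeight_eq_zero (u := y.label) (l := B) (fun z hz => hny z (by tauto)), hov]
    ring
  have hsxy : codeSign (A ++ X ++ B ++ Y ++ C) y.label =
      -codeSign (A ++ X ++ B ++ Y ++ C) x.label := by
    rw [h.codeSign_eq (hp.mem_iff.mpr (by simp)), h.codeSign_eq (hp.mem_iff.mpr (by simp)), hsign]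
    simp
  rw [codeWeight, hV, weightSum_insert_pair hxV hyV hxy h.overInterlacement_skew
    h.overInterlacement_cases hrow hsxy, codeWeight]
  have hne' : ∀ i ∈ crossings (A ++ B ++ C), x.label ≠ i ∧ y.label ≠ i := fun i hi =>
    ⟨(ne_of_mem_of_not_mem hi hxV).symm, (ne_of_mem_of_not_mem hi hyV).symm⟩
  refine weightSum_congr (fun i hi => ?_) fun i hi j hj => ?_
  · exact IsGaussCode.codeSign_eq_of_perm (D := [x, x.flip, y, y.flip]) hp (by
      simp [Letter.flip, hne' i hi])
  · by_cases hij : i = j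
    · rw [hij, overInterlacement_self, overInterlacement_self]
    · have e1 : overInterlacement Y i j = 0 := by
        rcases hYT _ _ hij with e | e
        · rw [e, overBranch_of_ne (hne' i hi).1, zero_mul]
        · rw [e, overBranch_of_ne (hne' i hi).2, zero_mul]
      simp only [overInterlacement_append hij, overHeight_append, hXT _ _ hij, e1, hXb, hYb,
        overBranch_of_ne (hne' i hi).1, overBranch_of_ne (hne' i hi).2, overBranch_of_ne (hne' j hj).1,
        overBranch_of_ne (hne' j hj).2]
      ring

end KnotTheory

namespace KnotTheory

open Finset

/-! #### The third move -/

lemma sum_insert₃ {V : Finset ℕ} {a b c : ℕ} (hab : a ≠ b) (hac : a ≠ c) (hbc : b ≠ c) (ha : a ∉ V)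
    (hb : b ∉ V) (hc : c ∉ V) (f : ℕ → ℤ) :
    ∑ i ∈ insert a (insert b (insert c V)), f i = f a + f b + f c + ∑ i ∈ V, f i := by
  rw [sum_insert (by simp [hab, hac, ha]), sum_insert (by simp [hbc, hb]), sum_insert hc]
  ring

/-- The sum over all triples of a symmetric function that vanishes on triples with a repetition and
on triples with at most one entry outside `V`. -/
lemma sum_symmetric {V : Finset ℕ} {a b c : ℕ} (hab : a ≠ b) (hac : a ≠ c) (hbc : b ≠ c) (ha : a ∉ V)
    (hb : b ∉ V) (hc : c ∉ V) {F : ℕ → ℕ → ℕ → ℤ} (h₁ : ∀ i j k, F j i k = F i j k)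
    (h₂ : ∀ i j k, F i k j = F i j k) (h₃ : ∀ i j, F i i j = 0)
    (h₄ : ∀ i, ∀ j ∈ V, ∀ k ∈ V, F i j k = 0) :
    ∑ i ∈ insert a (insert b (insert c V)), ∑ j ∈ insert a (insert b (insert c V)),
      ∑ k ∈ insert a (insert b (insert c V)), F i j k =
        6 * (∑ k ∈ V, (F a b k + F b c k + F a c k) + F a b c) := by
  have s₁ : ∀ x, ∑ j ∈ V, ∑ k ∈ V, F x j k = 0 := fun x =>
    sum_eq_zero fun j hj => sum_eq_zero fun k hk => h₄ x j hj k hk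
  have s₂ : ∀ x, ∑ j ∈ V, ∑ k ∈ V, F j x k = 0 := fun x => by
    simp only [h₁ x]; exact s₁ x
  have m₁ : ∀ x y, ∑ k ∈ V, F x k y = ∑ k ∈ V, F x y k := fun x y =>
    sum_congr rfl fun k _ => h₂ x y k
  have m₂ : ∀ x y, ∑ k ∈ V, F k x y = ∑ k ∈ V, F x y k := fun x y =>
    (sum_congr rfl fun k _ => h₁ x k y).trans (m₁ x y)
  have z₂ : ∀ i j, F i j i = 0 := fun i j => by rw [h₂, h₃]
  have z₃ : ∀ i j, F j i i = 0 := fun i j => by rw [← h₁, z₂]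
  have e₁ : ∀ k, F b a k = F a b k := h₁ a b
  have e₂ : ∀ k, F c a k = F a c k := h₁ a c
  have e₃ : ∀ k, F c b k = F b c k := h₁ b c
  have e₄ : F a c b = F a b c := h₂ a b c
  have e₅ : F b c a = F a b c := by rw [h₂, h₁]
  simp only [sum_insert₃ hab hac hbc ha hb hc, sum_add_distrib, s₁, s₂, m₁, m₂, h₃, z₂, z₃,
    e₁, e₂, e₃, e₄, e₅, sum_const_zero]
  ring

lemma overHeight_strand (k : ℕ) (e : ℤˣ) (x y : Letter) :
    overHeight k (strand e x y) = overBranch k x + overBranch k y := by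
  rw [strand]
  split_ifs
  · exact overHeight_pair k x y
  · rw [overHeight_pair, add_comm]

lemma overInterlacement_strand {i j : ℕ} (h : i ≠ j) (e : ℤˣ) (x y : Letter) :
    overInterlacement (strand e x y) i j =
      if e = 1 then overBranch i x * overBranch j y else overBranch i y * overBranch j x := by
  rw [strand]
  split_ifs
  · exact overInterlacement_pair h x y
  · exact overInterlacement_pair h y x

lemma strand_perm (e : ℤˣ) (x y : Letter) : (strand e x y).Perm [x, y] := by
  rw [strand]
  split_ifs
  · exact List.Perm.refl _
  · exact List.Perm.swap _ _ _

/-- A code with three strands that pass pairwise through the crossings of `x`, `y` and `z`. -/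
def triangleCode (A B C D : List Letter) (x y z : Letter) (t m u : ℤˣ) : List Letter :=
  A ++ strand t x y ++ B ++ strand m x.flip z ++ C ++ strand u y.flip z.flip ++ D

section Triangle

variable {A B C D : List Letter} {x y z : Letter} {t m u : ℤˣ}

lemma triangleCode_perm (A B C D : List Letter) (x y z : Letter) (t m u : ℤˣ) :
    (triangleCode A B C D x y z t m u).Perm
      ([x, x.flip, y, y.flip, z, z.flip] ++ (A ++ B ++ C ++ D)) := by
  classical
  rw [List.perm_iff_count]
  intro v
  have h1 := (strand_perm t x y).count_eq v
  have h2 := (strand_perm m x.flip z).count_eq v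
  have h3 := (strand_perm u y.flip z.flip).count_eq v
  simp only [triangleCode, List.count_append, h1, h2, h3, List.count_cons, List.count_nil]
  omega

/-- The labels of the three crossings of a triangle occur nowhere else. -/
structure IsTriangle (A B C D : List Letter) (x y z : Letter) : Prop where
  hxy : x.label ≠ y.label
  hxz : x.label ≠ z.label
  hyz : y.label ≠ z.label
  hx : ∀ v ∈ A ++ B ++ C ++ D, v.label ≠ x.label
  hy : ∀ v ∈ A ++ B ++ C ++ D, v.label ≠ y.label
  hz : ∀ v ∈ A ++ B ++ C ++ D, v.label ≠ z.label

lemma IsGaussCode.isTriangle (h : IsGaussCode (triangleCode A B C D x y z t m u)) :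
    IsTriangle A B C D x y z := by
  classical
  have hp := triangleCode_perm A B C D x y z t m u
  have h1 := h.label_ne_of_perm hp
  have h2 := h.label_ne_of_perm (x := y) (r := [x, x.flip, z, z.flip] ++ (A ++ B ++ C ++ D))
    (hp.trans (by
      rw [List.perm_iff_count]
      intro v
      simp only [List.count_append, List.count_cons, List.count_nil]
      omega))
  have h3 := h.label_ne_of_perm (x := z) (r := [x, x.flip, y, y.flip] ++ (A ++ B ++ C ++ D))
    (hp.trans (by
      rw [List.perm_iff_count]
      intro v
      simp only [List.count_append, List.count_cons, List.count_nil]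
      omega))
  exact ⟨(h1 y (by simp)).symm, (h1 z (by simp)).symm, (h2 z (by simp)).symm,
    fun v hv => h1 v (List.mem_append_right _ hv), fun v hv => h2 v (List.mem_append_right _ hv),
    fun v hv => h3 v (List.mem_append_right _ hv)⟩

namespace IsTriangle

/-- Two corners share one strand, and their interlacement depends only on its direction; the order
of their other passages is fixed by the order of the strands. -/
lemma interlacement_corners (h : IsTriangle A B C D x y z) (hx : x.isOver = true)
    (hy : y.isOver = true) (hz : z.isOver = true) :
    overInterlacement (triangleCode A B C D x y z t m u) x.label y.label = (if t = 1 then 1 else 0) ∧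
    overInterlacement (triangleCode A B C D x y z t m u) x.label z.label = (if m = 1 then 0 else 1) ∧
    overInterlacement (triangleCode A B C D x y z t m u) y.label z.label = (if u = 1 then 1 else 0) := by
  obtain ⟨hxy, hxz, hyz, hx', hy', hz'⟩ := h
  simp only [List.mem_append] at hx' hy' hz'
  have ex : x.overSign = 1 := if_pos hx
  have ey : y.overSign = 1 := if_pos hy
  have ez : z.overSign = 1 := if_pos hz
  refine ⟨?_, ?_, ?_⟩
  · simp only [triangleCode, overInterlacement_append hxy, overHeight_append, overHeight_strand,
      overInterlacement_strand hxy, overBranch_flip, overBranch_self, overBranch_of_ne hxy,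
      overBranch_of_ne hxy.symm, overBranch_of_ne hxz.symm, overBranch_of_ne hyz.symm,
      overInterlacement_left (u := x.label) (l := A) (fun v hv => hx' v (by tauto)),
      overInterlacement_left (u := x.label) (l := B) (fun v hv => hx' v (by tauto)),
      overInterlacement_left (u := x.label) (l := C) (fun v hv => hx' v (by tauto)),
      overInterlacement_left (u := x.label) (l := D) (fun v hv => hx' v (by tauto)),
      overHeight_eq_zero (u := x.label) (l := A) (fun v hv => hx' v (by tauto)),
      overHeight_eq_zero (u := x.label) (l := B) (fun v hv => hx' v (by tauto)),
      overHeight_eq_zero (u := x.label) (l := C) (fun v hv => hx' v (by tauto)),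
      overHeight_eq_zero (u := y.label) (l := B) (fun v hv => hy' v (by tauto)),
      overHeight_eq_zero (u := y.label) (l := C) (fun v hv => hy' v (by tauto)),
      overHeight_eq_zero (u := y.label) (l := D) (fun v hv => hy' v (by tauto)), ex, ey]
    split_ifs <;> norm_num
  · simp only [triangleCode, overInterlacement_append hxz, overHeight_append, overHeight_strand,
      overInterlacement_strand hxz, overBranch_flip, overBranch_self, overBranch_of_ne hxz,
      overBranch_of_ne hxz.symm, overBranch_of_ne hxy.symm, overBranch_of_ne hyz,
      overInterlacement_left (u := x.label) (l := A) (fun v hv => hx' v (by tauto)),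
      overInterlacement_left (u := x.label) (l := B) (fun v hv => hx' v (by tauto)),
      overInterlacement_left (u := x.label) (l := C) (fun v hv => hx' v (by tauto)),
      overInterlacement_left (u := x.label) (l := D) (fun v hv => hx' v (by tauto)),
      overHeight_eq_zero (u := x.label) (l := A) (fun v hv => hx' v (by tauto)),
      overHeight_eq_zero (u := x.label) (l := B) (fun v hv => hx' v (by tauto)),
      overHeight_eq_zero (u := x.label) (l := C) (fun v hv => hx' v (by tauto)),
      overHeight_eq_zero (u := z.label) (l := B) (fun v hv => hz' v (by tauto)),
      overHeight_eq_zero (u := z.label) (l := C) (fun v hv => hz' v (by tauto)),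
      overHeight_eq_zero (u := z.label) (l := D) (fun v hv => hz' v (by tauto)), ex, ez]
    split_ifs <;> norm_num
  · simp only [triangleCode, overInterlacement_append hyz, overHeight_append, overHeight_strand,
      overInterlacement_strand hyz, overBranch_flip, overBranch_self, overBranch_of_ne hxz,
      overBranch_of_ne hyz.symm, overBranch_of_ne hxy, overBranch_of_ne hyz,
      overInterlacement_left (u := y.label) (l := A) (fun v hv => hy' v (by tauto)),
      overInterlacement_left (u := y.label) (l := B) (fun v hv => hy' v (by tauto)),
      overInterlacement_left (u := y.label) (l := C) (fun v hv => hy' v (by tauto)),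
      overInterlacement_left (u := y.label) (l := D) (fun v hv => hy' v (by tauto)),
      overHeight_eq_zero (u := y.label) (l := A) (fun v hv => hy' v (by tauto)),
      overHeight_eq_zero (u := y.label) (l := B) (fun v hv => hy' v (by tauto)),
      overHeight_eq_zero (u := y.label) (l := C) (fun v hv => hy' v (by tauto)),
      overHeight_eq_zero (u := z.label) (l := B) (fun v hv => hz' v (by tauto)),
      overHeight_eq_zero (u := z.label) (l := C) (fun v hv => hz' v (by tauto)),
      overHeight_eq_zero (u := z.label) (l := D) (fun v hv => hz' v (by tauto)), ey, ez]
    split_ifs <;> norm_num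

/-- Seen from outside, the loop at x is B, the loop at z is C and the loop at y is both together.
The directions of the strands do not enter. -/
lemma interlacement_outside (h : IsTriangle A B C D x y z) (hx : x.isOver = true)
    (hy : y.isOver = true) (hz : z.isOver = true) {k : ℕ} (hkx : x.label ≠ k) (hky : y.label ≠ k)
    (hkz : z.label ≠ k) :
    overInterlacement (triangleCode A B C D x y z t m u) x.label k = overHeight k B ∧
    overInterlacement (triangleCode A B C D x y z t m u) y.label k =
      overHeight k B + overHeight k C ∧
    overInterlacement (triangleCode A B C D x y z t m u) z.label k = overHeight k C := by
  obtain ⟨hxy, hxz, hyz, hx', hy', hz'⟩ := h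
  simp only [List.mem_append] at hx' hy' hz'
  have ex : x.overSign = 1 := if_pos hx
  have ey : y.overSign = 1 := if_pos hy
  have ez : z.overSign = 1 := if_pos hz
  refine ⟨?_, ?_, ?_⟩
  · simp only [triangleCode, overInterlacement_append hkx, overHeight_append, overHeight_strand,
      overInterlacement_strand hkx, overBranch_flip, overBranch_self, overBranch_of_ne hkx,
      overBranch_of_ne hky, overBranch_of_ne hkz, overBranch_of_ne hxy.symm, overBranch_of_ne hxz.symm,
      overInterlacement_left (u := x.label) (l := A) (fun v hv => hx' v (by tauto)),
      overInterlacement_left (u := x.label) (l := B) (fun v hv => hx' v (by tauto)),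
      overInterlacement_left (u := x.label) (l := C) (fun v hv => hx' v (by tauto)),
      overInterlacement_left (u := x.label) (l := D) (fun v hv => hx' v (by tauto)),
      overHeight_eq_zero (u := x.label) (l := A) (fun v hv => hx' v (by tauto)),
      overHeight_eq_zero (u := x.label) (l := B) (fun v hv => hx' v (by tauto)),
      overHeight_eq_zero (u := x.label) (l := C) (fun v hv => hx' v (by tauto)), ex]
    split_ifs <;> ring
  · simp only [triangleCode, overInterlacement_append hky, overHeight_append, overHeight_strand,
      overInterlacement_strand hky, overBranch_flip, overBranch_self, overBranch_of_ne hkx,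
      overBranch_of_ne hky, overBranch_of_ne hkz, overBranch_of_ne hxy, overBranch_of_ne hyz.symm,
      overInterlacement_left (u := y.label) (l := A) (fun v hv => hy' v (by tauto)),
      overInterlacement_left (u := y.label) (l := B) (fun v hv => hy' v (by tauto)),
      overInterlacement_left (u := y.label) (l := C) (fun v hv => hy' v (by tauto)),
      overInterlacement_left (u := y.label) (l := D) (fun v hv => hy' v (by tauto)),
      overHeight_eq_zero (u := y.label) (l := A) (fun v hv => hy' v (by tauto)),
      overHeight_eq_zero (u := y.label) (l := B) (fun v hv => hy' v (by tauto)),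
      overHeight_eq_zero (u := y.label) (l := C) (fun v hv => hy' v (by tauto)), ey]
    split_ifs <;> ring
  · simp only [triangleCode, overInterlacement_append hkz, overHeight_append, overHeight_strand,
      overInterlacement_strand hkz, overBranch_flip, overBranch_self, overBranch_of_ne hkx,
      overBranch_of_ne hky, overBranch_of_ne hkz, overBranch_of_ne hxz, overBranch_of_ne hyz,
      overInterlacement_left (u := z.label) (l := A) (fun v hv => hz' v (by tauto)),
      overInterlacement_left (u := z.label) (l := B) (fun v hv => hz' v (by tauto)),
      overInterlacement_left (u := z.label) (l := C) (fun v hv => hz' v (by tauto)),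
      overInterlacement_left (u := z.label) (l := D) (fun v hv => hz' v (by tauto)),
      overHeight_eq_zero (u := z.label) (l := A) (fun v hv => hz' v (by tauto)),
      overHeight_eq_zero (u := z.label) (l := B) (fun v hv => hz' v (by tauto)),
      overHeight_eq_zero (u := z.label) (l := C) (fun v hv => hz' v (by tauto)), ez]
    split_ifs <;> ring

end IsTriangle

/-- Away from the corners of a triangle the directions of its sides do not matter. -/
lemma interlacement_triangleCode {i j : ℕ} (hix : x.label ≠ i) (hiy : y.label ≠ i) (hiz : z.label ≠ i)
    (hjx : x.label ≠ j) (hjy : y.label ≠ j) (hjz : z.label ≠ j) :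
    overInterlacement (triangleCode A B C D x y z t m u) i j =
      overInterlacement (A ++ B ++ C ++ D) i j := by
  by_cases hij : i = j
  · rw [hij, overInterlacement_self, overInterlacement_self]
  simp only [triangleCode, overInterlacement_append hij, overHeight_append, overHeight_strand,
    overInterlacement_strand hij, overBranch_flip, overBranch_of_ne hix, overBranch_of_ne hiy,
    overBranch_of_ne hiz, overBranch_of_ne hjx, overBranch_of_ne hjy, overBranch_of_ne hjz]
  split_ifs <;> ring

lemma passCount_ne_zero {k : ℕ} {l : List Pass} (h : passCount k l ≠ 0) : ∃ v ∈ l, v.label = k := by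
  contrapose! h
  exact passCount_eq_zero h

/-- For a crossing that X shares with the rest of the curve, the height on X is its sign and the
squared height on Y tells whether the other passage is in Y. All other crossings have height zero on
X. -/
lemma IsCurve.cross_eq_sum_sq {X Y Z : List Pass} {V : Finset ℕ} (h : IsCurve (X ++ (Y ++ Z)))
    (hf : ∀ v ∈ X ++ (Y ++ Z), v.fwd = true) (hV : ∀ v ∈ X, v.label ∈ V) :
    cross X Y = ∑ k ∈ V, height k X * height k Y ^ 2 := by
  have h' : IsCurve (Y ++ (Z ++ X)) := h.of_perm (List.Perm.map _ (by
    rw [← List.append_assoc Y Z X]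
    exact List.perm_append_comm))
  have hf' : ∀ v ∈ Y ++ (Z ++ X), v.fwd = true := fun v hv => hf v (by
    simp only [List.mem_append] at hv ⊢; tauto)
  rw [cross, sum₁_eq_sum _ hV]
  refine sum_congr rfl fun k _ => ?_
  have e : ∀ a ∈ X, (if a.label = k then 1 else 0) * sum₁ (eps a) Y =
      (if a.label = k then 1 else 0) * (height k X * passCount k Y) := by
    intro a ha
    rw [← sum₁_mul_left, sum₁_congr fun c hc => h.ite_mul_eps hf k ha (List.mem_append_left _ hc)]
    simp only [sum₁_mul_left]
    rw [passCount]; ring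
  rw [sum₁_congr e, sum₁_mul_right, ← passCount]
  rcases h.mixed_or hf k with ⟨h1, -⟩ | ⟨h1, -⟩
  swap
  · rw [h1]; ring
  rcases h'.mixed_or hf' k with ⟨h2, -, h3, -⟩ | ⟨h2, -, h3⟩
  · rw [h1, h2, pow_two, h3]; ring
  · rw [h2]
    have : passCount k Y = 0 := by
      by_contra hne
      obtain ⟨v, hv, hvk⟩ := passCount_ne_zero hne
      obtain ⟨w, hw, hwk⟩ := passCount_ne_zero (l := X) (k := k) (by rw [h1]; exact one_ne_zero)
      exact h3 v hv w (by simp [hw]) hvk hwk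
    rw [this]; ring

lemma IsGaussCode.height_shadow {w l : List Letter} (h : IsGaussCode w) (hl : ∀ v ∈ l, v ∈ w) {k : ℕ}
    (hk : k ∈ crossings w) : height k (l.map shadow) = codeSign w k * overHeight k l := by
  rw [height, sum₁_map, overHeight, ← sum₁_mul_left]
  refine sum₁_congr fun v hv => ?_
  rw [overBranch, h.overSign_eq (hl v hv), ← mul_assoc, ← pow_two, h.codeSign_sq hk, one_mul]

lemma eps_shadow_flip {v : Letter} (hv : v.isOver = true) : eps (shadow v) (shadow v.flip) = v.sign := by
  have hm := match_shadow_flip v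
  rw [eps, if_pos ⟨hm.1.symm, fun h => hm.2 h.symm⟩]
  obtain ⟨i, b, s⟩ := v
  rcases Int.units_eq_one_or s with rfl | rfl <;> simp_all [shadow, Letter.IsFst, sg]

/-- The disjoint loops at two corners of a triangle do not cross. -/
lemma IsGaussCode.sum_triangleCode (h : IsGaussCode (triangleCode A B C D x y z t 1 u))
    (hc : IsColourable ((triangleCode A B C D x y z t 1 u).map shadow)) (hy : y.isOver = true) :
    ∑ k ∈ crossings (A ++ B ++ C ++ D), codeSign (triangleCode A B C D x y z t 1 u) k *
      (overHeight k B * overHeight k C ^ 2) = -if t = 1 ∧ u = 1 then (y.sign : ℤ) else 0 := by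
  have hp := triangleCode_perm A B C D x y z t 1 u
  have ht := h.isTriangle
  have hcur := h.isCurve
  set w := triangleCode A B C D x y z t 1 u with hw
  have hmem : ∀ v, v ∈ A ++ B ++ C ++ D → v ∈ w := fun v hv =>
    hp.mem_iff.mpr (List.mem_append_right _ hv)
  have hy' := ht.hy
  simp only [List.mem_append] at hy'
  have e1 : cross (B.map shadow) (C.map shadow) =
      ∑ k ∈ crossings (A ++ B ++ C ++ D), codeSign w k * (overHeight k B * overHeight k C ^ 2) := by
    have hperm : w.Perm (B ++ (C ++ ([x, x.flip, y, y.flip, z, z.flip] ++ A ++ D))) := by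
      classical
      refine hp.trans ?_
      rw [List.perm_iff_count]
      intro v
      simp only [List.count_append]
      omega
    have hcur' := (h.perm hperm).isCurve
    have hf := shadow_fwd (B ++ (C ++ ([x, x.flip, y, y.flip, z, z.flip] ++ A ++ D)))
    rw [List.map_append, List.map_append (l₁ := C)] at hcur' hf
    rw [hcur'.cross_eq_sum_sq hf (V := crossings (A ++ B ++ C ++ D))]
    · refine sum_congr rfl fun k hk => ?_
      have hkw : k ∈ crossings w := by
        obtain ⟨v, hv, hvk⟩ := mem_crossings.mp hk
        exact mem_crossings.mpr ⟨v, hmem v hv, hvk⟩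
      have hs := h.codeSign_sq hkw
      rw [h.height_shadow (fun v hv => hmem v (by simp [hv])) hkw,
        h.height_shadow (fun v hv => hmem v (by simp [hv])) hkw]
      linear_combination codeSign w k * overHeight k B * overHeight k C ^ 2 * hs
    · intro v hv
      obtain ⟨v', hv', rfl⟩ := List.mem_map.mp hv
      exact mem_crossings.mpr ⟨v', by simp [hv'], rfl⟩
  rw [← e1]
  have hyB : sum₁ (eps (shadow y.flip)) (B.map shadow) = 0 := by
    rw [sum₁_map]
    exact sum₁_eq_zero fun v hv => eps_of_label_ne (hy' v (by tauto)).symm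
  have hyB' : cross (B.map shadow) [shadow y.flip] = 0 := by
    rw [cross_swap, cross_cons_left, hyB]
    simp [cross, sum₁]
  have hyC : sum₁ (eps (shadow y)) (C.map shadow) = 0 := by
    rw [sum₁_map]
    exact sum₁_eq_zero fun v hv => eps_of_label_ne (hy' v (by tauto)).symm
  have hmx := match_shadow_flip x
  have hmz := match_shadow_flip z
  -- Since the middle strand has direction 1, the loop at x ends before the loop at z begins. These
  -- loops are B and C, enlarged by y if t = 1 and by y.flip if u = 1. Their intersection number is
  -- zero, and y itself is counted in it only when both hold.
  rcases Int.units_eq_one_or t with rfl | rfl <;> rcases Int.units_eq_one_or u with rfl | rfl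
  · have := IsColourable.cross_eq_zero_of_disjoint (P := A.map shadow) (Q := shadow y :: B.map shadow)
      (R := []) (S := C.map shadow ++ [shadow y.flip]) (T := D.map shadow)
      (by simpa [hw, triangleCode, strand] using hc) (by simpa [hw, triangleCode, strand] using hcur)
      hmx hmz
    rw [cross_cons_left, sum₁_append, hyC, cross_append_right, hyB'] at this
    simp only [sum₁, eps_shadow_flip hy] at this
    simp only [and_self, if_true]
    linarith
  · have := IsColourable.cross_eq_zero_of_disjoint (P := A.map shadow) (Q := shadow y :: B.map shadow)
      (R := []) (S := C.map shadow) (T := shadow y.flip :: D.map shadow)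
      (by simpa [hw, triangleCode, strand] using hc) (by simpa [hw, triangleCode, strand] using hcur)
      hmx hmz
    rw [cross_cons_left, hyC] at this
    rw [if_neg (by decide)]
    linarith
  · have := IsColourable.cross_eq_zero_of_disjoint (P := A.map shadow ++ [shadow y]) (Q := B.map shadow)
      (R := []) (S := C.map shadow ++ [shadow y.flip]) (T := D.map shadow)
      (by simpa [hw, triangleCode, strand] using hc) (by simpa [hw, triangleCode, strand] using hcur)
      hmx hmz
    rw [cross_append_right, hyB'] at this
    rw [if_neg (by decide)]
    linarith
  · have := IsColourable.cross_eq_zero_of_disjoint (P := A.map shadow ++ [shadow y]) (Q := B.map shadow)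
      (R := []) (S := C.map shadow) (T := shadow y.flip :: D.map shadow)
      (by simpa [hw, triangleCode, strand] using hc) (by simpa [hw, triangleCode, strand] using hcur)
      hmx hmz
    rw [if_neg (by decide)]
    linarith

end Triangle

end KnotTheory

/-! ### Invariance under the third move. -/

namespace KnotTheory

open Finset

/-- Here α, γ and α + γ are the entries of x, z and y against an outside crossing. The three triples
formed by it and two corners change together by a multiple of αγ², the summand in
`IsGaussCode.sum_triangleCode`. -/
lemma weight_triangle_outside (t m u : ℤˣ) {α γ : ℤ} (hα : α = -1 ∨ α = 0 ∨ α = 1)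
    (hγ : γ = -1 ∨ γ = 0 ∨ γ = 1) (hαγ : α + γ = -1 ∨ α + γ = 0 ∨ α + γ = 1) :
    (m * u : ℤ) * (weight (if -t = 1 then 1 else 0) (α + γ) (-α) -
        weight (if t = 1 then 1 else 0) (α + γ) (-α)) +
      (t * m : ℤ) * (weight (if -u = 1 then 1 else 0) γ (-(α + γ)) -
        weight (if u = 1 then 1 else 0) γ (-(α + γ))) +
      (t * u : ℤ) * (weight (if -m = 1 then 0 else 1) γ (-α) -
        weight (if m = 1 then 0 else 1) γ (-α)) = -2 * (t * m * u) * (α * γ ^ 2) := by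
  rcases Int.units_eq_one_or t with rfl | rfl <;> rcases Int.units_eq_one_or m with rfl | rfl <;>
  rcases Int.units_eq_one_or u with rfl | rfl <;> rcases hα with rfl | rfl | rfl <;>
  rcases hγ with rfl | rfl | rfl <;> first | decide | (exfalso; revert hαγ; decide)

/-- The triple of corners changes only if y joins the disjoint loops at x and z, before the move for
m = 1 and after it for m = -1. This is the correction term of the sum over outside crossings. -/
lemma weight_triangle_corners (t m u : ℤˣ) :
    weight (if -t = 1 then 1 else 0) (if -u = 1 then 1 else 0) (-(if -m = 1 then 0 else 1)) -
      weight (if t = 1 then 1 else 0) (if u = 1 then 1 else 0) (-(if m = 1 then 0 else 1)) =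
      2 * ((t * m * u : ℤ) * if m = 1 then (if t = 1 ∧ u = 1 then -1 else 0) else
        if -t = 1 ∧ -u = 1 then -1 else 0) := by
  rcases Int.units_eq_one_or t with rfl | rfl <;> rcases Int.units_eq_one_or m with rfl | rfl <;>
  rcases Int.units_eq_one_or u with rfl | rfl <;> decide

lemma sign_triangle : ∀ t m u p q r : ℤˣ, t * m * p = t * u * q → t * u * q = m * u * r →
    q = m * u * p ∧ r = t * u * p := by
  intro t m u p q r
  rcases Int.units_eq_one_or t with rfl | rfl <;> rcases Int.units_eq_one_or m with rfl | rfl <;>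
  rcases Int.units_eq_one_or u with rfl | rfl <;> rcases Int.units_eq_one_or p with rfl | rfl <;>
  rcases Int.units_eq_one_or q with rfl | rfl <;> rcases Int.units_eq_one_or r with rfl | rfl <;>
  decide

lemma codeWeight_triangleCode {A B C D : List Letter} {x y z : Letter} {t m u : ℤˣ}
    (h : IsGaussCode (triangleCode A B C D x y z t m u))
    (hc : IsColourable ((triangleCode A B C D x y z t m u).map shadow))
    (hc' : IsColourable ((triangleCode A B C D x y z (-t) (-m) (-u)).map shadow))
    (hx : x.isOver = true) (hy : y.isOver = true) (hz : z.isOver = true)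
    (hab : t * m * x.sign = t * u * y.sign) (hbc : t * u * y.sign = m * u * z.sign) :
    codeWeight (triangleCode A B C D x y z (-t) (-m) (-u)) =
      codeWeight (triangleCode A B C D x y z t m u) := by
  have hp := triangleCode_perm A B C D x y z t m u
  have hpp := hp.trans (triangleCode_perm A B C D x y z (-t) (-m) (-u)).symm
  have h' := h.perm hpp
  have ht := h.isTriangle
  obtain ⟨c1, c2, c3⟩ := ht.interlacement_corners (t := t) (m := m) (u := u) hx hy hz
  obtain ⟨d1, d2, d3⟩ := ht.interlacement_corners (t := -t) (m := -m) (u := -u) hx hy hz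
  have out := fun {k : ℕ} (h1 : x.label ≠ k) h2 h3 =>
    ht.interlacement_outside (t := t) (m := m) (u := u) hx hy hz h1 h2 h3
  have out' := fun {k : ℕ} (h1 : x.label ≠ k) h2 h3 =>
    ht.interlacement_outside (t := -t) (m := -m) (u := -u) hx hy hz h1 h2 h3
  have far := fun {i j : ℕ} (h1 : x.label ≠ i) h2 h3 h4 h5 h6 =>
    interlacement_triangleCode (A := A) (B := B) (C := C) (D := D) (x := x) (y := y) (z := z)
      (t := t) (m := m) (u := u) (i := i)
      (j := j) h1 h2 h3 h4 h5 h6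
  have far' := fun {i j : ℕ} (h1 : x.label ≠ i) h2 h3 h4 h5 h6 =>
    interlacement_triangleCode (A := A) (B := B) (C := C) (D := D) (x := x) (y := y) (z := z)
      (t := -t) (m := -m) (u := -u) (i := i)
      (j := j) h1 h2 h3 h4 h5 h6
  have hsx := h.codeSign_eq (hp.mem_iff.mpr (show x ∈ _ by simp))
  have hsy := h.codeSign_eq (hp.mem_iff.mpr (show y ∈ _ by simp))
  have hsz := h.codeSign_eq (hp.mem_iff.mpr (show z ∈ _ by simp))
  have hcs := codeSign_perm hpp
  have hVV := crossings_perm hpp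
  obtain ⟨hq, hr⟩ : (y.sign : ℤ) = m * u * x.sign ∧ (z.sign : ℤ) = t * u * x.sign := by
    obtain ⟨h1, h2⟩ := sign_triangle t m u _ _ _ hab hbc
    rw [h1, h2]
    push_cast
    exact ⟨rfl, rfl⟩
  have rel : (m : ℤ) * m = 1 ∧ (t : ℤ) * t = 1 ∧ (u : ℤ) * u = 1 ∧
      (x.sign : ℤ) * x.sign = 1 := by
    refine ⟨?_, ?_, ?_, ?_⟩ <;> exact Int.units_coe_mul_self _
  -- For m = -1 the loops at x and z are disjoint in the code after the move. The signs of the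
  -- crossings and the arcs B, C are common to both codes, so the sum is the same.
  have sum_out : ∑ k ∈ crossings (A ++ B ++ C ++ D),
      codeSign (triangleCode A B C D x y z t m u) k * (overHeight k B * overHeight k C ^ 2) =
      y.sign * if m = 1 then (if t = 1 ∧ u = 1 then -1 else 0) else
        if -t = 1 ∧ -u = 1 then -1 else 0 := by
    rcases Int.units_eq_one_or m with rfl | rfl
    · rw [h.sum_triangleCode hc hy, if_pos rfl]
      split_ifs <;> ring
    · rw [neg_neg] at hc' h' hcs
      rw [hcs, h'.sum_triangleCode hc' hy, if_neg (show ¬ (-1 : ℤˣ) = 1 by decide)]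
      split_ifs <;> ring
  have hV : crossings (triangleCode A B C D x y z t m u) =
      insert x.label (insert y.label (insert z.label (crossings (A ++ B ++ C ++ D)))) := by
    rw [crossings_perm hp]
    simp [crossings, Letter.flip]
  have hne : ∀ k ∈ crossings (A ++ B ++ C ++ D), x.label ≠ k ∧ y.label ≠ k ∧ z.label ≠ k := by
    intro k hk
    obtain ⟨v, hv, rfl⟩ := IsGaussCode.mem_crossings.mp hk
    exact ⟨(ht.hx v hv).symm, (ht.hy v hv).symm, (ht.hz v hv).symm⟩
  have hcase := h.overInterlacement_cases
  have hskew := h.overInterlacement_skew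
  have hskew' := h'.overInterlacement_skew
  have hcase' := h'.overInterlacement_cases
  rw [codeWeight, codeWeight, ← hcs, ← hVV, hV, ← sub_eq_zero]
  set w := triangleCode A B C D x y z t m u
  set w' := triangleCode A B C D x y z (-t) (-m) (-u)
  set V := crossings (A ++ B ++ C ++ D)
  set s := codeSign w
  set T := overInterlacement w
  set T' := overInterlacement w'
  have far'' : ∀ i, ∀ k ∈ V, T' i k = T i k := by
    intro i k hk
    obtain ⟨k1, k2, k3⟩ := hne k hk
    by_cases h1 : x.label = i
    · rw [← h1, (out k1 k2 k3).1, (out' k1 k2 k3).1]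
    by_cases h2 : y.label = i
    · rw [← h2, (out k1 k2 k3).2.1, (out' k1 k2 k3).2.1]
    by_cases h3 : z.label = i
    · rw [← h3, (out k1 k2 k3).2.2, (out' k1 k2 k3).2.2]
    rw [far h1 h2 h3 k1 k2 k3, far' h1 h2 h3 k1 k2 k3]
  have e1 : weightSum (insert x.label (insert y.label (insert z.label V))) s T' -
      weightSum (insert x.label (insert y.label (insert z.label V))) s T =
      ∑ i ∈ insert x.label (insert y.label (insert z.label V)),
      ∑ j ∈ insert x.label (insert y.label (insert z.label V)),
      ∑ k ∈ insert x.label (insert y.label (insert z.label V)),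
        s i * s j * s k * (weight (T' i j) (T' j k) (T' k i) - weight (T i j) (T j k) (T k i)) := by
    simp only [weightSum, ← sum_sub_distrib, mul_sub]
  rw [e1, sum_symmetric ht.hxy ht.hxz ht.hyz (fun hk => (hne _ hk).1 rfl)
    (fun hk => (hne _ hk).2.1 rfl) (fun hk => (hne _ hk).2.2 rfl)]
  -- Only triples with at least two corners change. The signs of the corners y and z are expressed
  -- through the sign of x, after which the three triples with a given outside crossing combine.
  · have hk : ∀ k ∈ V,
        s x.label * s y.label * s k * (weight (T' x.label y.label) (T' y.label k) (T' k x.label) -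
          weight (T x.label y.label) (T y.label k) (T k x.label)) +
        s y.label * s z.label * s k * (weight (T' y.label z.label) (T' z.label k) (T' k y.label) -
          weight (T y.label z.label) (T z.label k) (T k y.label)) +
        s x.label * s z.label * s k * (weight (T' x.label z.label) (T' z.label k) (T' k x.label) -
          weight (T x.label z.label) (T z.label k) (T k x.label)) =
        -2 * (t * m * u) * (s k * (overHeight k B * overHeight k C ^ 2)) := by
      intro k hk
      obtain ⟨k1, k2, k3⟩ := hne k hk
      have q1 := hcase x.label k
      have q2 := hcase y.label k
      have q3 := hcase z.label k
      have key := weight_triangle_outside t m u (α := overHeight k B) (γ := overHeight k C)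
        (by rw [← (out k1 k2 k3).1]; exact q1) (by rw [← (out k1 k2 k3).2.2]; exact q3)
        (by rw [← (out k1 k2 k3).2.1]; exact q2)
      obtain ⟨o1, o2, o3⟩ := out k1 k2 k3
      simp only [hskew' x.label k, hskew' y.label k, hskew x.label k, hskew y.label k, far'' _ k hk,
        o1, o2, o3, c1, c2, c3, d1, d2, d3, hsx, hsy, hsz, hq, hr]
      revert key
      generalize weight (if -t = 1 then 1 else 0) _ _ - _ = E₁
      generalize weight (if -u = 1 then 1 else 0) _ _ - _ = E₂
      generalize weight (if -m = 1 then 0 else 1) _ _ - _ = E₃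
      intro key
      linear_combination s k * key + (m * u * s k * E₁ + t * u * s k * E₃ +
        t * m * s k * E₂ * (u * u)) * rel.2.2.2 + t * m * s k * E₂ * rel.2.2.1
    rw [sum_congr rfl hk, ← mul_sum, sum_out, hskew x.label z.label, hskew' x.label z.label, c1, c2, c3,
      d1, d2, d3, weight_triangle_corners, hsx, hsy, hsz, hq, hr]
    -- The indicator is nonzero only if t = u, which reconciles the sign factor of y with that of
    -- the triple of corners.
    have htu : (t : ℤ) * (if m = 1 then (if t = 1 ∧ u = 1 then -1 else 0) else
        if -t = 1 ∧ -u = 1 then -1 else 0) = u * (if m = 1 then (if t = 1 ∧ u = 1 then -1 else 0) else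
        if -t = 1 ∧ -u = 1 then -1 else 0) := by
      rcases Int.units_eq_one_or t with rfl | rfl <;> rcases Int.units_eq_one_or m with rfl | rfl <;>
      rcases Int.units_eq_one_or u with rfl | rfl <;> decide
    revert htu
    generalize (if m = 1 then (if t = 1 ∧ u = 1 then -1 else 0) else
        if -t = 1 ∧ -u = 1 then (-1 : ℤ) else 0) = X
    intro htu
    rcases Int.units_eq_one_or t with rfl | rfl <;> rcases Int.units_eq_one_or m with rfl | rfl <;>
    rcases Int.units_eq_one_or u with rfl | rfl <;>
    rcases Int.units_eq_one_or x.sign with e | e <;> rw [e] <;> push_cast at htu ⊢ <;> linarith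
  · intro i j k
    rw [hskew' i j, hskew' k i, hskew' j k, hskew i j, hskew k i, hskew j k]
    simp only [weight]
    ring
  · intro i j k
    rw [hskew' i j, hskew' k i, hskew' j k, hskew i j, hskew k i, hskew j k]
    simp only [weight]
    ring
  · intro i j
    have h0 : T i i = 0 := overInterlacement_self _ _
    have h0' : T' i i = 0 := overInterlacement_self _ _
    rw [h0, h0', hskew i j, hskew' i j, (weight_eq_zero (Or.inr (Or.inl rfl)) (hcase i j)).1,
      (weight_eq_zero (Or.inr (Or.inl rfl)) (hcase' i j)).1]
    ring
  · intro i j hj k hk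
    rw [hskew' i k, far'' i k hk, hskew i k, far'' j k hk, far'' i j hj]
    ring

/-! ### Mirror images, and the third move in the other cyclic order. -/

/-- The passage in the mirror image, seen from the other side of the sphere. -/
def Letter.mirror (x : Letter) : Letter := ⟨x.label, !x.isOver, -x.sign⟩

lemma Letter.mirror_flip (x : Letter) : x.flip.mirror = x.mirror.flip := rfl

lemma Letter.mirror_mirror (x : Letter) : x.mirror.mirror = x := by
  ext <;> simp [Letter.mirror]

lemma shadow_mirror (x : Letter) : shadow x.mirror = shadow x := by
  obtain ⟨k, b, s⟩ := x
  rcases Int.units_eq_one_or s with rfl | rfl <;> cases b <;>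
    simp [shadow, Letter.mirror, Letter.IsFst]

lemma map_shadow_mirror (w : List Letter) : (w.map Letter.mirror).map shadow = w.map shadow := by
  rw [List.map_map]
  exact List.map_congr_left fun x _ => shadow_mirror x

lemma IsGaussCode.mirror {w : List Letter} (h : IsGaussCode w) : IsGaussCode (w.map Letter.mirror) := by
  refine ⟨h.nodup.map (Function.LeftInverse.injective Letter.mirror_mirror), ?_, ?_⟩
  · intro x hx
    obtain ⟨y, hy, rfl⟩ := List.mem_map.mp hx
    exact List.mem_map.mpr ⟨y.flip, h.flip_mem y hy, rfl⟩
  · intro x hx x' hx' hl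
    obtain ⟨y, hy, rfl⟩ := List.mem_map.mp hx
    obtain ⟨y', hy', rfl⟩ := List.mem_map.mp hx'
    exact congrArg Neg.neg (h.sign_eq y hy y' hy' hl)

/-- An interlacement is a product of two over/under signs and is unchanged, while the three crossing
signs in each triple all change. -/
lemma IsGaussCode.codeWeight_mirror {w : List Letter} (h : IsGaussCode w) :
    codeWeight (w.map Letter.mirror) = -codeWeight w := by
  have hV : crossings (w.map Letter.mirror) = crossings w := by
    rw [crossings, List.map_map]; rfl
  have hs : ∀ u ∈ crossings w, codeSign (w.map Letter.mirror) u = -codeSign w u := by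
    intro u hu
    obtain ⟨x, hx, rfl⟩ := mem_crossings.mp hu
    rw [h.codeSign_eq hx]
    refine (h.mirror.codeSign_eq (List.mem_map_of_mem hx)).trans ?_
    simp [Letter.mirror]
  have hb : ∀ u x, overBranch u (Letter.mirror x) = -overBranch u x := by
    intro u x
    by_cases hx : x.label = u
    · rw [overBranch, if_pos (show x.mirror.label = u from hx), overBranch, if_pos hx]
      obtain ⟨k, b, s⟩ := x
      cases b <;> rfl
    · rw [overBranch_of_ne hx, overBranch_of_ne (x := x.mirror) hx, neg_zero]
  have hT : overInterlacement (w.map Letter.mirror) = overInterlacement w := by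
    ext u v
    by_cases huv : u = v
    · rw [huv, overInterlacement_self, overInterlacement_self]
    · rw [overInterlacement_of_ne huv, overInterlacement_of_ne huv, sum₂_map]
      simp only [hb, neg_mul_neg]
  rw [codeWeight, hV, hT, weightSum_congr hs fun _ _ _ _ => rfl, codeWeight, weightSum, weightSum]
  simp only [← sum_neg_distrib]
  refine sum_congr rfl fun i _ => sum_congr rfl fun j _ => sum_congr rfl fun k _ => ?_
  ring

/-- A code with three strands as in `triangleCode`, in the other cyclic order. -/
def triangleCode' (A B C D : List Letter) (x y z : Letter) (t m u : ℤˣ) : List Letter :=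
  A ++ strand t x y ++ B ++ strand u y.flip z.flip ++ C ++ strand m x.flip z ++ D

lemma strand_neg (e : ℤˣ) (x y : Letter) : strand (-e) x y = strand e y x := by
  rcases Int.units_eq_one_or e with rfl | rfl <;> rfl

lemma map_strand (f : Letter → Letter) (e : ℤˣ) (x y : Letter) :
    (strand e x y).map f = strand e (f x) (f y) := by
  rcases Int.units_eq_one_or e with rfl | rfl <;> rfl

section Mirror

variable {A B C D : List Letter} {x y z : Letter} {t m u : ℤˣ}

/-- In the mirror image the bottom strand becomes the top one. Starting there puts the strands in
the other cyclic order, with x and z exchanged and each strand listed from its other end. -/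
lemma exists_mirror_triangleCode' (A B C D : List Letter) (x y z : Letter) (t m u : ℤˣ) :
    ∃ P Q, (triangleCode' A B C D x y z t m u).map Letter.mirror = P ++ Q ∧
      triangleCode [] (C.map Letter.mirror) ((D ++ A).map Letter.mirror) (B.map Letter.mirror)
        z.flip.mirror y.flip.mirror x.flip.mirror (-u) (-m) (-t) = Q ++ P := by
  refine ⟨(A ++ strand t x y ++ B).map Letter.mirror,
    (strand u y.flip z.flip ++ C ++ strand m x.flip z ++ D).map Letter.mirror, ?_, ?_⟩
  · rw [← List.map_append]
    simp [triangleCode']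
  · simp only [triangleCode, strand_neg, List.map_append, map_strand, List.nil_append,
      List.append_assoc, Letter.mirror_flip, Letter.flip_flip]

lemma isGaussCode_triangleCode' (h : IsGaussCode (triangleCode' A B C D x y z t m u)) :
    IsGaussCode (triangleCode [] (C.map Letter.mirror) ((D ++ A).map Letter.mirror)
      (B.map Letter.mirror) z.flip.mirror y.flip.mirror x.flip.mirror (-u) (-m) (-t)) ∧
    codeWeight (triangleCode' A B C D x y z t m u) = -codeWeight (triangleCode []
      (C.map Letter.mirror) ((D ++ A).map Letter.mirror) (B.map Letter.mirror) z.flip.mirror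
      y.flip.mirror x.flip.mirror (-u) (-m) (-t)) := by
  obtain ⟨P, Q, h1, h2⟩ := exists_mirror_triangleCode' A B C D x y z t m u
  have h3 := h.mirror
  have h4 := h.codeWeight_mirror
  rw [h1] at h3 h4
  rw [h2, h3.codeWeight_rotate, h4, neg_neg]
  exact ⟨h3.perm List.perm_append_comm, rfl⟩

lemma isColourable_triangleCode'
    (h : IsColourable ((triangleCode' A B C D x y z t m u).map shadow)) :
    IsColourable ((triangleCode [] (C.map Letter.mirror) ((D ++ A).map Letter.mirror)
      (B.map Letter.mirror) z.flip.mirror y.flip.mirror x.flip.mirror (-u) (-m) (-t)).map shadow) := by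
  obtain ⟨P, Q, h1, h2⟩ := exists_mirror_triangleCode' A B C D x y z t m u
  rw [← map_shadow_mirror, h1, List.map_append] at h
  rw [h2, List.map_append]
  exact h.rotate

lemma codeWeight_triangleCode' (h : IsGaussCode (triangleCode' A B C D x y z t m u))
    (h' : IsGaussCode (triangleCode' A B C D x y z (-t) (-m) (-u)))
    (hc : IsColourable ((triangleCode' A B C D x y z t m u).map shadow))
    (hc' : IsColourable ((triangleCode' A B C D x y z (-t) (-m) (-u)).map shadow))
    (hx : x.isOver = true) (hy : y.isOver = true) (hz : z.isOver = true)
    (hab : t * m * x.sign = t * u * y.sign) (hbc : t * u * y.sign = m * u * z.sign) :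
    codeWeight (triangleCode' A B C D x y z (-t) (-m) (-u)) =
      codeWeight (triangleCode' A B C D x y z t m u) := by
  obtain ⟨g, e⟩ := isGaussCode_triangleCode' h
  obtain ⟨-, e'⟩ := isGaussCode_triangleCode' h'
  rw [e, e', codeWeight_triangleCode g (isColourable_triangleCode' hc) (isColourable_triangleCode' hc')]
  · simpa [Letter.mirror, Letter.flip] using hz
  · simpa [Letter.mirror, Letter.flip] using hy
  · simpa [Letter.mirror, Letter.flip] using hx
  · simp only [Letter.mirror, Letter.flip]
    rw [neg_mul_neg, neg_mul_neg, mul_neg, mul_neg, mul_comm u m, mul_comm u t, hbc]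
  · simp only [Letter.mirror, Letter.flip]
    rw [neg_mul_neg, neg_mul_neg, mul_neg, mul_neg, mul_comm m t, mul_comm u t, hab]

end Mirror

/-! ### The triple sum as a knot invariant. -/

/-- The sum of the weights is invariant under the moves between plane diagrams. -/
lemma Move.codeWeight_eq {w w' : List Letter} (hm : Move w w') (h : IsGaussCode w)
    (h' : IsGaussCode w') (hc : IsColourable (w.map shadow)) (hc' : IsColourable (w'.map shadow)) :
    codeWeight w' = codeWeight w := by
  cases hm with
  | rotate A B => exact h.codeWeight_rotate
  | relabel f A => exact codeWeight_relabel f w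
  | r1 A B x => exact codeWeight_r1 h'
  | r2_parallel A B C x y hover hsign => exact codeWeight_r2 h' rfl (Or.inl rfl) hover hsign
  | r2_antiparallel A B C x y hover hsign => exact codeWeight_r2 h' rfl (Or.inr rfl) hover hsign
  | r3 A B C D a b c εa εb εc t m u hab hbc =>
    exact codeWeight_triangleCode (x := ⟨a, true, εa⟩) (y := ⟨b, true, εb⟩) (z := ⟨c, true, εc⟩)
      h hc hc' rfl rfl rfl hab hbc
  | r3' A B C D a b c εa εb εc t m u hab hbc =>
    exact codeWeight_triangleCode' (x := ⟨a, true, εa⟩) (y := ⟨b, true, εb⟩) (z := ⟨c, true, εc⟩)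
      h h' hc hc' rfl rfl rfl hab hbc

lemma Diagram.codeWeight_eq_of_toKnot {D D' : Diagram} (h : D.toKnot = D'.toKnot) :
    codeWeight D.code = codeWeight D'.code := by
  have := Quotient.exact h
  change Relation.EqvGen _ D D' at this
  clear h
  induction this with
  | rel D D' hm =>
    exact (hm.codeWeight_eq D.isGaussCode D'.isGaussCode (D.isGaussCode.isColourable D.isPlanar)
      (D'.isGaussCode.isColourable D'.isPlanar)).symm
  | refl => rfl
  | symm _ _ _ ih => exact ih.symm
  | trans _ _ _ _ _ ih ih' => exact ih.trans ih'

/-! ### The bound -/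

/-- The right side is affine in the products of adjacent entries, whose signed sums vanish. For σ =
1 there is equality on cyclic and on transitive triangles, hence on every triple of distinct
vertices of a tournament. -/
lemma mul_weight_le {a b c σ : ℤ} (ha : a = -1 ∨ a = 0 ∨ a = 1) (hb : b = -1 ∨ b = 0 ∨ b = 1)
    (hc : c = -1 ∨ c = 0 ∨ c = 1) (hσ : σ = 1 ∨ σ = -1) :
    σ * weight a b c ≤ 2 + 2 * (σ * (a * b) + σ * (b * c) + σ * (c * a)) := by
  rcases ha with rfl | rfl | rfl <;> rcases hb with rfl | rfl | rfl <;>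
  rcases hc with rfl | rfl | rfl <;> rcases hσ with rfl | rfl <;> decide

/-- In each product of two entries one index is a free end, and summing over it produces a vanishing
row sum. The constant 2 is dropped on the triples i = j = k, which have weight zero; this gives n³ -
n instead of n³. -/
lemma sum_weight_bound {V : Finset ℕ} {s : ℕ → ℤ} {T : ℕ → ℕ → ℤ} (hskew : ∀ i j, T j i = -T i j)
    (hrow : ∀ i ∈ V, ∑ j ∈ V, s j * T i j = 0) :
    ∑ i ∈ V, ∑ j ∈ V, ∑ k ∈ V,
      ((2 - if i = j then if j = k then 2 else 0 else 0) + 2 * (s i * s j * s k * (T i j * T j k) +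
        s i * s j * s k * (T j k * T k i) + s i * s j * s k * (T k i * T i j))) =
      2 * ((V.card : ℤ) ^ 3 - V.card) := by
  have hcol : ∀ i ∈ V, ∑ j ∈ V, s j * T j i = 0 := by
    intro i hi
    simp only [hskew i, mul_neg, sum_neg_distrib, hrow i hi, neg_zero]
  have e1 : ∑ i ∈ V, ∑ j ∈ V, ∑ k ∈ V, s i * s j * s k * (T i j * T j k) = 0 := by
    refine sum_eq_zero fun i _ => sum_eq_zero fun j hj => ?_
    rw [← mul_zero (s i * s j * T i j), ← hrow j hj, mul_sum]
    exact sum_congr rfl fun k _ => by ring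
  have e2 : ∑ i ∈ V, ∑ j ∈ V, ∑ k ∈ V, s i * s j * s k * (T j k * T k i) = 0 := by
    refine sum_eq_zero fun i _ => ?_
    rw [sum_comm]
    refine sum_eq_zero fun k hk => ?_
    rw [← mul_zero (s i * s k * T k i), ← hcol k hk, mul_sum]
    exact sum_congr rfl fun j _ => by ring
  have e3 : ∑ i ∈ V, ∑ j ∈ V, ∑ k ∈ V, s i * s j * s k * (T k i * T i j) = 0 := by
    refine sum_eq_zero fun i hi => sum_eq_zero fun j _ => ?_
    rw [← mul_zero (s i * s j * T i j), ← hcol i hi, mul_sum]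
    exact sum_congr rfl fun k _ => by ring
  have e4 : ∑ i ∈ V, ∑ j ∈ V, ∑ k ∈ V, (if i = j then if j = k then (2 : ℤ) else 0 else 0) =
      2 * V.card := by
    have : ∀ i ∈ V, ∑ j ∈ V, ∑ k ∈ V, (if i = j then if j = k then (2 : ℤ) else 0 else 0) = 2 := by
      intro i hi
      rw [sum_eq_single i]
      · simp [hi]
      · intro j _ hj
        simp [hj.symm]
      · intro hi'
        exact absurd hi hi'
    rw [sum_congr rfl this, sum_const, nsmul_eq_mul, mul_comm]
  simp only [sum_add_distrib, sum_sub_distrib, ← mul_sum, e1, e2, e3, e4, sum_const, nsmul_eq_mul]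
  ring

lemma weightSum_le {V : Finset ℕ} {s : ℕ → ℤ} {T : ℕ → ℕ → ℤ} (hs : ∀ i ∈ V, s i = 1 ∨ s i = -1)
    (hT : ∀ i j, T i j = -1 ∨ T i j = 0 ∨ T i j = 1) (hskew : ∀ i j, T j i = -T i j)
    (hrow : ∀ i ∈ V, ∑ j ∈ V, s j * T i j = 0) :
    weightSum V s T ≤ 2 * ((V.card : ℤ) ^ 3 - V.card) := by
  have h0 : ∀ i, T i i = 0 := fun i => by have := hskew i i; omega
  rw [← sum_weight_bound hskew hrow]
  refine sum_le_sum fun i hi => sum_le_sum fun j hj => sum_le_sum fun k hk => ?_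
  have hσ : s i * s j * s k = 1 ∨ s i * s j * s k = -1 := by
    rcases hs i hi with e | e <;> rcases hs j hj with e' | e' <;> rcases hs k hk with e'' | e'' <;>
      rw [e, e', e''] <;> decide
  by_cases hijk : i = j ∧ j = k
  · obtain ⟨rfl, rfl⟩ := hijk
    simp [h0, weight]
  · have := mul_weight_le (hT i j) (hT j k) (hT k i) hσ
    split_ifs with e1 e2
    · exact absurd ⟨e1, e2⟩ hijk
    · simpa using this
    · simpa using this

/-- The bound is attained if all crossings interlace and have the same sign. -/
lemma weightSum_of_complete {V : Finset ℕ} {s : ℕ → ℤ} {T : ℕ → ℕ → ℤ} {ε : ℤ} (hε : ε * ε = 1)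
    (hs : ∀ i ∈ V, s i = ε) (hT : ∀ i ∈ V, ∀ j ∈ V, i ≠ j → T i j = -1 ∨ T i j = 1)
    (hskew : ∀ i j, T j i = -T i j) (hrow : ∀ i ∈ V, ∑ j ∈ V, s j * T i j = 0) :
    weightSum V s T = ε * (2 * ((V.card : ℤ) ^ 3 - V.card)) := by
  have h0 : ∀ i, T i i = 0 := fun i => by have := hskew i i; omega
  have hrow' : ∀ i ∈ V, ∑ j ∈ V, (fun _ => (1 : ℤ)) j * T i j = 0 := by
    intro i hi
    rw [← mul_zero ε, ← hrow i hi, mul_sum]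
    refine sum_congr rfl fun j hj => ?_
    rw [hs j hj, ← mul_assoc, hε]
  rw [← sum_weight_bound hskew hrow', weightSum, mul_sum]
  refine sum_congr rfl fun i hi => ?_
  rw [mul_sum]
  refine sum_congr rfl fun j hj => ?_
  rw [mul_sum]
  refine sum_congr rfl fun k hk => ?_
  rw [hs i hi, hs j hj, hs k hk, hε, one_mul]
  congr 1
  by_cases hij : i = j
  · subst hij
    by_cases hik : i = k
    · subst hik; simp [h0, weight]
    · rcases hT i hi k hk hik with e | e <;> simp [h0, hskew i k, e, hik, weight]
  by_cases hjk : j = k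
  · subst hjk
    rcases hT i hi j hj hij with e | e <;> simp [h0, hskew i j, e, hij, weight]
  by_cases hik : i = k
  · subst hik
    rcases hT i hi j hj hij with e | e <;> simp [h0, hskew i j, e, hij, weight]
  rw [if_neg hij]
  rcases hT i hi j hj hij with e | e <;> rcases hT j hj k hk hjk with e' | e' <;>
    rcases hT k hk i hi (Ne.symm hik) with e'' | e'' <;> rw [e, e', e''] <;> decide

lemma Diagram.sum_row (D : Diagram) {i : ℕ} (hi : i ∈ crossings D.code) :
    ∑ j ∈ crossings D.code, codeSign D.code j * overInterlacement D.code i j = 0 := by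
  have h := D.isGaussCode
  have := h.isCurve.sum_row (h.isColourable D.isPlanar) (shadow_fwd D.code)
    (by rw [IsGaussCode.labels_shadow]; exact hi)
  rw [IsGaussCode.labels_shadow] at this
  rw [← mul_zero (codeSign D.code i), ← this, mul_sum]
  refine sum_congr rfl fun j hj => ?_
  have hj := h.codeSign_sq hj
  rw [h.overInterlacement_eq]
  linear_combination codeSign D.code i * signedInterlacement (D.code.map shadow) i j * hj

lemma Diagram.abs_codeWeight_le (D : Diagram) :
    |codeWeight D.code| ≤ 2 * ((D.numCrossings : ℤ) ^ 3 - D.numCrossings) := by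
  have h := D.isGaussCode
  have hs : ∀ i ∈ crossings D.code, codeSign D.code i = 1 ∨ codeSign D.code i = -1 := fun i hi =>
    sq_eq_one_iff.mp (h.codeSign_sq hi)
  have hrow := fun i hi => D.sum_row (i := i) hi
  refine abs_le'.mpr ⟨weightSum_le hs h.overInterlacement_cases h.overInterlacement_skew hrow, ?_⟩
  -- Changing all signs s negates the sum and keeps the hypotheses, so the lower bound follows from
  -- the upper one.
  have : -codeWeight D.code = weightSum (crossings D.code) (fun i => -codeSign D.code i)
      (overInterlacement D.code) := by
    rw [codeWeight, weightSum, weightSum]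
    simp only [← sum_neg_distrib]
    refine sum_congr rfl fun i _ => sum_congr rfl fun j _ => sum_congr rfl fun k _ => ?_
    ring
  rw [this]
  refine weightSum_le (fun i hi => ?_) h.overInterlacement_cases h.overInterlacement_skew fun i hi => ?_
  · rcases hs i hi with e | e <;> rw [e] <;> norm_num
  · simp only [neg_mul, sum_neg_distrib, hrow i hi, neg_zero]

lemma Knot.exists_diagram (K : Knot) : ∃ D : Diagram, D.toKnot = K ∧
    D.numCrossings = K.crossingNumber := by
  obtain ⟨D, hD⟩ := Quotient.exists_rep K
  exact Nat.sInf_mem (s := {n | ∃ D : Diagram, D.toKnot = K ∧ D.numCrossings = n}) ⟨_, D, hD, rfl⟩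

lemma Diagram.crossingNumber_le (D : Diagram) : D.toKnot.crossingNumber ≤ D.numCrossings :=
  Nat.sInf_le ⟨D, rfl, rfl⟩

theorem Diagram.abs_codeWeight_le_crossingNumber (D : Diagram) :
    |codeWeight D.code| ≤ 2 * ((D.toKnot.crossingNumber : ℤ) ^ 3 - D.toKnot.crossingNumber) := by
  obtain ⟨D', h1, h2⟩ := D.toKnot.exists_diagram
  rw [← codeWeight_eq_of_toKnot h1, ← h2]
  exact D'.abs_codeWeight_le

end KnotTheory

namespace KnotTheory

open Finset

/-! ### Torus knots -/

lemma isGaussCode_append_flip {H : List Letter} (h : (H.map Letter.label).Nodup) :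
    IsGaussCode (H ++ H.map Letter.flip) := by
  have huniq : ∀ x ∈ H, ∀ y ∈ H, x.label = y.label → x = y := fun x hx y hy hl =>
    List.inj_on_of_nodup_map h hx hy hl
  have hne : ∀ x : Letter, x.flip ≠ x := by
    rintro ⟨k, b, s⟩ h
    cases b <;> simp [Letter.flip] at h
  refine ⟨List.nodup_append'.mpr ⟨h.of_map _, (h.of_map _).map
    (Function.LeftInverse.injective Letter.flip_flip), ?_⟩, ?_, ?_⟩
  · intro x hx hx'
    obtain ⟨y, hy, rfl⟩ := List.mem_map.mp hx'
    exact hne y (huniq _ hx _ hy rfl)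
  · intro x hx
    rcases List.mem_append.mp hx with hx | hx
    · exact List.mem_append_right _ (List.mem_map_of_mem hx)
    · obtain ⟨y, hy, rfl⟩ := List.mem_map.mp hx
      rw [Letter.flip_flip]
      exact List.mem_append_left _ hy
  · intro x hx y hy hl
    have key : ∀ x ∈ H ++ H.map Letter.flip, ∃ z ∈ H, z.label = x.label ∧ z.sign = x.sign := by
      intro x hx
      rcases List.mem_append.mp hx with hx | hx
      · exact ⟨x, hx, rfl, rfl⟩
      · obtain ⟨y, hy, rfl⟩ := List.mem_map.mp hx
        exact ⟨y, hy, rfl, rfl⟩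
    obtain ⟨x', hx', e1, e2⟩ := key x hx
    obtain ⟨y', hy', e3, e4⟩ := key y hy
    rw [← e2, ← e4, huniq x' hx' y' hy' (e1.trans (hl.trans e3.symm))]

/-- The sign of the crossings of a torus knot. -/
def torusSign (p : ℤ) : ℤˣ := if 0 < p then 1 else -1

/-- The first turn of a `(2,p)`-torus knot. -/
def torusHalf (p : ℤ) (n : ℕ) : List Letter := (List.range n).map fun k => ⟨k, k % 2 == 0, torusSign p⟩

variable {p : ℤ}

lemma torusCode_eq (hp : Odd p) :
    torusCode p = torusHalf p p.natAbs ++ (torusHalf p p.natAbs).map Letter.flip := by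
  have hn : p.natAbs % 2 = 1 := Nat.odd_iff.mp (Int.natAbs_odd.mpr hp)
  rw [torusCode, two_mul, List.range_add, List.map_append, torusHalf, List.map_map, List.map_map]
  congr 1
  · refine List.map_congr_left fun k hk => ?_
    rw [Nat.mod_eq_of_lt (List.mem_range.mp hk)]
    rfl
  · refine List.map_congr_left fun k hk => ?_
    simp only [Function.comp, Letter.flip, Letter.mk.injEq]
    refine ⟨?_, ?_, rfl⟩
    · rw [Nat.add_mod_left, Nat.mod_eq_of_lt (List.mem_range.mp hk)]
    · rcases Nat.mod_two_eq_zero_or_one k with h | h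
      · simp [Nat.add_mod, hn, h]
      · simp [Nat.add_mod, hn, h]

lemma map_label_torusHalf (p : ℤ) (n : ℕ) : (torusHalf p n).map Letter.label = List.range n := by
  rw [torusHalf, List.map_map]
  exact List.map_id _

lemma isGaussCode_torusCode (hp : Odd p) : IsGaussCode (torusCode p) := by
  rw [torusCode_eq hp]
  refine isGaussCode_append_flip ?_
  rw [map_label_torusHalf]
  exact List.nodup_range

lemma crossings_torusCode (hp : Odd p) : crossings (torusCode p) = range p.natAbs := by
  rw [torusCode_eq hp]
  ext k
  simp [crossings, torusHalf, Letter.flip]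

lemma overHeight_torusHalf (p : ℤ) (n : ℕ) (u : ℕ) :
    overHeight u (torusHalf p n) = if u < n then if u % 2 = 0 then 1 else -1 else 0 := by
  induction n with
  | zero => simp [torusHalf, overHeight, sum₁]
  | succ n ih =>
    have : torusHalf p (n + 1) = torusHalf p n ++ [⟨n, n % 2 == 0, torusSign p⟩] := by
      simp [torusHalf, List.range_succ]
    rw [this, overHeight_append, ih]
    have e : overHeight u [(⟨n, n % 2 == 0, torusSign p⟩ : Letter)] =
        if n = u then if n % 2 = 0 then 1 else -1 else 0 := by
      simp [overHeight, sum₁, overBranch, Letter.overSign]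
    rw [e]
    by_cases h1 : n = u
    · subst h1; simp
    · rw [if_neg h1]
      by_cases h2 : u < n
      · rw [if_pos h2, if_pos (show u < n + 1 by omega), add_zero]
      · rw [if_neg h2, if_neg (show ¬ u < n + 1 by omega), add_zero]

/-- The second turn repeats the first with over and under exchanged. The entry is therefore twice
that of the first turn minus a product of two signs, hence odd. -/
lemma overInterlacement_torusCode (hp : Odd p) {u v : ℕ} (hu : u < p.natAbs) (hv : v < p.natAbs)
    (huv : u ≠ v) :
    overInterlacement (torusCode p) u v = -1 ∨ overInterlacement (torusCode p) u v = 1 := by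
  have h1 := (isGaussCode_torusCode hp).overInterlacement_cases u v
  have h2 : ∀ k, overHeight k ((torusHalf p p.natAbs).map Letter.flip) =
      -overHeight k (torusHalf p p.natAbs) := by
    intro k
    rw [overHeight, sum₁_map]
    simp only [overBranch_flip, sum₁_neg]
    rfl
  have h3 : overInterlacement ((torusHalf p p.natAbs).map Letter.flip) u v =
      overInterlacement (torusHalf p p.natAbs) u v := by
    rw [overInterlacement_of_ne huv, overInterlacement_of_ne huv, sum₂_map]
    simp only [overBranch_flip, neg_mul_neg]
  rw [torusCode_eq hp, overInterlacement_append huv, h2, h3, overHeight_torusHalf,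
    overHeight_torusHalf, if_pos hu, if_pos hv] at h1 ⊢
  split_ifs at h1 ⊢ <;> omega

/-- The faces of the standard diagram of a torus knot: the bigons between successive crossings and
the two faces that touch all crossings. -/
def torusFace (p : ℤ) (a : ℕ × Bool) : ℕ :=
  if ((a.1 % 2 == 0) ^^ a.2 ^^ decide (0 < p)) = true then p.natAbs + a.2.toNat else a.1 % p.natAbs

lemma isPlanar_torusCode (hp : Odd p) : IsPlanar (torusCode p) := by
  have hG := isGaussCode_torusCode hp
  have hodd : p.natAbs % 2 = 1 := Nat.odd_iff.mp (Int.natAbs_odd.mpr hp)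
  -- The genus is not negative, so it suffices to find n + 2 different faces: `torusFace` is
  -- constant on faces and takes all values below n + 2.
  refine le_antisymm hG.numFaces_le ?_
  rw [crossings_torusCode hp, card_range, numFaces]
  have hlen : (torusCode p).length = 2 * p.natAbs := by simp [torusCode]
  have hget : ∀ i : Fin (torusCode p).length, (torusCode p).get i =
      ⟨i % p.natAbs, (i : ℕ) % 2 == 0, if 0 < p then 1 else -1⟩ := by
    intro i
    rw [List.get_eq_getElem]
    simp only [torusCode, List.getElem_map, List.getElem_range]
  have hlt : ∀ a, torusFace p a < p.natAbs + 2 := by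
    rintro ⟨a, s⟩
    rw [torusFace]
    have : (a, s).1 % p.natAbs < p.natAbs := Nat.mod_lt a (show 0 < p.natAbs by omega)
    split_ifs
    · cases s <;> simp
    · omega
  have hrel : ∀ a b : Fin ((torusCode p).length + 1) × Bool, FaceRel (torusCode p) a b →
      torusFace p (a.1, a.2) = torusFace p (b.1, b.2) := by
    have key : ∀ i j : Fin (torusCode p).length, (torusCode p).get j = ((torusCode p).get i).flip →
        (((torusCode p).get i).isOver = true ↔ ((torusCode p).get i).sign = 1) →
        (j : ℕ) % p.natAbs = i % p.natAbs ∧ ((j : ℕ) % 2 == 0) = !((i : ℕ) % 2 == 0) ∧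
          ((i : ℕ) % 2 == 0) = decide (0 < p) := by
      intro i j hij hi
      rw [hget, hget] at hij
      rw [hget] at hi
      simp only [Letter.flip, Letter.mk.injEq] at hij
      refine ⟨hij.1, hij.2.1, ?_⟩
      by_cases h0 : 0 < p
      · simpa [h0] using hi
      · simpa [h0] using hi
    have hsucc : ∀ k : ℕ, ((k + 1) % 2 == 0) = !(k % 2 == 0) := by
      intro k
      rcases Nat.mod_two_eq_zero_or_one k with h | h <;> simp [Nat.add_mod, h]
    intro a b hab
    cases hab with
    | base s => simp [torusFace, hlen]
    | out_out i j hij hi =>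
      obtain ⟨h1, h2, h3⟩ := key i j hij hi
      simp only [torusFace, Fin.val_succ, hsucc, h2, h3]
      have : (i + 1 : ℕ) % p.natAbs = (j + 1) % p.natAbs := by rw [Nat.add_mod, ← h1, ← Nat.add_mod]
      by_cases h0 : 0 < p <;> simp [h0, this]
    | in_out i j hij hi =>
      obtain ⟨h1, h2, h3⟩ := key i j hij hi
      simp only [torusFace, Fin.val_succ, Fin.val_castSucc, hsucc, h2, h3]
      by_cases h0 : 0 < p <;> simp [h0]
    | in_in i j hij hi =>
      obtain ⟨h1, h2, h3⟩ := key i j hij hi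
      simp only [torusFace, Fin.val_castSucc, h2, h3]
      by_cases h0 : 0 < p <;> simp [h0, h1]
    | out_in i j hij hi =>
      obtain ⟨h1, h2, h3⟩ := key i j hij hi
      simp only [torusFace, Fin.val_succ, Fin.val_castSucc, hsucc, h2, h3]
      by_cases h0 : 0 < p <;> simp [h0]
  let f : Quot (FaceRel (torusCode p)) → Fin (p.natAbs + 2) :=
    Quot.lift (fun a => ⟨torusFace p (a.1, a.2), hlt _⟩) fun a b hab => Fin.ext (hrel a b hab)
  have hf : Function.Surjective f := by
    have hq : ∀ (k : ℕ) (s : Bool), k < 2 * p.natAbs + 1 → ∃ a, (f a : ℕ) = torusFace p (k, s) :=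
      fun k s hk => ⟨Quot.mk _ (⟨k, by omega⟩, s), rfl⟩
    rintro ⟨c, hc⟩
    suffices ∃ a, (f a : ℕ) = c from this.imp fun a ha => Fin.ext ha
    by_cases hcn : c < p.natAbs
    · obtain ⟨a, ha⟩ := hq c ((c % 2 == 0) ^^ decide (0 < p)) (by omega)
      refine ⟨a, ha.trans ?_⟩
      rw [torusFace, if_neg, Nat.mod_eq_of_lt hcn]
      cases (c % 2 == 0) <;> cases decide (0 < p) <;> simp
    · obtain ⟨s, hs⟩ : ∃ s : Bool, c = p.natAbs + s.toNat := by
        rcases (show c = p.natAbs ∨ c = p.natAbs + 1 by omega) with h | h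
        · exact ⟨false, h⟩
        · exact ⟨true, h⟩
      obtain ⟨a, ha⟩ := hq (if (s ^^ decide (0 < p)) = true then 1 else 0) s (by split_ifs <;> omega)
      refine ⟨a, ha.trans ?_⟩
      rw [torusFace, hs]
      cases s <;> by_cases h0 : 0 < p <;> simp [h0]
  simpa using Nat.card_le_card_of_surjective f hf

/-- The standard diagram of the `(2,p)`-torus knot. -/
def torusDiagram (hp : Odd p) : Diagram := ⟨torusCode p, isGaussCode_torusCode hp, isPlanar_torusCode hp⟩

lemma numCrossings_torusDiagram (hp : Odd p) : (torusDiagram hp).numCrossings = p.natAbs := by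
  rw [Diagram.numCrossings, torusDiagram, crossings_torusCode hp, card_range]

lemma codeWeight_torusCode (hp : Odd p) :
    codeWeight (torusCode p) = p.sign * (2 * ((p.natAbs : ℤ) ^ 3 - p.natAbs)) := by
  have hG := isGaussCode_torusCode hp
  have hp0 : p ≠ 0 := by rintro rfl; exact absurd hp (by decide)
  have hs : ∀ u ∈ crossings (torusCode p), codeSign (torusCode p) u = p.sign := by
    intro u hu
    obtain ⟨x, hx, rfl⟩ := IsGaussCode.mem_crossings.mp hu
    rw [hG.codeSign_eq hx]
    obtain ⟨k, -, rfl⟩ := List.mem_map.mp hx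
    by_cases h0 : 0 < p
    · simp [h0, Int.sign_eq_one_of_pos h0]
    · simp [h0, Int.sign_eq_neg_one_of_neg (show p < 0 by omega)]
  have hsq : p.sign * p.sign = 1 := by
    rcases lt_or_gt_of_ne hp0 with h | h
    · rw [Int.sign_eq_neg_one_of_neg h]; rfl
    · rw [Int.sign_eq_one_of_pos h]; rfl
  rw [codeWeight, weightSum_of_complete hsq hs ?_ hG.overInterlacement_skew fun i hi =>
    (torusDiagram hp).sum_row hi, crossings_torusCode hp, card_range]
  intro i hi j hj hij
  rw [crossings_torusCode hp, mem_range] at hi hj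
  exact overInterlacement_torusCode hp hi hj hij

/-- The bound itself shows that the standard diagram is minimal: its triple sum attains the bound
for n crossings, which no smaller number of crossings would allow. -/
lemma crossingNumber_torusDiagram (hp : Odd p) (h1 : p.natAbs ≠ 1) :
    (torusDiagram hp).toKnot.crossingNumber = p.natAbs := by
  have hp0 : p ≠ 0 := by rintro rfl; exact absurd hp (by decide)
  have hle := (torusDiagram hp).crossingNumber_le
  rw [numCrossings_torusDiagram] at hle
  have hb := (torusDiagram hp).abs_codeWeight_le_crossingNumber
  rw [show (torusDiagram hp).code = torusCode p from rfl, codeWeight_torusCode hp, abs_mul,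
    Int.abs_sign_of_ne_zero hp0, one_mul] at hb
  have hb := (le_abs_self _).trans hb
  set c := (torusDiagram hp).toKnot.crossingNumber
  set n := p.natAbs
  refine le_antisymm hle ?_
  by_contra hlt
  have h2 : (c : ℤ) + 1 ≤ n := by exact_mod_cast (not_le.mp hlt)
  have h3 : (2 : ℤ) ≤ n := by
    have : n ≠ 0 := Int.natAbs_ne_zero.mpr hp0
    omega
  have h4 : (0 : ℤ) ≤ c := Int.natCast_nonneg c
  -- The factorization n³ - n - (c³ - c) = (n - c)(n² + nc + c² - 1); n ≥ 2 makes the second factor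
  -- positive.
  nlinarith [mul_pos (show (0 : ℤ) < n - c by linarith)
    (show (0 : ℤ) < n ^ 2 + n * c + c ^ 2 - 1 by nlinarith [mul_nonneg (show (0 : ℤ) ≤ n by linarith) h4])]

end KnotTheory

theorem proposition3p8 :
    (∀ (K : KnotTheory.Knot) (D : KnotTheory.Diagram), D.toKnot = K →
      -(1 / 24 : ℝ) * ((K.crossingNumber : ℝ) ^ 3 - (K.crossingNumber : ℝ)) ≤ 4 * D.v3 ∧
      4 * D.v3 ≤ (1 / 24 : ℝ) * ((K.crossingNumber : ℝ) ^ 3 - (K.crossingNumber : ℝ))) ∧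
    (∀ p : ℤ, Odd p → ∃ T : KnotTheory.Diagram, T.code = KnotTheory.torusCode p ∧
      (p.natAbs ≠ 1 → T.toKnot.crossingNumber = p.natAbs) ∧
      4 * T.v3 = (p.sign : ℝ) *
        (((T.toKnot.crossingNumber : ℝ) ^ 3 - (T.toKnot.crossingNumber : ℝ)) / 24)) := by
  open KnotTheory in
  refine ⟨fun K D hD => ?_, fun p hp => ⟨torusDiagram hp, rfl, crossingNumber_torusDiagram hp, ?_⟩⟩
  · have h1 := D.v3_eq_codeWeight
    have h2 := D.abs_codeWeight_le_crossingNumber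
    rw [hD, abs_le] at h2
    have h3 : -(2 * ((K.crossingNumber : ℝ) ^ 3 - K.crossingNumber)) ≤ (codeWeight D.code : ℝ) := by
      exact_mod_cast h2.1
    have h4 : (codeWeight D.code : ℝ) ≤ 2 * ((K.crossingNumber : ℝ) ^ 3 - K.crossingNumber) := by
      exact_mod_cast h2.2
    constructor <;> linarith
  · have h1 := (torusDiagram hp).v3_eq_codeWeight
    rw [show (torusDiagram hp).code = torusCode p from rfl, codeWeight_torusCode hp] at h1
    push_cast at h1
    -- For |p| = 1 the crossing number is at most one, and c³ - c vanishes at both 0 and 1, so the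
    -- diagram need not be recognized as the unknot.
    by_cases hn : p.natAbs = 1
    · have h2 := (torusDiagram hp).crossingNumber_le
      rw [numCrossings_torusDiagram, hn] at h2
      have h3 : (((torusDiagram hp).toKnot.crossingNumber : ℝ) ^ 3 -
          (torusDiagram hp).toKnot.crossingNumber) = 0 := by
        interval_cases (torusDiagram hp).toKnot.crossingNumber <;> norm_num
      have h4 : ((p.natAbs : ℕ) : ℝ) = 1 := by rw [hn]; norm_num
      simp only [Nat.cast_natAbs, Int.cast_abs] at h4
      rw [h3]
      rw [h4] at h1
      linarith
    · rw [crossingNumber_torusDiagram hp hn]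
      simp only [Nat.cast_natAbs, Int.cast_abs] at h1 ⊢
      linarith
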